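/- Let $k$ be a field of characteristic different from $2$ and let $A$ be a cocommutative Hopf algebra over $k$, with counit $\varepsilon$, coproduct $\Delta(a)=\sum a_1\otimes a_2$ and antipode $S$ (which is then automatically bijective). Let $H^*(A,k)=\operatorname{Ext}^*_A(k,k)$ be its Hopf algebra cohomology, where $A$ acts on $k$ through $\varepsilon$, and let $HH^*(A)=\operatorname{Ext}^*_{A^e}(A,A)$, $A^e=A\otimes_k A^{op}$, be its Hochschild cohomology with the Gerstenhaber bracket $[\ ,\ ]$, which is induced by $$[f,g]=f\circ g-(-1)^{(m-1)(n-1)}g\circ f,$$ $$(f\circ g)(a_1,\dots,a_{m+n-1})=\sum_{i=1}^{m}(-1)^{(i-1)(n-1)}f(a_1,\dots,a_{i-1},g(a_i,\dots,a_{i+n-1}),a_{i+n},\dots,a_{m+n-1})$$ on Hochschild cochains $f$, $g$ of degrees $m$, $n$. Let $$\iota: H^*(A,k)\to H^*(A,A^{ad})=\operatorname{Ext}^*_A(k,A^{ad})\cong HH^*(A)$$ be the embedding given by the unit map $k\to A^{ad}$ and the Eckmann-Shapiro isomorphism, where $A^{ad}$ is $A$ with the left adjoint action $a\cdot b=\sum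 a_1bS(a_2)$. The Gerstenhaber bracket of two elements of $H^*(A,k)$ is defined as the Gerstenhaber bracket of their images under $\iota$ in $HH^*(A)$. Then this bracket is zero in positive degrees: for all $m,n\ge 1$, all $\alpha\in H^m(A,k)$ and all $\beta\in H^n(A,k)$, one has $[\iota(\alpha),\iota(\beta)]=0$ in $HH^{m+n-1}(A)$. -/

import Mathlib

open scoped TensorProduct

universe u v w x

noncomputable section

namespace HopfGerstenhaber

/-! ## Cohomology of a cochain complex in degrees `0, 1, 2, …` -/

section Cohomology

variable {C : ℕ → Type w} [∀ n, AddCommGroup (C n)] (δ : ∀ n, C n →+ C (n + 1))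

/-- The cocycles of degree `n`. -/
def cocycles (n : ℕ) : AddSubgroup (C n) := (δ n).ker

/-- The coboundaries of degree `n` (only `0` in degree `0`). -/
def coboundaries : ∀ n : ℕ, AddSubgroup (C n)
  | 0 => ⊥
  | n + 1 => (δ n).range

/-- Cohomology: cocycles modulo coboundaries. -/
abbrev Cohomology (n : ℕ) : Type w :=
  cocycles δ n ⧸ (coboundaries δ n).addSubgroupOf (cocycles δ n)

/-- The class of a cocycle. -/
def cohClass {n : ℕ} (c : cocycles δ n) : Cohomology δ n :=
  QuotientAddGroup.mk' _ c

variable {C' : ℕ → Type x} [∀ n, AddCommGroup (C' n)] (δ' : ∀ n, C' n →+ C' (n + 1))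

variable {δ δ'} in
/-- The map on cohomology induced by a map of cochain complexes. -/
def cohMap (φ : ∀ n, C n →+ C' n) (hφ : ∀ n c, δ' n (φ n c) = φ (n + 1) (δ n c)) (n : ℕ) :
    Cohomology δ n →+ Cohomology δ' n :=
  QuotientAddGroup.map _ _
    (((φ n).comp (cocycles δ n).subtype).codRestrict (cocycles δ' n) (fun c => by
      have hc : δ n c.1 = 0 := c.2
      change δ' n (φ n c.1) = 0
      rw [hφ, hc, map_zero]))
    (by
      rintro ⟨c, hc⟩ h
      have h' : c ∈ coboundaries δ n := h
      change φ n c ∈ coboundaries δ' n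
      cases n with
      | zero =>
        have h0 : c = 0 := h'
        rw [h0, map_zero]
        exact zero_mem _
      | succ n =>
        obtain ⟨b, rfl⟩ := h'
        exact ⟨φ n b, hφ n b⟩)

end Cohomology

/-! ## Bimodules and the Hochschild complex -/

section Hochschild

variable (k : Type u) [Field k] (A : Type v) [Ring A] [Algebra k A]

/-- The enveloping algebra `Aᵉ = A ⊗ Aᵒᵖ`; left modules over it are `A`-bimodules. -/
abbrev Env : Type v := A ⊗[k] Aᵐᵒᵖ

/-- `A` as a bimodule over itself: `(x ⊗ op y) • b = x * (b * y)`. -/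
instance envModule : Module (Env k A) A := TensorProduct.Algebra.module

theorem env_smul_def (x : A) (y : Aᵐᵒᵖ) (b : A) :
    (x ⊗ₜ[k] y : Env k A) • b = x * (b * y.unop) := rfl

instance envTower : IsScalarTower k (Env k A) A where
  smul_assoc r e b := by
    change TensorProduct.Algebra.moduleAux _ _ = _ • TensorProduct.Algebra.moduleAux _ _
    simp

variable (M : Type w) [AddCommGroup M] [Module k M]

/-- Hochschild `n`-cochains with values in a bimodule: `k`-multilinear maps `Aⁿ → M`. -/
abbrev Cochain (n : ℕ) : Type (max v w) := MultilinearMap k (fun _ : Fin n => A) M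

variable {k A M}

/-- The arguments `(a₀, …, a_{i-1}, g (a_i, …, a_{i+n-1}), a_{i+n}, …)`. -/
def insertArg {m n N : ℕ} (h : N + 1 = m + n) (i : Fin m) (g : Cochain k A A n)
    (a : Fin N → A) : Fin m → A := fun j =>
  if hj : j.1 < i.1 then a ⟨j.1, by omega⟩
  else if hji : j = i then g fun l => a ⟨i.1 + l.1, by omega⟩
  else a ⟨j.1 + n - 1, by omega⟩

theorem insertArg_update {m n N : ℕ} (h : N + 1 = m + n) (i : Fin m) (g : Cochain k A A n)
    (a : Fin N → A) (t : Fin N) :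
    ∃ (j : Fin m) (L : A →ₗ[k] A), ∀ z : A,
      insertArg h i g (Function.update a t z) = Function.update (insertArg h i g a) j (L z) := by
  by_cases h1 : t.1 < i.1
  · refine ⟨⟨t.1, by omega⟩, LinearMap.id, fun z => ?_⟩
    funext j
    by_cases hj : j.1 = t.1
    · have hj0 : j = ⟨t.1, by omega⟩ := Fin.ext hj
      rw [hj0]
      simp [insertArg, h1]
    · have hj' : j ≠ ⟨t.1, by omega⟩ := fun e => hj (congrArg Fin.val e)
      rw [Function.update_of_ne hj']
      unfold insertArg
      split_ifs with h2 h3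
      · exact Function.update_of_ne (fun e => hj (congrArg Fin.val e)) _ _
      · congr 1
        funext l
        exact Function.update_of_ne (fun e => by have := congrArg Fin.val e; simp at this; omega) _ _
      · have h4 : j.1 ≠ i.1 := fun e => h3 (Fin.ext e)
        exact Function.update_of_ne (fun e => by have := congrArg Fin.val e; simp at this; omega) _ _
  · by_cases h2 : t.1 < i.1 + n
    · have hl : t.1 - i.1 < n := by omega
      refine ⟨i, g.toLinearMap (fun l => a ⟨i.1 + l.1, by omega⟩) ⟨t.1 - i.1, hl⟩, fun z => ?_⟩
      funext j
      by_cases hj : j = i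
      · subst hj
        simp only [insertArg, lt_irrefl, dite_false, dite_true, Function.update_self,
          MultilinearMap.toLinearMap_apply]
        congr 1
        funext l
        by_cases hlt : l.1 = t.1 - j.1
        · obtain rfl : l = ⟨t.1 - j.1, hl⟩ := Fin.ext hlt
          have : (⟨j.1 + (t.1 - j.1), by omega⟩ : Fin N) = t := Fin.ext (by simp; omega)
          rw [Function.update_self]
          simp [this]
        · have q1 : (⟨j.1 + l.1, by omega⟩ : Fin N) ≠ t :=
            fun e => by have := congrArg Fin.val e; simp at this; omega
          have q2 : l ≠ ⟨t.1 - j.1, hl⟩ := fun e => hlt (congrArg Fin.val e)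
          rw [Function.update_of_ne q1, Function.update_of_ne q2]
      · rw [Function.update_of_ne hj]
        have h4 : j.1 ≠ i.1 := fun e => hj (Fin.ext e)
        unfold insertArg
        split_ifs with h3
        · exact Function.update_of_ne
            (fun e => by have := congrArg Fin.val e; simp at this; omega) _ _
        · exact Function.update_of_ne
            (fun e => by have := congrArg Fin.val e; simp at this; omega) _ _
    · refine ⟨⟨t.1 + 1 - n, by omega⟩, LinearMap.id, fun z => ?_⟩
      funext j
      by_cases hj : j.1 = t.1 + 1 - n
      · have hj0 : j = ⟨t.1 + 1 - n, by omega⟩ := Fin.ext hj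
        rw [hj0]
        have e1 : ¬ (t.1 + 1 - n < i.1) := by omega
        have e2 : (⟨t.1 + 1 - n, by omega⟩ : Fin m) ≠ i :=
          fun e => by have := congrArg Fin.val e; simp at this; omega
        have e3 : (⟨t.1 + 1 - n + n - 1, by omega⟩ : Fin N) = t := Fin.ext (by simp; omega)
        simp [insertArg, e1, e2, e3]
      · rw [Function.update_of_ne (fun e => hj (congrArg Fin.val e))]
        unfold insertArg
        split_ifs with h3 h4
        · exact Function.update_of_ne
            (fun e => by have := congrArg Fin.val e; simp at this; omega) _ _
        · congr 1
          funext l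
          exact Function.update_of_ne
            (fun e => by have := congrArg Fin.val e; simp at this; omega) _ _
        · have h5 : j.1 ≠ i.1 := fun e => h4 (Fin.ext e)
          exact Function.update_of_ne
            (fun e => by have := congrArg Fin.val e; simp at this; omega) _ _

/-- Partial composition: `g` is plugged into the (zero-based) `i`-th slot of `f`,
`(a₀, …) ↦ f (a₀, …, a_{i-1}, g (a_i, …, a_{i+n-1}), a_{i+n}, …)`. -/
def insertAt {m n N : ℕ} (h : N + 1 = m + n) (i : Fin m)
    (f : Cochain k A M m) (g : Cochain k A A n) : Cochain k A M N where
  toFun a := f (insertArg h i g a)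
  map_update_add' {inst} a t x y := by
    obtain rfl : inst = instDecidableEqFin N := Subsingleton.elim _ _
    obtain ⟨j, L, hL⟩ := insertArg_update h i g a t
    simp only [hL, map_add, MultilinearMap.map_update_add]
  map_update_smul' {inst} a t r x := by
    obtain rfl : inst = instDecidableEqFin N := Subsingleton.elim _ _
    obtain ⟨j, L, hL⟩ := insertArg_update h i g a t
    simp only [hL, map_smul, MultilinearMap.map_update_smul]

theorem insertAt_apply {m n N : ℕ} (h : N + 1 = m + n) (i : Fin m)
    (f : Cochain k A M m) (g : Cochain k A A n) (a : Fin N → A) :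
    insertAt h i f g a = f (insertArg h i g a) := rfl

variable [Module (Env k A) M] [IsScalarTower k (Env k A) M]

/-- Left multiplication on a bimodule, `x ↦ (b ↦ x b)`. -/
def leftAct : A →ₗ[k] M →ₗ[k] M :=
  (Algebra.lsmul k k M : Env k A →ₐ[k] Module.End k M).toLinearMap ∘ₗ
    (Algebra.TensorProduct.includeLeft : A →ₐ[k] Env k A).toLinearMap

/-- Right multiplication on a bimodule, `y ↦ (b ↦ b y)`. -/
def rightAct : A →ₗ[k] M →ₗ[k] M :=
  (Algebra.lsmul k k M : Env k A →ₐ[k] Module.End k M).toLinearMap ∘ₗ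
    (Algebra.TensorProduct.includeRight : Aᵐᵒᵖ →ₐ[k] Env k A).toLinearMap ∘ₗ
      (MulOpposite.opLinearEquiv k).toLinearMap

/-- `(a₀, …, aₙ) ↦ a₀ c (a₁, …, aₙ)`. -/
def leftTerm {n : ℕ} (c : Cochain k A M n) : Cochain k A M (n + 1) :=
  LinearMap.uncurryLeft (M := fun _ : Fin (n + 1) => A)
    { toFun := fun a => (leftAct a).compMultilinearMap c
      map_add' := fun a b => by ext; simp
      map_smul' := fun r a => by ext; simp }

/-- `(a₀, …, aₙ) ↦ c (a₀, …, a_{n-1}) aₙ`. -/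
def rightTerm {n : ℕ} (c : Cochain k A M n) : Cochain k A M (n + 1) :=
  MultilinearMap.uncurryRight (M := fun _ : Fin (n + 1) => A)
    ((rightAct (k := k) (A := A) (M := M)).flip.compMultilinearMap c)

theorem leftTerm_apply {n : ℕ} (c : Cochain k A M n) (a : Fin (n + 1) → A) :
    leftTerm c a = (a 0 ⊗ₜ[k] 1 : Env k A) • c fun i => a i.succ := rfl

theorem rightTerm_apply {n : ℕ} (c : Cochain k A M n) (a : Fin (n + 1) → A) :
    rightTerm c a =
      (1 ⊗ₜ[k] MulOpposite.op (a (Fin.last n)) : Env k A) • c fun i => a i.castSucc := rfl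

/-- `(a₀, …, aₙ) ↦ c (a₀, …, aᵢ aᵢ₊₁, …, aₙ)`. -/
def mulTerm {n : ℕ} (i : Fin n) (c : Cochain k A M n) : Cochain k A M (n + 1) :=
  insertAt (n := 2) rfl i c (MultilinearMap.mkPiAlgebraFin k 2 A)

variable (k A M) in
/-- The Hochschild differential
`(δ c)(a₀, …, aₙ) = a₀ c (a₁, …, aₙ) + ∑ᵢ (-1)ⁱ⁺¹ c (…, aᵢ aᵢ₊₁, …) + (-1)ⁿ⁺¹ c (a₀, …, a_{n-1}) aₙ`. -/
def hochschildD (n : ℕ) : Cochain k A M n →+ Cochain k A M (n + 1) where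
  toFun c := leftTerm c + ∑ i : Fin n, (-1 : k) ^ (i.1 + 1) • mulTerm i c
    + (-1 : k) ^ (n + 1) • rightTerm c
  map_zero' := by
    ext a
    simp [leftTerm_apply, rightTerm_apply, mulTerm, insertAt_apply]
  map_add' c c' := by
    ext a
    simp only [add_apply, sum_apply, smul_apply,
      leftTerm_apply, rightTerm_apply, mulTerm, insertAt_apply, smul_add, Finset.sum_add_distrib]
    abel

theorem hochschildD_apply {n : ℕ} (c : Cochain k A M n) (a : Fin (n + 1) → A) :
    hochschildD k A M n c a = (a 0 ⊗ₜ[k] 1 : Env k A) • c (fun i => a i.succ)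
      + ∑ i : Fin n, (-1 : k) ^ (i.1 + 1) •
          c (insertArg (n := 2) rfl i (MultilinearMap.mkPiAlgebraFin k 2 A) a)
      + (-1 : k) ^ (n + 1) •
          (1 ⊗ₜ[k] MulOpposite.op (a (Fin.last n)) : Env k A) • c (fun i => a i.castSucc) := by
  simp [hochschildD, leftTerm_apply, rightTerm_apply, mulTerm, insertAt_apply]

variable (k A) in
/-- Hochschild cohomology `HHⁿ(A) = Extⁿ_{Aᵉ}(A, A)`, as the cohomology of Hochschild cochains. -/
abbrev HH (n : ℕ) : Type v := Cohomology (hochschildD k A A) n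

/-- The circle product `f ∘ g = ∑ᵢ (-1)^(i (n-1)) f ∘ᵢ g` of cochains of degrees `m` and `n`,
a cochain of degree `N = m + n - 1` (note that `n + 1` and `n - 1` have the same parity). -/
def circ {m n N : ℕ} (h : N + 1 = m + n) (f : Cochain k A A m) (g : Cochain k A A n) :
    Cochain k A A N :=
  ∑ i : Fin m, (-1 : k) ^ (i.1 * (n + 1)) • insertAt h i f g

/-- The Gerstenhaber bracket of cochains, `[f, g] = f ∘ g - (-1)^((m-1)(n-1)) g ∘ f`. -/
def cochainBracket {m n N : ℕ} (h : N + 1 = m + n) (f : Cochain k A A m) (g : Cochain k A A n) :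
    Cochain k A A N :=
  circ h f g - (-1 : k) ^ ((m + 1) * (n + 1)) • circ (h.trans (Nat.add_comm m n)) g f

/-- `z ∈ HH^{m+n-1}(A)` is the Gerstenhaber bracket of `x ∈ HHᵐ(A)` and `y ∈ HHⁿ(A)`: it is
the class of the bracket of cocycles that represent `x` and `y`. -/
def IsGerstenhaberBracket {m n N : ℕ} (h : N + 1 = m + n)
    (x : HH k A m) (y : HH k A n) (z : HH k A N) : Prop :=
  ∃ (f : cocycles (hochschildD k A A) m) (g : cocycles (hochschildD k A A) n)
    (b : cocycles (hochschildD k A A) N),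
    cohClass _ f = x ∧ cohClass _ g = y ∧ b.1 = cochainBracket h f.1 g.1 ∧ cohClass _ b = z

/-! ### The bar resolution of the bimodule `A` -/

variable (k A) in
/-- The bar resolution in degree `n`: the free `Aᵉ`-module on `A^{⊗n}`, that is
`A ⊗ A^{⊗n} ⊗ A` with the last factor moved next to the first. -/
abbrev Bar (n : ℕ) : Type (max u v) := Env k A ⊗[k] (⨂[k] _ : Fin n, A)

/-- The bimodule map `Barₙ → M`, `x ⊗ (a₁, …, aₙ) ⊗ y ↦ x c(a₁, …, aₙ) y`, that corresponds
to the cochain `c`. -/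
def barExtend {n : ℕ} (c : Cochain k A M n) : Bar k A n →ₗ[Env k A] M :=
  TensorProduct.AlgebraTensorModule.lift
    (LinearMap.toSpanSingleton (Env k A) ((⨂[k] _ : Fin n, A) →ₗ[k] M) (PiTensorProduct.lift c))

theorem barExtend_tmul {n : ℕ} (c : Cochain k A M n) (e : Env k A) (a : Fin n → A) :
    barExtend c (e ⊗ₜ PiTensorProduct.tprod k a) = e • c a := by
  simp [barExtend]

variable (k A) in
/-- The universal cochain `(a₁, …, aₙ) ↦ 1 ⊗ (a₁, …, aₙ) ⊗ 1`. -/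
def barUniv (n : ℕ) : Cochain k A (Bar k A n) n :=
  (TensorProduct.mk k (Env k A) (⨂[k] _ : Fin n, A) 1).compMultilinearMap (PiTensorProduct.tprod k)

theorem barExtend_zero {n : ℕ} : barExtend (0 : Cochain k A M n) = 0 := by
  apply TensorProduct.AlgebraTensorModule.ext
  intro e t
  simp [barExtend]

theorem barExtend_add {n : ℕ} (c c' : Cochain k A M n) :
    barExtend (c + c') = barExtend c + barExtend c' := by
  apply TensorProduct.AlgebraTensorModule.ext
  intro e t
  simp [barExtend]

theorem barExtend_barUniv {n : ℕ} (c : Cochain k A M n) (a : Fin n → A) :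
    barExtend c (barUniv k A n a) = c a :=
  (barExtend_tmul c 1 a).trans (one_smul _ _)

theorem barExtend_smul {n : ℕ} (c : Cochain k A M n) (r : k) (b : Bar k A n) :
    barExtend c (r • b) = r • barExtend c b :=
  LinearMap.map_smul_of_tower (barExtend c) r b

variable (k A) in
/-- The bar differential
`1 ⊗ (a₀, …, aₙ) ⊗ 1 ↦ a₀ ⊗ (a₁, …, aₙ) ⊗ 1 + ∑ᵢ (-1)ⁱ⁺¹ 1 ⊗ (…, aᵢ aᵢ₊₁, …) ⊗ 1
  + (-1)ⁿ⁺¹ 1 ⊗ (a₀, …, a_{n-1}) ⊗ aₙ`. -/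
def barD (n : ℕ) : Bar k A (n + 1) →ₗ[Env k A] Bar k A n :=
  barExtend (hochschildD k A (Bar k A n) n (barUniv k A n))

variable (k A) in
/-- The augmentation `x ⊗ () ⊗ y ↦ x y` of the bar resolution. -/
def barAug : Bar k A 0 →ₗ[Env k A] A :=
  barExtend (MultilinearMap.constOfIsEmpty k (fun _ : Fin 0 => A) 1)

theorem barExtend_barD {n : ℕ} (c : Cochain k A M n) :
    barExtend c ∘ₗ barD k A n = barExtend (hochschildD k A M n c) := by
  have key : ∀ a : Fin (n + 1) → A,
      barExtend c (hochschildD k A (Bar k A n) n (barUniv k A n) a) = hochschildD k A M n c a := by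
    intro a
    simp only [hochschildD_apply, map_add, map_sum, barExtend_smul, map_smul, barExtend_barUniv]
  apply TensorProduct.AlgebraTensorModule.ext
  intro e t
  induction t using PiTensorProduct.induction_on with
  | smul_tprod r a =>
    simp only [TensorProduct.tmul_smul, LinearMap.comp_apply, barExtend_smul, barD, barExtend_tmul,
      map_smul, key]
  | add x y hx hy => rw [TensorProduct.tmul_add, map_add, map_add, hx, hy]

end Hochschild

/-! ## Hopf algebra cohomology and its embedding into Hochschild cohomology -/

section Hopf

variable (k : Type u) [Field k] (A : Type v) [Ring A] [HopfAlgebra k A]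

/-- The trivial `A`-module `k`. -/
def Triv (_A : Type v) : Type u := k

instance : AddCommGroup (Triv k A) := inferInstanceAs (AddCommGroup k)

/-- `a • c = ε(a) c`. -/
instance : Module A (Triv k A) :=
  Module.compHom k (Bialgebra.counitAlgHom k A).toRingHom

/-- The embedding `A → Aᵉ`, `a ↦ ∑ a₁ ⊗ S(a₂)`. -/
def deltaHom : A →ₐ[k] Env k A :=
  (Algebra.TensorProduct.map (AlgHom.id k A) (HopfAlgebra.antipodeAlgHomOp k A)).comp
    (Bialgebra.comulAlgHom k A)

/-- A bimodule `M` as a left `A`-module by restriction along `a ↦ ∑ a₁ ⊗ S(a₂)`, that is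
`a • b = ∑ a₁ b S(a₂)`. In particular `Ad k A A` is the left adjoint module. -/
def Ad (_k : Type u) (_A : Type v) (M : Type w) : Type w := M

instance (M : Type w) [AddCommGroup M] : AddCommGroup (Ad k A M) :=
  inferInstanceAs (AddCommGroup M)

instance (M : Type w) [AddCommGroup M] [Module (Env k A) M] : Module A (Ad k A M) :=
  Module.compHom M (deltaHom k A).toRingHom

variable {k A} in
/-- A bimodule map, regarded as a map of restricted `A`-modules. -/
def adMap {M : Type w} {N : Type x} [AddCommGroup M] [Module (Env k A) M]
    [AddCommGroup N] [Module (Env k A) N] (f : M →ₗ[Env k A] N) : Ad k A M →ₗ[A] Ad k A N where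
  toFun := f
  map_add' := f.map_add
  map_smul' a m := f.map_smul (deltaHom k A a) m

theorem deltaHom_smul_algebraMap (a : A) (c : k) :
    deltaHom k A a • algebraMap k A c =
      algebraMap k A (Coalgebra.counit a) * algebraMap k A c := by
  have key : ∀ t : A ⊗[k] A,
      (Algebra.TensorProduct.map (AlgHom.id k A) (HopfAlgebra.antipodeAlgHomOp k A) t : Env k A) •
        algebraMap k A c =
      LinearMap.mul' k A ((HopfAlgebra.antipode k).lTensor A t) * algebraMap k A c := by
    intro t
    induction t with
    | zero => simp
    | add x y hx hy => rw [map_add, add_smul, hx, hy, map_add, map_add, add_mul]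
    | tmul x y =>
      rw [Algebra.TensorProduct.map_tmul, env_smul_def]
      simp [mul_assoc, Algebra.commutes]
  have h := key (Coalgebra.comul a)
  rw [HopfAlgebra.mul_antipode_lTensor_comul_apply] at h
  exact h

/-- The unit map `k → A`, which is `A`-linear from the trivial to the adjoint module. -/
def unitMap : Triv k A →ₗ[A] Ad k A A where
  toFun c := algebraMap k A c
  map_add' := (algebraMap k A).map_add
  map_smul' a (c : k) := by
    change algebraMap k A (Coalgebra.counit (R := k) a * c) = deltaHom k A a • algebraMap k A c
    rw [deltaHom_smul_algebraMap, map_mul]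

/-- A projective resolution `⋯ → X₁ → X₀ → k → 0` of the trivial `A`-module. -/
structure ProjRes where
  X : ℕ → Type w
  [addCommGroup : ∀ n, AddCommGroup (X n)]
  [module : ∀ n, Module A (X n)]
  projective : ∀ n, Module.Projective A (X n)
  d : ∀ n, X (n + 1) →ₗ[A] X n
  aug : X 0 →ₗ[A] Triv k A
  aug_surjective : Function.Surjective aug
  exact_aug : Function.Exact (d 0) aug
  exact_d : ∀ n, Function.Exact (d (n + 1)) (d n)

attribute [instance] ProjRes.addCommGroup ProjRes.module

variable {k A}

/-- The differential `f ↦ f ∘ d` of the complex `Hom_A(P, M)`. -/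
def homD (P : ProjRes.{u, v, w} k A) (M : Type x) [AddCommGroup M] [Module A M] (n : ℕ) :
    (P.X n →ₗ[A] M) →+ (P.X (n + 1) →ₗ[A] M) where
  toFun f := f ∘ₗ P.d n
  map_zero' := LinearMap.zero_comp _
  map_add' _ _ := LinearMap.add_comp _ _ _

/-- `Hⁿ(A, M) = Extⁿ_A(k, M)`, computed by the projective resolution `P` of `k`. -/
abbrev HopfCoh (P : ProjRes.{u, v, w} k A) (M : Type x) [AddCommGroup M] [Module A M] (n : ℕ) :
    Type (max w x) :=
  Cohomology (homD P M) n

/-- The map `η_* : Hⁿ(A, k) → Hⁿ(A, A^{ad})` induced by the unit map. -/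
def unitCoh (P : ProjRes.{u, v, w} k A) (n : ℕ) :
    HopfCoh P (Triv k A) n →+ HopfCoh P (Ad k A A) n :=
  cohMap
    (fun _ =>
      { toFun := fun f => unitMap k A ∘ₗ f
        map_zero' := LinearMap.comp_zero _
        map_add' := fun _ _ => LinearMap.comp_add _ _ _ })
    (fun _ _ => rfl) n

/-- A chain map of `A`-modules from `P` to the restricted bar resolution that lifts the unit map
`k → A^{ad}`; it is unique up to homotopy. -/
structure UnitLift (P : ProjRes.{u, v, w} k A) where
  hom : ∀ n, P.X n →ₗ[A] Ad k A (Bar k A n)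
  comm : ∀ n, adMap (barD k A n) ∘ₗ hom (n + 1) = hom n ∘ₗ P.d n
  comm_aug : adMap (barAug k A) ∘ₗ hom 0 = unitMap k A ∘ₗ P.aug

/-- The Eckmann-Shapiro isomorphism `HHⁿ(A) = Extⁿ_{Aᵉ}(A, A) ≅ Extⁿ_A(k, A^{ad})`: restriction of
a cocycle `Barₙ → A` along `a ↦ ∑ a₁ ⊗ S(a₂)`, followed by pull back along `k → A^{ad}`. -/
def shapiro {P : ProjRes.{u, v, w} k A} (L : UnitLift P) (n : ℕ) :
    HH k A n →+ HopfCoh P (Ad k A A) n :=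
  cohMap
    (fun n =>
      { toFun := fun c => adMap (barExtend c) ∘ₗ L.hom n
        map_zero' := by
          rw [barExtend_zero]
          rfl
        map_add' := fun c c' => by
          rw [barExtend_add]
          rfl })
    (fun n c => by
      change (adMap (barExtend c) ∘ₗ L.hom n) ∘ₗ P.d n =
        adMap (barExtend (hochschildD k A A n c)) ∘ₗ L.hom (n + 1)
      rw [← barExtend_barD, LinearMap.comp_assoc, ← L.comm]
      rfl) n

/-- `x ∈ HHⁿ(A)` is the image of `α ∈ Hⁿ(A, k)` under the embedding
`Hⁿ(A, k) → Hⁿ(A, A^{ad}) ≅ HHⁿ(A)` given by the unit map and the Eckmann-Shapiro isomorphism. -/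
def IsHochschildImage {P : ProjRes.{u, v, w} k A} {n : ℕ}
    (α : HopfCoh P (Triv k A) n) (x : HH k A n) : Prop :=
  ∃ L : UnitLift P, shapiro L n x = unitCoh P n α

/-- `z` is the Gerstenhaber bracket of the Hopf algebra cohomology classes `α` and `β`:
the Gerstenhaber bracket in Hochschild cohomology of their images under the embedding. -/
def IsHopfBracket {P : ProjRes.{u, v, w} k A} {m n N : ℕ} (h : N + 1 = m + n)
    (α : HopfCoh P (Triv k A) m) (β : HopfCoh P (Triv k A) n) (z : HH k A N) : Prop :=
  ∃ (x : HH k A m) (y : HH k A n),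
    IsHochschildImage α x ∧ IsHochschildImage β y ∧ IsGerstenhaberBracket h x y z

end Hopf

end HopfGerstenhaber

end

noncomputable section

namespace HopfGerstenhaber

/-! ## Lifting and homotopies between complexes of modules -/

section Homological

/-! On cochains of words the embedding has a closed form: a cochain `φ` with values in `k` goes to
`embed`, that is `(a₁, …, aₙ) ↦ ∑ φ(a₁', …, aₙ') a₁''⋯aₙ''`. Two properties of these cochains carry
the proof.

They are exactly the colinear cochains, for the coaction on words by the product of the letters
(`embed_mem_colinear`, `embed_counitCochain`). Since `Δ` is multiplicative, colinear cochains are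
closed under insertion (`IsColinear.insertAt`), so the bracket of two embedded cocycles is again an
embedded cocycle.

The signed reversal `T = antipodeReverse`, `f ↦ ± S f(S aₙ, …, S a₁)`, fixes the class of every
embedded cocycle of positive degree (`antipodeReverse_embed_sub_mem_coboundaries`). Indeed
cocommutativity makes the reversal of the bar resolution linear for the adjoint `A`-module
structures, so it carries one lift of the unit map to another, and two lifts are homotopic. On the
other hand reversing the order of insertions produces a sign: `T[f, g] = -[Tf, Tg]`
(`antipodeReverse_cochainBracket`).

For embedded cocycles, up to coboundaries, `[f, g] ∼ T[f, g] = -[Tf, Tg] ∼ -[f, g]`. So `2[f, g]` is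
a coboundary, and `2` is invertible (`cochainBracket_embed_mem_coboundaries`).

Two supporting facts are needed. The bracket descends to cohomology: insertion is pre-Lie, hence the
bracket satisfies the Jacobi identity, and `δ = -[·, μ]` for the multiplication `μ`. And the images
defined through an arbitrary projective resolution and an arbitrary lift are the classes of `embed`
(`sub_embed_mem_coboundaries`, `isHochschildImage_embed`); this rests on the contractibility of the
bar resolution and on `fromAdCochain`, the Eckmann-Shapiro isomorphism written as a convolution. -/

theorem exists_dependent_sequence {S : ℕ → Type*} (Q : ∀ n, S n → Prop)
    (R : ∀ n, S n → S (n + 1) → Prop) (s₀ : S 0) (h₀ : Q 0 s₀)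
    (step : ∀ n s, Q n s → ∃ s', Q (n + 1) s' ∧ R n s s') :
    ∃ s : ∀ n, S n, s 0 = s₀ ∧ ∀ n, R n (s n) (s (n + 1)) := by
  choose f hQ hR using step
  let t : ∀ n, { s : S n // Q n s } := fun n =>
    Nat.rec ⟨s₀, h₀⟩ (fun n s => ⟨f n s.1 s.2, hQ n s.1 s.2⟩) n
  exact ⟨fun n => (t n).1, rfl, fun n => hR n (t n).1 (t n).2⟩

variable {R : Type*} [Ring R]

/-- Projectivity is applied to the corestriction of `g` to its range, so `g` itself need not be
surjective. -/
theorem exists_comp_eq_of_forall_exists {X Y Z : Type*} [AddCommGroup X] [Module R X]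
    [AddCommGroup Y] [Module R Y] [AddCommGroup Z] [Module R Z] [Module.Projective R X]
    (f : X →ₗ[R] Y) (g : Z →ₗ[R] Y) (h : ∀ x, ∃ z, g z = f x) :
    ∃ l : X →ₗ[R] Z, g ∘ₗ l = f := by
  obtain ⟨l, hl⟩ := Module.projective_lifting_property g.rangeRestrict
    (f.codRestrict (LinearMap.range g) h) g.surjective_rangeRestrict
  refine ⟨l, LinearMap.ext fun x => ?_⟩
  exact congrArg Subtype.val (LinearMap.congr_fun hl x)

variable {X : ℕ → Type*} [∀ n, AddCommGroup (X n)] [∀ n, Module R (X n)]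
  [∀ n, Module.Projective R (X n)] (dX : ∀ n, X (n + 1) →ₗ[R] X n)
  {Y : ℕ → Type*} [∀ n, AddCommGroup (Y n)] [∀ n, Module R (Y n)]
  (dY : ∀ n, Y (n + 1) →ₗ[R] Y n)
  {W : Type*} [AddCommGroup W] [Module R W]

theorem exists_chain_lift (hX : ∀ n x, dX n (dX (n + 1) x) = 0)
    (eX : X 0 →ₗ[R] W) (heX : ∀ x, eX (dX 0 x) = 0)
    (eY : Y 0 →ₗ[R] W) (hsurj : Function.Surjective eY)
    (hexact₀ : ∀ y, eY y = 0 → ∃ z, dY 0 z = y)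
    (hexact : ∀ n y, dY n y = 0 → ∃ z, dY (n + 1) z = y) :
    ∃ f : ∀ n, X n →ₗ[R] Y n, eY ∘ₗ f 0 = eX ∧ ∀ n, dY n ∘ₗ f (n + 1) = f n ∘ₗ dX n := by
  obtain ⟨f₀, hf₀⟩ := exists_comp_eq_of_forall_exists eX eY fun x => hsurj _
  obtain ⟨f₁, hf₁⟩ := exists_comp_eq_of_forall_exists (f₀ ∘ₗ dX 0) (dY 0) fun x => by
    apply hexact₀
    have := LinearMap.congr_fun hf₀ (dX 0 x)
    rw [heX] at this
    exact this
  -- The recursion carries two consecutive components, because the next one exists only when the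
  -- square between them commutes.
  obtain ⟨s, hs₀, hs⟩ := exists_dependent_sequence
    (S := fun n => (X n →ₗ[R] Y n) × (X (n + 1) →ₗ[R] Y (n + 1)))
    (fun n p => dY n ∘ₗ p.2 = p.1 ∘ₗ dX n)
    (fun n p q => q.1 = p.2 ∧ dY n ∘ₗ p.2 = p.1 ∘ₗ dX n) (f₀, f₁) hf₁ (by
      rintro n ⟨p, q⟩ hpq
      obtain ⟨r, hr⟩ := exists_comp_eq_of_forall_exists (q ∘ₗ dX (n + 1)) (dY (n + 1)) fun x => by
        apply hexact
        have := LinearMap.congr_fun hpq (dX (n + 1) x)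
        simpa [hX] using this
      exact ⟨(q, r), hr, rfl, hpq⟩)
  refine ⟨fun n => (s n).1, by simpa only [hs₀] using hf₀, fun n => ?_⟩
  simpa only [(hs n).1] using (hs n).2

/-- The recursion only needs `dY n ∘ h` to agree with `f n` on the image of `dX n`: then `f (n + 1)
- h ∘ dX n` takes values in cycles and lifts. No equation is recorded in degree `0`, since only
positive degrees are used later. -/
theorem exists_homotopy_of_lift_zero (hX : ∀ n x, dX n (dX (n + 1) x) = 0)
    (eY : Y 0 →ₗ[R] W)
    (hexact₀ : ∀ y, eY y = 0 → ∃ z, dY 0 z = y)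
    (hexact : ∀ n y, dY n y = 0 → ∃ z, dY (n + 1) z = y)
    (f : ∀ n, X n →ₗ[R] Y n) (hf₀ : eY ∘ₗ f 0 = 0)
    (hf : ∀ n, dY n ∘ₗ f (n + 1) = f n ∘ₗ dX n) :
    ∃ h : ∀ n, X n →ₗ[R] Y (n + 1),
      ∀ n, f (n + 1) = dY (n + 1) ∘ₗ h (n + 1) + h n ∘ₗ dX n := by
  obtain ⟨h₀, hh₀⟩ := exists_comp_eq_of_forall_exists (f 0) (dY 0) fun x =>
    hexact₀ _ (LinearMap.congr_fun hf₀ x)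
  obtain ⟨s, -, hs⟩ := exists_dependent_sequence
    (S := fun n => X n →ₗ[R] Y (n + 1))
    (fun n h => ∀ x, dY n (h (dX n x)) = f n (dX n x))
    (fun n h h' => f (n + 1) = dY (n + 1) ∘ₗ h' + h ∘ₗ dX n) h₀
    (fun x => LinearMap.congr_fun hh₀ _) (by
      intro n h hh
      obtain ⟨r, hr⟩ := exists_comp_eq_of_forall_exists (f (n + 1) - h ∘ₗ dX n) (dY (n + 1))
        fun x => by
          apply hexact
          have := LinearMap.congr_fun (hf n) x
          simp only [LinearMap.comp_apply] at this
          simp [this, hh]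
      refine ⟨r, fun x => ?_, ?_⟩
      · have := LinearMap.congr_fun hr (dX (n + 1) x)
        simpa [hX] using this
      · rw [hr, sub_add_cancel])
  exact ⟨s, hs⟩

/-- Two lifts of the same map to an exact complex are homotopic. -/
theorem exists_homotopy (hX : ∀ n x, dX n (dX (n + 1) x) = 0)
    (eY : Y 0 →ₗ[R] W)
    (hexact₀ : ∀ y, eY y = 0 → ∃ z, dY 0 z = y)
    (hexact : ∀ n y, dY n y = 0 → ∃ z, dY (n + 1) z = y)
    (f g : ∀ n, X n →ₗ[R] Y n) (h₀ : eY ∘ₗ f 0 = eY ∘ₗ g 0)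
    (hf : ∀ n, dY n ∘ₗ f (n + 1) = f n ∘ₗ dX n) (hg : ∀ n, dY n ∘ₗ g (n + 1) = g n ∘ₗ dX n) :
    ∃ h : ∀ n, X n →ₗ[R] Y (n + 1),
      ∀ n, f (n + 1) = g (n + 1) + dY (n + 1) ∘ₗ h (n + 1) + h n ∘ₗ dX n := by
  obtain ⟨h, hh⟩ := exists_homotopy_of_lift_zero dX dY hX eY hexact₀ hexact (fun n => f n - g n)
    (by rw [LinearMap.comp_sub, h₀, sub_self])
    (fun n => by rw [LinearMap.comp_sub, LinearMap.sub_comp, hf, hg])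
  exact ⟨h, fun n => by rw [add_assoc, ← hh n, add_sub_cancel]⟩

end Homological

/-! ## Insertion operations on functions of words -/

section Words

variable {k : Type*} [CommRing k] {A : Type*} {M : Type*} [AddCommGroup M] [Module k M]

/-- The sum of `H u v` over all ways to cut the word as `u ++ v`. -/
def cutSum (H : List A → List A → M) : List A → M
  | [] => H [] []
  | a :: l => H [] (a :: l) + cutSum (fun u v => H (a :: u) v) l

theorem cutSum_add (H K : List A → List A → M) (l : List A) :
    cutSum (fun u v => H u v + K u v) l = cutSum H l + cutSum K l := by
  induction l generalizing H K with
  | nil => rfl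
  | cons a l ih => simp only [cutSum, ih]; abel

theorem cutSum_smul (s : k) (H : List A → List A → M) (l : List A) :
    cutSum (fun u v => s • H u v) l = s • cutSum H l := by
  induction l generalizing H with
  | nil => rfl
  | cons a l ih => simp only [cutSum, ih, smul_add]

/-- Coassociativity of deconcatenation: both sides run over the cuts into three words. -/
theorem cutSum_cutSum (J : List A → List A → List A → M) (l : List A) :
    cutSum (fun u v => cutSum (fun v₁ v₂ => J u v₁ v₂) v) l =
      cutSum (fun w v₂ => cutSum (fun u v₁ => J u v₁ v₂) w) l := by
  induction l generalizing J with
  | nil => rfl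
  | cons a l ih =>
    simp only [cutSum, ih, cutSum_add]
    abel

/-- The sum of `F (G u :: v)` over all ways to cut the word as `u ++ v`. -/
def insertFirst (F : List A → M) (G : List A → A) (l : List A) : M :=
  cutSum (fun u v => F (G u :: v)) l

/-- The signed sum of `F (w ++ G u :: v)` over all ways to cut the word as `w ++ u ++ v`, where
each letter of `w` contributes the sign `s`. -/
def insertSum (s : k) : (List A → M) → (List A → A) → List A → M
  | F, G, [] => insertFirst F G []
  | F, G, a :: l => insertFirst F G (a :: l) + s • insertSum s (fun t => F (a :: t)) G l

theorem insertSum_add (s : k) (F F' : List A → M) (G : List A → A) (l : List A) :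
    insertSum s (fun t => F t + F' t) G l = insertSum s F G l + insertSum s F' G l := by
  induction l generalizing F F' with
  | nil => simp only [insertSum, insertFirst, cutSum_add]
  | cons a l ih => simp only [insertSum, insertFirst, cutSum_add, ih, smul_add]; abel

theorem insertSum_smul (s r : k) (F : List A → M) (G : List A → A) (l : List A) :
    insertSum s (fun t => r • F t) G l = r • insertSum s F G l := by
  induction l generalizing F with
  | nil => simp only [insertSum, insertFirst, cutSum_smul]
  | cons a l ih => simp only [insertSum, insertFirst, cutSum_smul, ih, smul_add, smul_comm s r]

/-- Insertion into a sum over cuts acts on the left or on the right part. -/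
theorem insertSum_cutSum (s : k) (H : List A → List A → M) (K : List A → A) (l : List A) :
    insertSum s (cutSum H) K l =
      cutSum (fun u v => insertSum s (fun t => H t v) K u) l +
        cutSum (fun u v => s ^ u.length • insertSum s (H u) K v) l := by
  induction l generalizing H with
  | nil =>
    simp only [insertSum, insertFirst, cutSum, List.length_nil, pow_zero, one_smul]
    abel
  | cons a l ih =>
    -- After `K u` has been put in front, the outer cut lies either before `K u`, leaving an empty
    -- left part, or somewhere behind it.
    have h1 : insertFirst (cutSum H) K (a :: l) =
        cutSum (fun u v => H [] (K u :: v)) (a :: l) +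
          cutSum (fun w v => cutSum (fun u v₁ => H (K u :: v₁) v) w) (a :: l) := by
      rw [← cutSum_cutSum (fun u v₁ v => H (K u :: v₁) v), ← cutSum_add]
      rfl
    have h2 : insertSum s (fun t => cutSum H (a :: t)) K l =
        insertSum s (fun t => H [] (a :: t)) K l +
          insertSum s (cutSum fun u v => H (a :: u) v) K l := by
      rw [← insertSum_add]
      rfl
    rw [insertSum, h1, h2, ih]
    simp only [cutSum, insertSum, insertFirst, List.length_nil, List.length_cons, pow_zero,
      one_smul, smul_add, cutSum_add, cutSum_smul, pow_succ', mul_smul]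
    abel

variable [AddCommGroup A] [Module k A]

/-- Linearity in every letter. -/
def LetterLinear (k : Type*) [CommRing k] {A M : Type*} [AddCommGroup M] [Module k M]
    [AddCommGroup A] [Module k A] (F : List A → M) : Prop :=
  ∀ u v : List A, ∃ L : A →ₗ[k] M, ∀ z, F (u ++ z :: v) = L z

theorem LetterLinear.cons {F : List A → M} (hF : LetterLinear k F) (a : A) :
    LetterLinear k fun t => F (a :: t) :=
  fun u v => hF (a :: u) v

theorem LetterLinear.map_cutSum {F : List A → M} (hF : LetterLinear k F)
    (H : List A → List A → A) (v l : List A) :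
    F (cutSum H l :: v) = cutSum (fun u w => F (H u w :: v)) l := by
  obtain ⟨L, hL⟩ := hF [] v
  simp only [List.nil_append] at hL
  induction l generalizing H with
  | nil => rfl
  | cons a l ih =>
    rw [cutSum, hL, map_add, ← hL, ← hL, ih]
    rfl

theorem LetterLinear.map_insertSum {F : List A → M} (hF : LetterLinear k F) (s : k)
    (G K : List A → A) (v l : List A) :
    F (insertSum s G K l :: v) = insertSum s (fun t => F (G t :: v)) K l := by
  induction l generalizing G with
  | nil => exact hF.map_cutSum _ _ _
  | cons a l ih =>
    obtain ⟨L, hL⟩ := hF [] v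
    simp only [List.nil_append] at hL
    rw [insertSum, insertSum, hL, map_add, map_smul, ← hL, ← hL, ih]
    congr 1
    exact hF.map_cutSum _ _ _

/-- The signed sum over insertions of `G` and, later, of `K` into `F`; a letter in front of both
contributes `r`, a letter between them `t`. -/
def insertTwo (t r : k) : (List A → M) → (List A → A) → (List A → A) → List A → M
  | F, G, K, [] => cutSum (fun u v => insertSum t (fun w => F (G u :: w)) K v) []
  | F, G, K, a :: l => cutSum (fun u v => insertSum t (fun w => F (G u :: w)) K v) (a :: l) +
      r • insertTwo t r (fun w => F (a :: w)) G K l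

/-- A cut with `u.length ≠ n` puts the letter `0` into `F` and contributes nothing, so the exponent
may be replaced by the constant `n`. -/
theorem cutSum_pow_length_smul {F : List A → M} (hF : LetterLinear k F) (t : k) {n : ℕ}
    {G : List A → A} (hG : ∀ u, u.length ≠ n → G u = 0) (K : List A → A) (l : List A) :
    cutSum (fun u v => t ^ u.length • insertSum t (fun w => F (G u :: w)) K v) l =
      t ^ n • cutSum (fun u v => insertSum t (fun w => F (G u :: w)) K v) l := by
  rw [← cutSum_smul]
  congr 1
  funext u v
  by_cases h : u.length = n
  · rw [h]
  · have h0 : (fun w => F (G u :: w)) = fun w => (0 : k) • F (G u :: w) := by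
      funext w
      obtain ⟨L, hL⟩ := hF [] w
      have := hL (G u)
      rw [List.nil_append] at this
      rw [this, hG u h, map_zero, smul_zero]
    rw [h0, insertSum_smul, zero_smul, smul_zero, smul_zero]

/-- The associator of the insertion operation. -/
theorem insertSum_insertSum {F : List A → M} (hF : LetterLinear k F) (s t : k) {n : ℕ}
    {G K : List A → A} (hG : ∀ u, u.length ≠ n → G u = 0) (l : List A) :
    insertSum t (insertSum s F G) K l =
      insertSum (s * t) F (insertSum t G K) l
        + s • insertTwo s (s * t) F K G l + t ^ n • insertTwo t (s * t) F G K l := by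
  -- With `G` at the very front, `K` lands either inside the word consumed by `G` or behind it; in
  -- the second case it has passed `n` letters, whence `t ^ n`.
  have key : ∀ {F : List A → M}, LetterLinear k F → ∀ l, insertSum t (insertFirst F G) K l =
      insertFirst F (insertSum t G K) l +
        t ^ n • cutSum (fun u v => insertSum t (fun w => F (G u :: w)) K v) l := by
    intro F hF l
    rw [← cutSum_pow_length_smul hF t hG, insertFirst]
    simp only [hF.map_insertSum]
    exact insertSum_cutSum t (fun u v => F (G u :: v)) K l
  have hfirst : ∀ (F : List A → M) (a : A) (t : List A), insertSum s F G (a :: t) =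
      insertFirst F G (a :: t) + s • insertSum s (fun w => F (a :: w)) G t := fun _ _ _ => rfl
  -- With `K` at the very front, `G` either starts there too or passes the single letter `K u`,
  -- whence the factor `s`.
  have hall : ∀ (F : List A → M) l, insertFirst (insertSum s F G) K l =
      insertFirst (insertFirst F G) K l +
        s • cutSum (fun u v => insertSum s (fun w => F (K u :: w)) G v) l := by
    intro F l
    simp only [insertFirst, hfirst, cutSum_add, cutSum_smul]
  induction l generalizing F with
  | nil =>
    have h1 := key hF []
    simp only [insertSum] at h1 ⊢
    rw [hall, h1]
    simp only [insertTwo]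
    abel
  | cons a l ih =>
    have h1 := key hF (a :: l)
    rw [insertSum] at h1 ⊢
    simp only [hfirst]
    rw [insertSum_add, insertSum_smul, ih (hF.cons a), hall, insertSum, insertTwo, insertTwo]
    rw [← sub_eq_zero] at h1 ⊢
    rw [← h1]
    module

/-- The pre-Lie identity for insertions. -/
theorem insertSum_preLie {F : List A → M} (hF : LetterLinear k F) {s t e : k} {n p : ℕ}
    {G K : List A → A} (hG : ∀ u, u.length ≠ n → G u = 0) (hK : ∀ u, u.length ≠ p → K u = 0)
    (hs : s = e * s ^ p) (ht : t ^ n = e * t) (l : List A) :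
    insertSum t (insertSum s F G) K l - insertSum (s * t) F (insertSum t G K) l =
      e • (insertSum s (insertSum t F K) G l - insertSum (s * t) F (insertSum s K G) l) := by
  -- Both associators consist of the same two `insertTwo` terms, with coefficients `s`, `t ^ n` on
  -- the left and `s ^ p`, `t` on the right; `hs` and `ht` say that these differ by the factor `e`.
  rw [insertSum_insertSum hF s t hG, insertSum_insertSum hF t s hK, mul_comm t s, ht]
  nth_rw 2 [hs]
  module

end Words

/-! ### Closed formulas for sums over cuts -/

section WordSums

variable {k : Type*} [CommRing k] {A : Type*} {M : Type*} [AddCommGroup M] [Module k M]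

theorem cutSum_eq_zero (H : List A → List A → M) (hH : ∀ u v, H u v = 0) (l : List A) :
    cutSum H l = 0 := by
  induction l generalizing H with
  | nil => exact hH _ _
  | cons a l ih => rw [cutSum, hH, ih _ fun u v => hH _ _, add_zero]

theorem cutSum_eq_of_forall_length_ne {n : ℕ} (H : List A → List A → M)
    (hH : ∀ u v, u.length ≠ n → H u v = 0) (l : List A) :
    cutSum H l = if n ≤ l.length then H (l.take n) (l.drop n) else 0 := by
  induction l generalizing H n with
  | nil =>
    by_cases hn : n = 0
    · subst hn; simp [cutSum]
    · simp [cutSum, hn, hH [] [] (by simpa using Ne.symm hn)]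
  | cons a l ih =>
    cases n with
    | zero =>
      rw [cutSum, cutSum_eq_zero _ fun u v => hH _ _ (by simp)]
      simp
    | succ n =>
      rw [cutSum, ih (n := n) _ fun u v h => hH _ _ (by simpa using h), hH _ _ (by simp)]
      simp

theorem insertSum_eq_sum_range (s : k) (F : List A → M) (G : List A → A) (l : List A) :
    insertSum s F G l = ∑ i ∈ Finset.range (l.length + 1),
      s ^ i • insertFirst (fun t => F (l.take i ++ t)) G (l.drop i) := by
  induction l generalizing F with
  | nil => simp [insertSum]
  | cons a l ih =>
    rw [List.length_cons, Finset.sum_range_succ', insertSum, ih, Finset.smul_sum, add_comm]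
    simp [pow_succ', mul_smul]

end WordSums

/-! ### Cochains as functions of words -/

section CochainWords

variable {k : Type u} [Field k] {A : Type v} [Ring A] [Algebra k A]
  {M : Type w} [AddCommGroup M] [Module k M]

/-- A cochain of degree `n` as a function of words that vanishes on words of other lengths. -/
def onWords {n : ℕ} (c : Cochain k A M n) (l : List A) : M :=
  if h : l.length = n then c fun i => l[i.1] else 0

theorem onWords_of_length_ne {n : ℕ} (c : Cochain k A M n) (l : List A) (h : l.length ≠ n) :
    onWords c l = 0 :=
  dif_neg h

theorem onWords_of_length_eq {n : ℕ} (c : Cochain k A M n) (l : List A) (h : l.length = n) :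
    onWords c l = c fun i => l[i.1] :=
  dif_pos h

theorem onWords_ofFn {n : ℕ} (c : Cochain k A M n) (a : Fin n → A) :
    onWords c (List.ofFn a) = c a := by
  rw [onWords_of_length_eq _ _ (by simp)]
  simp

theorem onWords_injective {n : ℕ} :
    Function.Injective (onWords : Cochain k A M n → List A → M) := by
  intro c c' h
  ext a
  rw [← onWords_ofFn, h, onWords_ofFn]

theorem letterLinear_onWords {n : ℕ} (c : Cochain k A M n) : LetterLinear k (onWords c) := by
  intro u v
  by_cases h : (u ++ (0 : A) :: v).length = n
  · refine ⟨c.toLinearMap (fun i => (u ++ (0 : A) :: v)[i.1])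
      ⟨u.length, by simp at h; omega⟩, fun z => ?_⟩
    rw [onWords_of_length_eq _ _ (by simpa using h), MultilinearMap.toLinearMap_apply]
    congr 1
    funext i
    by_cases hi : i.1 = u.length
    · have hi' : (⟨u.length, by simp at h; omega⟩ : Fin n) = i := Fin.ext hi.symm
      rw [hi', Function.update_self]
      simp [hi]
    · rw [Function.update_of_ne (fun e => hi (congrArg Fin.val e))]
      simp only [List.getElem_append]
      split_ifs with h1
      · rfl
      · obtain ⟨j, hj⟩ : ∃ j, i.1 - u.length = j + 1 := ⟨i.1 - u.length - 1, by omega⟩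
        simp [hj]
  · refine ⟨0, fun z => ?_⟩
    rw [onWords_of_length_ne _ _ (by simpa using h)]
    rfl

/-- The sign `(-1)^(i (n+1))` of slot `i` is one factor `(-1)^(n+1)` for each of the `i` letters in
front of it. This moves the circle product to words, where degrees no longer have to be matched and
insertions can be handled by induction on lists. -/
theorem onWords_circ {m n N : ℕ} (h : N + 1 = m + n) (f : Cochain k A A m)
    (g : Cochain k A A n) :
    onWords (circ h f g) = insertSum ((-1 : k) ^ (n + 1)) (onWords f) (onWords g) := by
  funext l
  have hterm : ∀ i ≤ l.length, insertFirst (fun t => onWords f (l.take i ++ t)) (onWords g)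
      (l.drop i) = if i + n ≤ l.length then
        onWords f (l.take i ++ onWords g ((l.drop i).take n) :: l.drop (i + n)) else 0 := by
    intro i hi
    rw [insertFirst, cutSum_eq_of_forall_length_ne (n := n)]
    · simp only [List.length_drop, List.drop_drop]
      congr 1
      simp only [eq_iff_iff]
      omega
    · intro u v hu
      obtain ⟨L, hL⟩ := letterLinear_onWords f (l.take i) v
      rw [hL, onWords_of_length_ne _ _ hu, map_zero]
  rw [insertSum_eq_sum_range]
  by_cases hl : l.length = N
  · rw [onWords_of_length_eq _ _ hl, circ]
    -- A starting position `i ≥ m` leaves fewer than `n` letters for `g`, so it contributes nothing.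
    have hsub : ∑ i ∈ Finset.range m, ((-1 : k) ^ (n + 1)) ^ i •
        insertFirst (fun t => onWords f (l.take i ++ t)) (onWords g) (l.drop i) =
        ∑ i ∈ Finset.range (l.length + 1), ((-1 : k) ^ (n + 1)) ^ i •
        insertFirst (fun t => onWords f (l.take i ++ t)) (onWords g) (l.drop i) := by
      apply Finset.sum_subset
      · intro i
        simp only [Finset.mem_range]
        omega
      · intro i hi him
        simp only [Finset.mem_range] at hi him
        rw [hterm i (by omega), if_neg (by omega), smul_zero]
    rw [← hsub, Finset.sum_range]
    simp only [sum_apply, smul_apply]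
    refine Finset.sum_congr rfl fun i _ => ?_
    rw [hterm i (by omega), if_pos (by omega), insertAt_apply, ← pow_mul, mul_comm (n + 1),
      onWords_of_length_eq f _ (by simp; omega)]
    congr 2
    funext j
    unfold insertArg
    simp only [List.getElem_append, List.length_take, List.getElem_take]
    have hi : i.1 ≤ l.length := by omega
    rcases lt_trichotomy j.1 i.1 with h1 | h1 | h1
    · rw [dif_pos h1, dif_pos (by omega)]
    · obtain rfl : j = i := Fin.ext h1
      rw [dif_neg (lt_irrefl _), dif_pos rfl, dif_neg (by omega)]
      simp only [min_eq_left hi, Nat.sub_self, List.getElem_cons_zero]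
      rw [onWords_of_length_eq g _ (by simp; omega)]
      simp
    · rw [dif_neg (by omega), dif_neg (fun e => h1.ne' (congrArg Fin.val e)), dif_neg (by omega)]
      obtain ⟨r, hr⟩ : ∃ r, j.1 = i.1 + r + 1 := ⟨j.1 - i.1 - 1, by omega⟩
      have h7 : j.1 - min i.1 l.length = r + 1 := by omega
      simp only [h7, List.getElem_cons_succ, List.getElem_drop]
      congr 1
      omega
  · rw [onWords_of_length_ne _ _ hl]
    symm
    refine Finset.sum_eq_zero fun i hi => ?_
    simp only [Finset.mem_range] at hi
    rw [hterm i (by omega)]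
    split_ifs with h1
    · rw [onWords_of_length_ne f _ (by simp; omega), smul_zero]
    · rw [smul_zero]

end CochainWords

/-! ### The pre-Lie and Jacobi identities -/

section Bracket

variable {k : Type u} [Field k] {A : Type v} [Ring A] [Algebra k A]
  {M : Type w} [AddCommGroup M] [Module k M]

/-- Isolates the dependence on `g` in one slot, so that linearity in `g` becomes linearity of the
outer cochain in that slot. -/
theorem insertArg_eq_update {m n N : ℕ} (h : N + 1 = m + n) (i : Fin m) (g : Cochain k A A n)
    (a : Fin N → A) :
    insertArg h i g a = Function.update (insertArg h i (0 : Cochain k A A n) a) i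
      (g fun l => a ⟨i.1 + l.1, by omega⟩) := by
  funext j
  by_cases hj : j = i
  · subst hj
    simp [insertArg]
  · rw [Function.update_of_ne hj]
    simp [insertArg, hj]

theorem insertAt_add_right {m n N : ℕ} (h : N + 1 = m + n) (i : Fin m) (f : Cochain k A M m)
    (g g' : Cochain k A A n) : insertAt h i f (g + g') = insertAt h i f g + insertAt h i f g' := by
  ext a
  simp only [insertAt_apply, add_apply]
  rw [insertArg_eq_update h i (g + g'), insertArg_eq_update h i g, insertArg_eq_update h i g',
    add_apply, f.map_update_add]

theorem insertAt_smul_right {m n N : ℕ} (h : N + 1 = m + n) (i : Fin m) (f : Cochain k A M m)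
    (r : k) (g : Cochain k A A n) : insertAt h i f (r • g) = r • insertAt h i f g := by
  ext a
  simp only [insertAt_apply, smul_apply]
  rw [insertArg_eq_update h i (r • g), insertArg_eq_update h i g, smul_apply, f.map_update_smul]

/-- The circle product as a bilinear map. -/
def circLin {m n N : ℕ} (h : N + 1 = m + n) :
    Cochain k A A m →ₗ[k] Cochain k A A n →ₗ[k] Cochain k A A N :=
  LinearMap.mk₂ k (circ h)
    (fun f f' g => by
      simp only [circ, ← Finset.sum_add_distrib]
      exact Finset.sum_congr rfl fun i _ => smul_add _ (insertAt h i f g) (insertAt h i f' g))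
    (fun r f g => by
      simp only [circ, Finset.smul_sum]
      exact Finset.sum_congr rfl fun i _ => smul_comm _ r (insertAt h i f g))
    (fun f g g' => by
      simp only [circ, insertAt_add_right, smul_add, Finset.sum_add_distrib])
    (fun r f g => by
      simp only [circ, insertAt_smul_right, Finset.smul_sum]
      exact Finset.sum_congr rfl fun i _ => smul_comm _ _ _)

theorem circLin_apply {m n N : ℕ} (h : N + 1 = m + n) (f : Cochain k A A m)
    (g : Cochain k A A n) : circLin h f g = circ h f g := rfl

/-- The word identity `insertSum_preLie` with letter signs `s = (-1)^(n+1)` and `t = (-1)^(p+1)`.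
The Koszul sign `e` satisfies the two required relations because squares of signs are `1`; the
product `s * t` is the letter sign of a cochain of degree `Y`. -/
theorem circ_preLie {m n p X Y Z N : ℕ} (hX : X + 1 = m + n) (hY : Y + 1 = n + p)
    (hY' : Y + 1 = p + n) (hZ : Z + 1 = m + p) (hXp : N + 1 = X + p) (hmY : N + 1 = m + Y)
    (hZn : N + 1 = Z + n) (f : Cochain k A A m) (g : Cochain k A A n) (e : Cochain k A A p) :
    circ hXp (circ hX f g) e - circ hmY f (circ hY g e) =
      (-1 : k) ^ ((n + 1) * (p + 1)) •
        (circ hZn (circ hZ f e) g - circ hmY f (circ hY' e g)) := by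
  have hs : (-1 : k) ^ (Y + 1) = (-1) ^ (n + 1) * (-1) ^ (p + 1) := by
    rw [hY, ← pow_add, show n + 1 + (p + 1) = n + p + 2 by ring, pow_add _ (n + p)]
    simp
  have key := insertSum_preLie (letterLinear_onWords f) (s := (-1 : k) ^ (n + 1))
    (t := (-1) ^ (p + 1)) (e := (-1 : k) ^ ((n + 1) * (p + 1))) (onWords_of_length_ne g)
    (onWords_of_length_ne e)
    (by
      rw [← pow_mul, ← pow_add, show (n + 1) * (p + 1) + (n + 1) * p =
        n + 1 + 2 * ((n + 1) * p) by ring, pow_add _ (n + 1), pow_mul _ 2]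
      simp)
    (by
      rw [← pow_mul, ← pow_add, show (n + 1) * (p + 1) + (p + 1) =
        (p + 1) * n + 2 * (p + 1) by ring, pow_add _ ((p + 1) * n), pow_mul _ 2]
      simp)
  apply onWords_injective
  funext l
  have h := key l
  rw [← onWords_circ hX, ← onWords_circ hY, ← onWords_circ hZ, ← onWords_circ hY', ← hs,
    ← onWords_circ hXp, ← onWords_circ hZn, ← onWords_circ hmY, ← onWords_circ hmY] at h
  by_cases hl : l.length = N
  · simpa only [onWords_of_length_eq _ _ hl, sub_apply, smul_apply] using h
  · simp only [onWords_of_length_ne _ _ hl]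

/-- The graded commutator of a pre-Lie product satisfies the Jacobi identity: three instances of the
pre-Lie identity, one for each choice of the outermost cochain, add up to it with suitable signs. -/
theorem cochainBracket_jacobi {m n p X Y Z N : ℕ} (hX : X + 1 = m + n) (hY : Y + 1 = n + p)
    (hZ : Z + 1 = m + p) (hXp : N + 1 = X + p) (hmY : N + 1 = m + Y)
    (hZn : N + 1 = Z + n) (f : Cochain k A A m) (g : Cochain k A A n) (e : Cochain k A A p) :
    cochainBracket hXp (cochainBracket hX f g) e =
      cochainBracket hmY f (cochainBracket hY g e) +
        (-1 : k) ^ ((n + 1) * (p + 1)) • cochainBracket hZn (cochainBracket hZ f e) g := by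
  have h1 := circ_preLie hX hY (by omega) hZ hXp hmY hZn f g e
  have h2 := circ_preLie (hX.trans (Nat.add_comm _ _)) hZ (by omega) hY hXp
    (by omega : N + 1 = n + Z) (hmY.trans (Nat.add_comm _ _)) g f e
  have h3 := circ_preLie (hZ.trans (Nat.add_comm _ _)) hX (by omega)
    (hY.trans (Nat.add_comm _ _)) hZn (hXp.trans (Nat.add_comm _ _))
    (hmY.trans (Nat.add_comm _ _)) e f g
  have s1 : (-1 : k) ^ ((X + 1) * (p + 1)) =
      (-1) ^ ((m + 1) * (p + 1)) * (-1) ^ ((n + 1) * (p + 1)) := by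
    rw [hX, ← pow_add, show (m + 1) * (p + 1) + (n + 1) * (p + 1) =
      (m + n) * (p + 1) + 2 * (p + 1) by ring, pow_add _ ((m + n) * (p + 1)), pow_mul _ 2]
    simp
  have s2 : (-1 : k) ^ ((m + 1) * (Y + 1)) =
      (-1) ^ ((m + 1) * (n + 1)) * (-1) ^ ((m + 1) * (p + 1)) := by
    rw [hY, ← pow_add, show (m + 1) * (n + 1) + (m + 1) * (p + 1) =
      (m + 1) * (n + p) + 2 * (m + 1) by ring, pow_add _ ((m + 1) * (n + p)), pow_mul _ 2]
    simp
  have s3 : (-1 : k) ^ ((Z + 1) * (n + 1)) =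
      (-1) ^ ((m + 1) * (n + 1)) * (-1) ^ ((n + 1) * (p + 1)) := by
    rw [hZ, ← pow_add, show (m + 1) * (n + 1) + (n + 1) * (p + 1) =
      (m + p) * (n + 1) + 2 * (n + 1) by ring, pow_add _ ((m + p) * (n + 1)), pow_mul _ 2]
    simp
  simp only [cochainBracket, s1, s2, s3, ← circLin_apply, map_sub, map_smul,
    LinearMap.sub_apply, LinearMap.smul_apply] at h1 h2 h3 ⊢
  -- Only three signs remain after `s1`, `s2`, `s3`. Once they are fixed, the identity is a
  -- combination of `h1`, `h2`, `h3` with coefficients `±1`.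
  rcases neg_one_pow_eq_or k ((m + 1) * (n + 1)) with hab | hab <;>
  rcases neg_one_pow_eq_or k ((m + 1) * (p + 1)) with hac | hac <;>
  rcases neg_one_pow_eq_or k ((n + 1) * (p + 1)) with hbc | hbc <;>
  simp only [hab, hac, hbc] at h1 h2 h3 ⊢ <;>
  first
  | linear_combination (norm := module) h1 + h2 + h3
  | linear_combination (norm := module) h1 + h2 - h3
  | linear_combination (norm := module) h1 - h2 + h3
  | linear_combination (norm := module) h1 - h2 - h3

end Bracket

/-! ### The bracket on Hochschild cohomology -/

section BracketCohomology

variable {k : Type u} [Field k] {A : Type v} [Ring A] [Algebra k A]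

/-- Inserting the multiplication into `f` gives the inner terms of the differential; inserting `f`
into its slots `0` and `1` gives the right and the left outer term. Through this formula the Jacobi
identity makes the differential a derivation of the bracket. -/
theorem hochschildD_eq_neg_bracket {n : ℕ} (f : Cochain k A A n) :
    hochschildD k A A n f =
      -cochainBracket (n := 2) rfl f (MultilinearMap.mkPiAlgebraFin k 2 A) := by
  have h0 : ∀ (h : n + 1 + 1 = 2 + n) a,
      MultilinearMap.mkPiAlgebraFin k 2 A (insertArg h 0 f a) =
        f (fun i => a i.castSucc) * a (Fin.last n) := by
    intro h a
    have e0 : insertArg h 0 f a 0 = f fun i => a i.castSucc := by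
      simp [insertArg]
      rfl
    have e1 : insertArg h 0 f a 1 = a (Fin.last n) := by
      simp [insertArg]
      congr 1
    rw [MultilinearMap.mkPiAlgebraFin_apply, ← e0, ← e1]
    simp
  have h1 : ∀ (h : n + 1 + 1 = 2 + n) a,
      MultilinearMap.mkPiAlgebraFin k 2 A (insertArg h 1 f a) =
        a 0 * f (fun i => a i.succ) := by
    intro h a
    have e0 : insertArg h 1 f a 0 = a 0 := by
      simp [insertArg]
    have e1 : insertArg h 1 f a 1 = f fun i => a i.succ := by
      simp [insertArg]
      congr 1
      funext l
      congr 1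
      ext
      simp [add_comm]
    rw [MultilinearMap.mkPiAlgebraFin_apply, ← e0, ← e1]
    simp
  have p1 : ∀ i : Fin n, (-1 : k) ^ (i.1 * (2 + 1)) = (-1) ^ i.1 := by
    intro i
    rw [mul_comm, pow_mul]
    norm_num
  have p2 : (-1 : k) ^ ((n + 1) * (2 + 1)) = (-1) ^ (n + 1) := by
    rw [mul_comm, pow_mul]
    norm_num
  have p3 : (-1 : k) ^ (n + 1) * (-1) ^ (n + 1) = 1 := by
    rw [← mul_pow]
    simp
  ext a
  rw [hochschildD_apply]
  simp only [cochainBracket, circ, neg_apply, add_apply, sub_apply, sum_apply, smul_apply, insertAt_apply,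
    Fin.sum_univ_two, p1, p2, h0, h1, env_smul_def]
  simp only [Fin.val_zero, Fin.val_one, zero_mul, pow_zero, one_smul, one_mul, mul_one,
    MulOpposite.unop_one, MulOpposite.unop_op, smul_add, smul_smul, p3, neg_smul,
    Finset.sum_neg_distrib, pow_succ (-1 : k) (_ : Fin n).1, mul_neg]
  abel

theorem cochainBracket_comm {m n N : ℕ} (h : N + 1 = m + n) (h' : N + 1 = n + m)
    (f : Cochain k A A m) (g : Cochain k A A n) :
    cochainBracket h f g = -((-1 : k) ^ ((m + 1) * (n + 1)) • cochainBracket h' g f) := by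
  have p : (-1 : k) ^ ((m + 1) * (n + 1)) * (-1) ^ ((m + 1) * (n + 1)) = 1 := by
    rw [← mul_pow]
    simp
  simp only [cochainBracket, smul_sub, smul_smul, mul_comm (n + 1), p, one_smul, neg_sub]

theorem cochainBracket_neg_left {m n N : ℕ} (h : N + 1 = m + n) (f : Cochain k A A m)
    (g : Cochain k A A n) : cochainBracket h (-f) g = -cochainBracket h f g := by
  simp only [cochainBracket, ← circLin_apply, map_neg, LinearMap.neg_apply, smul_neg]
  abel

theorem cochainBracket_zero_right {m n N : ℕ} (h : N + 1 = m + n) (f : Cochain k A A m) :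
    cochainBracket h f (0 : Cochain k A A n) = 0 := by
  simp only [cochainBracket, ← circLin_apply, map_zero, LinearMap.zero_apply, smul_zero, sub_zero]

/-- The Jacobi identity with the multiplication as third cochain; the term in which it meets `g`
vanishes because `g` is a cocycle. -/
theorem hochschildD_bracket {m n N : ℕ} (h : N + 1 = m + n) (f : Cochain k A A m)
    {g : Cochain k A A n} (hg : hochschildD k A A n g = 0) :
    hochschildD k A A N (cochainBracket h f g) =
      (-1 : k) ^ ((n + 1) * (2 + 1)) •
        cochainBracket (by omega) (hochschildD k A A m f) g := by
  have hg' : cochainBracket (n := 2) rfl g (MultilinearMap.mkPiAlgebraFin k 2 A) = 0 := by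
    rw [← neg_eq_zero, ← hochschildD_eq_neg_bracket, hg]
  rw [hochschildD_eq_neg_bracket, cochainBracket_jacobi (p := 2) (Y := n + 1) (Z := m + 1) h rfl rfl
    rfl (by omega) (by omega) f g (MultilinearMap.mkPiAlgebraFin k 2 A), hg',
    cochainBracket_zero_right, zero_add, hochschildD_eq_neg_bracket, cochainBracket_neg_left,
    smul_neg]

theorem cochainBracket_mem_cocycles {m n N : ℕ} (h : N + 1 = m + n)
    {f : Cochain k A A m} {g : Cochain k A A n} (hf : f ∈ cocycles (hochschildD k A A) m)
    (hg : g ∈ cocycles (hochschildD k A A) n) :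
    cochainBracket h f g ∈ cocycles (hochschildD k A A) N := by
  have hf' : hochschildD k A A m f = 0 := hf
  change hochschildD k A A N _ = 0
  rw [hochschildD_bracket h f hg, hf', cochainBracket_comm _ (by omega),
    cochainBracket_zero_right, smul_zero, neg_zero, smul_zero]

/-- Coboundaries are defined as a mere additive subgroup. Stability under `k` follows from linearity
of the bracket with the multiplication, and is needed for signs and for dividing by `2`. -/
theorem smul_mem_coboundaries {n : ℕ} (r : k) {f : Cochain k A A n}
    (hf : f ∈ coboundaries (hochschildD k A A) n) :
    r • f ∈ coboundaries (hochschildD k A A) n := by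
  cases n with
  | zero =>
    have h0 : f = 0 := hf
    rw [h0, smul_zero]
    exact zero_mem _
  | succ n =>
    obtain ⟨e, rfl⟩ := hf
    refine ⟨r • e, ?_⟩
    simp only [hochschildD_eq_neg_bracket, cochainBracket, ← circLin_apply, map_smul,
      LinearMap.smul_apply]
    module

theorem cochainBracket_mem_coboundaries_left {m n N : ℕ} (h : N + 1 = m + n) (hn : 0 < n)
    {f : Cochain k A A m} {g : Cochain k A A n} (hf : f ∈ coboundaries (hochschildD k A A) m)
    (hg : g ∈ cocycles (hochschildD k A A) n) :
    cochainBracket h f g ∈ coboundaries (hochschildD k A A) N := by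
  cases m with
  | zero =>
    have h0 : f = 0 := hf
    rw [h0, cochainBracket_comm _ (by omega), cochainBracket_zero_right, smul_zero, neg_zero]
    exact zero_mem _
  | succ m =>
    obtain ⟨e, rfl⟩ := hf
    -- The primitive `[e, g]` lives one degree lower; `0 < n` guarantees that this degree exists
    -- even when `e` has degree `0`.
    obtain ⟨N, rfl⟩ : ∃ N', N = N' + 1 := ⟨N - 1, by omega⟩
    have p : (-1 : k) ^ ((n + 1) * (2 + 1)) * (-1 : k) ^ ((n + 1) * (2 + 1)) = 1 := by
      rw [← mul_pow]
      simp
    have key := hochschildD_bracket (by omega : N + 1 = m + n) e hg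
    have : cochainBracket h (hochschildD k A A m e) g = (-1 : k) ^ ((n + 1) * (2 + 1)) •
        hochschildD k A A N (cochainBracket (by omega : N + 1 = m + n) e g) := by
      rw [key, smul_smul, p, one_smul]
    rw [this]
    exact smul_mem_coboundaries _ ⟨_, rfl⟩

theorem cochainBracket_mem_coboundaries_right {m n N : ℕ} (h : N + 1 = m + n) (hm : 0 < m)
    {f : Cochain k A A m} {g : Cochain k A A n} (hf : f ∈ cocycles (hochschildD k A A) m)
    (hg : g ∈ coboundaries (hochschildD k A A) n) :
    cochainBracket h f g ∈ coboundaries (hochschildD k A A) N := by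
  rw [cochainBracket_comm h (by omega)]
  exact neg_mem (smul_mem_coboundaries _
    (cochainBracket_mem_coboundaries_left _ hm hg hf))

/-- The class of the bracket of two cocycles depends only on their classes. -/
theorem cochainBracket_sub_mem_coboundaries {m n N : ℕ} (h : N + 1 = m + n) (hm : 0 < m)
    (hn : 0 < n) {f f' : Cochain k A A m} {g g' : Cochain k A A n}
    (hf' : f' ∈ cocycles (hochschildD k A A) m) (hg : g ∈ cocycles (hochschildD k A A) n)
    (hff' : f - f' ∈ coboundaries (hochschildD k A A) m)
    (hgg' : g - g' ∈ coboundaries (hochschildD k A A) n) :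
    cochainBracket h f g - cochainBracket h f' g' ∈ coboundaries (hochschildD k A A) N := by
  have e : cochainBracket h f g - cochainBracket h f' g' =
      cochainBracket h (f - f') g + cochainBracket h f' (g - g') := by
    simp only [cochainBracket, ← circLin_apply, map_sub, LinearMap.sub_apply, smul_sub]
    abel
  rw [e]
  exact add_mem (cochainBracket_mem_coboundaries_left h hn hff' hg)
    (cochainBracket_mem_coboundaries_right h hm hf' hgg')

end BracketCohomology

/-! ## Exactness of the bar resolution -/

section BarExact

variable {k : Type u} [Field k] {A : Type v} [Ring A] [Algebra k A]

/-- The regular action, which instance search would otherwise confuse with the action of `Aᵉ` on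
the first factor of `A ⊗ Aᵐᵒᵖ`. -/
scoped instance envDistribMulAction : DistribMulAction (Env k A) (Env k A) :=
  (Semiring.toModule : Module (Env k A) (Env k A)).toDistribMulAction

scoped instance barMulAction (n : ℕ) : MulAction (Env k A) (Bar k A n) :=
  (TensorProduct.leftModule : Module (Env k A) (Bar k A n)).toMulAction

theorem env_smul_barUniv {n : ℕ} (e : Env k A) (a : Fin n → A) :
    (e • barUniv k A n a : Bar k A n) = e ⊗ₜ[k] PiTensorProduct.tprod k a := by
  change e • ((1 : Env k A) ⊗ₜ[k] PiTensorProduct.tprod k a) = _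
  rw [TensorProduct.smul_tmul', smul_eq_mul, mul_one]

/-- Two linear maps on the bar resolution agree if they agree on pure tensors. -/
theorem bar_linearMap_ext {n : ℕ} {M : Type*} [AddCommMonoid M] [Module k M]
    {f g : Bar k A n →ₗ[k] M}
    (h : ∀ (x : A) (y : Aᵐᵒᵖ) (a : Fin n → A),
      f ((x ⊗ₜ[k] y) ⊗ₜ[k] PiTensorProduct.tprod k a) =
        g ((x ⊗ₜ[k] y) ⊗ₜ[k] PiTensorProduct.tprod k a)) : f = g := by
  apply TensorProduct.ext
  apply TensorProduct.ext'
  intro x y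
  ext a
  exact h x y a

/-- The values of the universal cochain generate the bar module over the enveloping algebra. -/
theorem bar_env_linearMap_ext {n : ℕ} {M : Type*} [AddCommMonoid M] [Module k M]
    [Module (Env k A) M] [IsScalarTower k (Env k A) M]
    {f g : Bar k A n →ₗ[Env k A] M}
    (h : ∀ a : Fin n → A, f (barUniv k A n a) = g (barUniv k A n a)) : f = g := by
  have : f.restrictScalars k = g.restrictScalars k := by
    apply bar_linearMap_ext
    intro x y a
    change f _ = g _
    rw [← env_smul_barUniv, map_smul, map_smul, h]
  exact LinearMap.ext fun z => LinearMap.congr_fun this z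

theorem barD_barUniv {n : ℕ} (a : Fin (n + 1) → A) :
    barD k A n (barUniv k A (n + 1) a) = hochschildD k A (Bar k A n) n (barUniv k A n) a :=
  barExtend_barUniv _ _

theorem barAug_barUniv (a : Fin 0 → A) : barAug k A (barUniv k A 0 a) = 1 :=
  barExtend_barUniv _ _

variable (k A) in
/-- Prepending a tensor factor. -/
def tprodCons (n : ℕ) : A →ₗ[k] (⨂[k] _ : Fin n, A) →ₗ[k] ⨂[k] _ : Fin (n + 1), A :=
  (PiTensorProduct.lift (R := k) (s := fun _ : Fin n => A)).toLinearMap ∘ₗ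
    (MultilinearMap.curryLeft (PiTensorProduct.tprod k (s := fun _ : Fin (n + 1) => A)))

theorem tprodCons_tprod {n : ℕ} (x : A) (a : Fin n → A) :
    tprodCons k A n x (PiTensorProduct.tprod k a) = PiTensorProduct.tprod k (Fin.cons x a) := by
  simp [tprodCons]

variable (k A) in
/-- The contracting homotopy `x ⊗ (a₁, …, aₙ) ⊗ y ↦ 1 ⊗ (x, a₁, …, aₙ) ⊗ y`. -/
def barHomotopy (n : ℕ) : Bar k A n →ₗ[k] Bar k A (n + 1) :=
  TensorProduct.lift (TensorProduct.lift
    (LinearMap.mk₂ k (fun x y => TensorProduct.mk k (Env k A) _ ((1 : A) ⊗ₜ[k] y) ∘ₗ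
        tprodCons k A n x)
      (fun x x' y => by ext; simp [TensorProduct.tmul_add])
      (fun r x y => by ext; simp)
      (fun x y y' => by ext; simp [TensorProduct.tmul_add])
      (fun r x y => by ext; simp [TensorProduct.smul_tmul'])))

theorem barHomotopy_tmul {n : ℕ} (x : A) (y : Aᵐᵒᵖ) (a : Fin n → A) :
    barHomotopy k A n ((x ⊗ₜ[k] y) ⊗ₜ[k] PiTensorProduct.tprod k a) =
      ((1 : A) ⊗ₜ[k] y) ⊗ₜ[k] PiTensorProduct.tprod k (Fin.cons x a) := by
  simp [barHomotopy, tprodCons_tprod]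

variable (k A) in
/-- The contraction `y ↦ 1 ⊗ () ⊗ y` of the augmentation. -/
def barSection : A →ₗ[k] Bar k A 0 :=
  (TensorProduct.mk k (Env k A) (⨂[k] _ : Fin 0, A)).flip
    (PiTensorProduct.tprod k Fin.elim0) ∘ₗ TensorProduct.mk k A Aᵐᵒᵖ 1 ∘ₗ
      (MulOpposite.opLinearEquiv k).toLinearMap

theorem barD_tmul {n : ℕ} (x y : A) (a : Fin (n + 1) → A) :
    barD k A n ((x ⊗ₜ[k] MulOpposite.op y) ⊗ₜ[k] PiTensorProduct.tprod k a) =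
      ((x * a 0) ⊗ₜ[k] MulOpposite.op y) ⊗ₜ[k] PiTensorProduct.tprod k (fun i => a i.succ)
      + ∑ i : Fin n, (-1 : k) ^ (i.1 + 1) •
          ((x ⊗ₜ[k] MulOpposite.op y) ⊗ₜ[k] PiTensorProduct.tprod k
            (insertArg (n := 2) rfl i (MultilinearMap.mkPiAlgebraFin k 2 A) a))
      + (-1 : k) ^ (n + 1) •
        ((x ⊗ₜ[k] MulOpposite.op (a (Fin.last n) * y)) ⊗ₜ[k]
          PiTensorProduct.tprod k (fun i => a i.castSucc)) := by
  have hc : ∀ (r : k) (e : Env k A) (b : Bar k A n), e • r • b = r • e • b :=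
    fun r e b => smul_comm _ _ _
  rw [barD, barExtend_tmul, hochschildD_apply, smul_add, smul_add, smul_smul, Finset.smul_sum,
    hc, smul_smul]
  simp only [hc, env_smul_barUniv, Algebra.TensorProduct.tmul_mul_tmul, mul_one, ← MulOpposite.op_mul]

theorem insertArg_cons_succ {n : ℕ} (i : Fin n) (x : A) (a : Fin (n + 1) → A) :
    insertArg (n := 2) rfl i.succ (MultilinearMap.mkPiAlgebraFin k 2 A)
        (Fin.cons x a : Fin (n + 2) → A) =
      Fin.cons x (insertArg (n := 2) rfl i (MultilinearMap.mkPiAlgebraFin k 2 A) a) := by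
  funext j
  refine Fin.cases ?_ (fun j => ?_) j
  · simp [insertArg]
  · simp only [Fin.cons_succ]
    unfold insertArg
    simp only [Fin.val_succ, Nat.add_lt_add_iff_right, Fin.succ_inj]
    split_ifs with h1 h2
    · rfl
    · congr 1
      funext l
      have : (⟨i.1 + 1 + l.1, by omega⟩ : Fin (n + 2)) =
        Fin.succ ⟨i.1 + l.1, by omega⟩ := Fin.ext (by simp; omega)
      rw [this, Fin.cons_succ]
    · have : (⟨j.1 + 1 + 2 - 1, by omega⟩ : Fin (n + 2)) =
        Fin.succ ⟨j.1 + 2 - 1, by omega⟩ := Fin.ext (by simp)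
      rw [this, Fin.cons_succ]

theorem insertArg_cons_zero {n : ℕ} (x : A) (a : Fin (n + 1) → A) :
    insertArg (n := 2) rfl 0 (MultilinearMap.mkPiAlgebraFin k 2 A)
        (Fin.cons x a : Fin (n + 2) → A) = Fin.cons (x * a 0) (fun i => a i.succ) := by
  funext j
  refine Fin.cases ?_ (fun j => ?_) j
  · simp [insertArg]
  · simp [insertArg]
    have : (⟨j.1 + 2, by omega⟩ : Fin (n + 2)) = Fin.succ j.succ := Fin.ext (by simp)
    rw [this, Fin.cons_succ]

/-- The sign pattern of `d h + h d = 1`: `p` is the face that undoes `h`, and the faces `q`, `s`,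
`r` of `h b` cancel against the images under `h` of the faces of `b`. -/
theorem alternating_sum_cancel {V : Type*} [AddCommGroup V] [Module k V] {n : ℕ} (p q r : V)
    (s : Fin n → V) :
    p + ((-1 : k) ^ (0 + 1) • q + ∑ i : Fin n, (-1 : k) ^ (i.1 + 1 + 1) • s i)
      + (-1 : k) ^ (n + 1 + 1) • r
      + (q + ∑ i : Fin n, (-1 : k) ^ (i.1 + 1) • s i + (-1 : k) ^ (n + 1) • r) = p := by
  simp only [pow_succ _ (_ + 1), mul_neg, mul_one, neg_smul, Finset.sum_neg_distrib]
  rw [zero_add, pow_one]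
  module

/-- The extra degeneracy contracts the bar complex: moving the left coefficient into the word adds
one face, which moves it back, while all other faces cancel. The contraction is only `k`-linear. -/
theorem barD_barHomotopy (n : ℕ) (b : Bar k A (n + 1)) :
    barD k A (n + 1) (barHomotopy k A (n + 1) b) + barHomotopy k A n (barD k A n b) = b := by
  have : (barD k A (n + 1)).restrictScalars k ∘ₗ barHomotopy k A (n + 1) +
      barHomotopy k A n ∘ₗ (barD k A n).restrictScalars k = LinearMap.id := by
    apply bar_linearMap_ext
    intro x y a
    obtain ⟨y, rfl⟩ := MulOpposite.op_surjective y
    simp only [LinearMap.add_apply, LinearMap.comp_apply, LinearMap.restrictScalars_apply,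
      LinearMap.id_apply]
    rw [barHomotopy_tmul, barD_tmul, barD_tmul, Fin.sum_univ_succ]
    simp only [map_add, map_sum, map_smul, barHomotopy_tmul, insertArg_cons_succ,
      insertArg_cons_zero, Fin.cons_succ, Fin.cons_zero, one_mul, Fin.val_zero, Fin.val_succ]
    have h1 : (Fin.cons x a : Fin (n + 2) → A) (Fin.last (n + 1)) = a (Fin.last n) := by
      rw [← Fin.succ_last, Fin.cons_succ]
    have h2 : (fun i : Fin (n + 1) => (Fin.cons x a : Fin (n + 2) → A) i.castSucc) =
        Fin.cons x fun i => a i.castSucc := by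
      funext i
      refine Fin.cases rfl (fun i => ?_) i
      rw [← Fin.succ_castSucc, Fin.cons_succ, Fin.cons_succ]
    rw [h1, h2]
    exact alternating_sum_cancel (k := k) (V := Bar k A (n + 1)) _ _ _ _
  exact LinearMap.congr_fun this b

theorem neg_one_smul_cancel {V : Type*} [AddCommGroup V] [Module k V] (p q : V) :
    p + (-1 : k) • q + q = p := by
  module

theorem barD_barHomotopy_zero (b : Bar k A 0) :
    barD k A 0 (barHomotopy k A 0 b) + barSection k A (barAug k A b) = b := by
  have : (barD k A 0).restrictScalars k ∘ₗ barHomotopy k A 0 +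
      barSection k A ∘ₗ (barAug k A).restrictScalars k = LinearMap.id := by
    apply bar_linearMap_ext
    intro x y a
    obtain ⟨y, rfl⟩ := MulOpposite.op_surjective y
    have ha : ∀ a' : Fin 0 → A, a' = a := fun a' => Subsingleton.elim _ _
    have h1 : barAug k A ((x ⊗ₜ[k] MulOpposite.op y) ⊗ₜ[k] PiTensorProduct.tprod k a) = x * y := by
      rw [barAug, barExtend_tmul]
      change (x ⊗ₜ[k] MulOpposite.op y : Env k A) • (1 : A) = x * y
      rw [env_smul_def]
      simp
    simp only [LinearMap.add_apply, LinearMap.comp_apply, LinearMap.restrictScalars_apply,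
      LinearMap.id_apply]
    rw [barHomotopy_tmul, barD_tmul, h1]
    simp only [ha, barSection, LinearMap.comp_apply]
    simp
    exact neg_one_smul_cancel (k := k) (V := Bar k A 0) _ _
  exact LinearMap.congr_fun this b

theorem barAug_barSection (x : A) : barAug k A (barSection k A x) = x := by
  change barAug k A ((1 ⊗ₜ[k] MulOpposite.op x) ⊗ₜ[k] PiTensorProduct.tprod k Fin.elim0) = x
  rw [barAug, barExtend_tmul]
  change ((1 : A) ⊗ₜ[k] MulOpposite.op x : Env k A) • (1 : A) = x
  rw [env_smul_def]
  simp

theorem barAug_surjective : Function.Surjective (barAug k A) :=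
  fun x => ⟨_, barAug_barSection x⟩

theorem barUniv_eq_barHomotopy {n : ℕ} (a : Fin (n + 1) → A) :
    barUniv k A (n + 1) a = barHomotopy k A n
      ((a 0 ⊗ₜ[k] 1) ⊗ₜ[k] PiTensorProduct.tprod k fun i => a i.succ) := by
  rw [barHomotopy_tmul]
  change _ = (1 : Env k A) ⊗ₜ[k] _
  have : (Fin.cons (a 0) fun i => a i.succ : Fin (n + 1) → A) = a := Fin.cons_self_tail a
  rw [this]
  rfl

theorem eq_zero_of_add_eq_right {V : Type*} [AddCommGroup V] {p q : V} (h : p + q = q) : p = 0 :=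
  add_eq_right.mp h

theorem barAug_barD (b : Bar k A 1) : barAug k A (barD k A 0 b) = 0 := by
  have : barAug k A ∘ₗ barD k A 0 = 0 := by
    apply bar_env_linearMap_ext
    intro a
    rw [barUniv_eq_barHomotopy]
    have h := congrArg (barAug k A) (barD_barHomotopy_zero
      ((a 0 ⊗ₜ[k] 1) ⊗ₜ[k] PiTensorProduct.tprod k fun i => a i.succ))
    rw [map_add, barAug_barSection] at h
    exact eq_zero_of_add_eq_right h
  exact LinearMap.congr_fun this b

/-- Deduced from the contraction instead of the simplicial identities. Each generator is some `h b`,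
and applying `d` to `d h b + h d b = b` leaves `d d h b = d b - d h d b`. This vanishes since `d h d
= d`, by the contraction one degree lower and the induction hypothesis. -/
theorem barD_barD (n : ℕ) (b : Bar k A (n + 2)) : barD k A n (barD k A (n + 1) b) = 0 := by
  have key : ∀ (n : ℕ), (∀ c, barD k A n (barHomotopy k A n (barD k A n c)) = barD k A n c) →
      ∀ b, barD k A n (barD k A (n + 1) b) = 0 := by
    intro n hn b
    have : barD k A n ∘ₗ barD k A (n + 1) = 0 := by
      apply bar_env_linearMap_ext
      intro a
      rw [barUniv_eq_barHomotopy]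
      have h := congrArg (barD k A n) (barD_barHomotopy n
        ((a 0 ⊗ₜ[k] 1) ⊗ₜ[k] PiTensorProduct.tprod k fun i => a i.succ))
      rw [map_add, hn] at h
      exact eq_zero_of_add_eq_right (V := Bar k A n) h
    exact LinearMap.congr_fun this b
  induction n with
  | zero =>
    refine key 0 (fun c => ?_) b
    have h := barD_barHomotopy_zero (barD k A 0 c)
    rwa [barAug_barD, map_zero, add_zero] at h
  | succ n ih =>
    refine key (n + 1) (fun c => ?_) b
    have h := barD_barHomotopy n (barD k A (n + 1) c)
    rwa [ih, map_zero, add_zero] at h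

theorem exists_barD_eq_of_barAug_eq_zero (b : Bar k A 0) (hb : barAug k A b = 0) :
    ∃ c, barD k A 0 c = b := by
  have := barD_barHomotopy_zero b
  rw [hb, map_zero, add_zero] at this
  exact ⟨_, this⟩

theorem exists_barD_eq_of_barD_eq_zero (n : ℕ) (b : Bar k A (n + 1)) (hb : barD k A n b = 0) :
    ∃ c, barD k A (n + 1) c = b := by
  have := barD_barHomotopy n b
  rw [hb, map_zero, add_zero] at this
  exact ⟨_, this⟩

variable {M : Type w} [AddCommGroup M] [Module k M] [Module (Env k A) M]
  [IsScalarTower k (Env k A) M]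

/-- Cochains are bimodule maps on the bar resolution, where the differential becomes composition
with `barD`. -/
theorem hochschildD_hochschildD {n : ℕ} (c : Cochain k A M n) :
    hochschildD k A M (n + 1) (hochschildD k A M n c) = 0 := by
  ext a
  rw [← barExtend_barUniv (hochschildD k A M (n + 1) _), ← barExtend_barD, ← barExtend_barD,
    LinearMap.comp_apply, LinearMap.comp_apply, barD_barD, map_zero]
  rfl

/-- A map of bimodules commutes with the Hochschild differential. -/
theorem hochschildD_comp {M' : Type x} [AddCommGroup M'] [Module k M'] [Module (Env k A) M']
    [IsScalarTower k (Env k A) M'] (f : M →ₗ[Env k A] M') {n : ℕ} (c : Cochain k A M n) :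
    hochschildD k A M' n ((f.restrictScalars k).compMultilinearMap c) =
      (f.restrictScalars k).compMultilinearMap (hochschildD k A M n c) := by
  ext a
  simp only [hochschildD_apply, LinearMap.compMultilinearMap_apply,
    LinearMap.restrictScalars_apply, map_add, map_sum, map_smul]

end BarExact

/-! ## The tensor algebra of a bialgebra as a coalgebra of words -/

section WordCoalgebra

variable {k : Type u} [Field k] {A : Type v} [Ring A]

theorem tensorAlgebra_linearMap_ext [Algebra k A] {M : Type*} [AddCommMonoid M] [Module k M]
    {f g : TensorAlgebra k A →ₗ[k] M}
    (h : ∀ n (a : Fin n → A), f (TensorAlgebra.tprod k A n a) = g (TensorAlgebra.tprod k A n a)) :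
    f = g := by
  have : f ∘ₗ TensorAlgebra.ofDirectSum.toLinearMap =
      g ∘ₗ TensorAlgebra.ofDirectSum.toLinearMap := by
    apply DirectSum.linearMap_ext
    intro n
    apply PiTensorProduct.ext
    ext a
    simpa [DirectSum.lof_eq_of, -TensorAlgebra.tprod_apply] using h n a
  ext t
  rw [← TensorAlgebra.ofDirectSum_toDirectSum t]
  exact LinearMap.congr_fun this _

/-- A multilinear map as a linear map on the tensor algebra that vanishes in other degrees. -/
def wordMap [Algebra k A] {M : Type*} [AddCommMonoid M] [Module k M] {n : ℕ}
    (c : MultilinearMap k (fun _ : Fin n => A) M) : TensorAlgebra k A →ₗ[k] M :=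
  PiTensorProduct.lift c ∘ₗ DirectSum.component k ℕ (fun n => ⨂[k] _ : Fin n, A) n ∘ₗ
    TensorAlgebra.toDirectSum.toLinearMap

theorem wordMap_tprod [Algebra k A] {M : Type*} [AddCommMonoid M] [Module k M] {n : ℕ}
    (c : MultilinearMap k (fun _ : Fin n => A) M) (a : Fin n → A) :
    wordMap c (TensorAlgebra.tprod k A n a) = c a := by
  simp only [wordMap, LinearMap.comp_apply, AlgHom.toLinearMap_apply,
    TensorAlgebra.toDirectSum_tensorPower_tprod, ← DirectSum.lof_eq_of k]
  rw [DirectSum.component.lof_self, PiTensorProduct.lift.tprod]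

theorem wordMap_tprod_of_ne [Algebra k A] {M : Type*} [AddCommMonoid M] [Module k M] {n m : ℕ}
    (c : MultilinearMap k (fun _ : Fin n => A) M) (a : Fin m → A) (h : m ≠ n) :
    wordMap c (TensorAlgebra.tprod k A m a) = 0 := by
  simp only [wordMap, LinearMap.comp_apply, AlgHom.toLinearMap_apply,
    TensorAlgebra.toDirectSum_tensorPower_tprod, ← DirectSum.lof_eq_of k]
  rw [DirectSum.component.of, dif_neg h, map_zero]

/-- The multilinear map `(p₁ ⊗ q₁, …, pₙ ⊗ qₙ) ↦ F (p₁ ⋯ pₙ) ⊗ G (q₁ ⋯ qₙ)`. -/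
def pairMap [Algebra k A] {M M' : Type*} [AddCommMonoid M] [Module k M] [AddCommMonoid M']
    [Module k M'] (F : TensorAlgebra k A →ₗ[k] M) (G : TensorAlgebra k A →ₗ[k] M') (n : ℕ) :
    MultilinearMap k (fun _ : Fin n => A ⊗[k] A) (M ⊗[k] M') :=
  (TensorProduct.map F G).compMultilinearMap
    ((MultilinearMap.mkPiAlgebraFin k n (TensorAlgebra k A ⊗[k] TensorAlgebra k A)).compLinearMap
      fun _ => TensorProduct.map (TensorAlgebra.ι k) (TensorAlgebra.ι k))

theorem list_prod_ofFn_tmul {B C : Type*} [Semiring B] [Algebra k B] [Semiring C] [Algebra k C]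
    {n : ℕ} (p : Fin n → B) (q : Fin n → C) :
    (List.ofFn fun i => (p i ⊗ₜ[k] q i : B ⊗[k] C)).prod =
      (List.ofFn p).prod ⊗ₜ[k] (List.ofFn q).prod := by
  induction n with
  | zero => simp [Algebra.TensorProduct.one_def]
  | succ n ih => simp [List.ofFn_succ, ih]

theorem pairMap_tmul [Algebra k A] {M M' : Type*} [AddCommMonoid M] [Module k M]
    [AddCommMonoid M'] [Module k M'] (F : TensorAlgebra k A →ₗ[k] M)
    (G : TensorAlgebra k A →ₗ[k] M') {n : ℕ} (p q : Fin n → A) :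
    pairMap F G n (fun i => p i ⊗ₜ[k] q i) =
      F (TensorAlgebra.tprod k A n p) ⊗ₜ[k] G (TensorAlgebra.tprod k A n q) := by
  simp [pairMap, list_prod_ofFn_tmul]

/-- Multilinear maps on tensor products agree if they agree on pure tensors. -/
theorem multilinearMap_tmul_ext {B C M : Type*} [AddCommMonoid B] [Module k B]
    [AddCommMonoid C] [Module k C] [AddCommMonoid M] [Module k M] {n : ℕ}
    {f g : MultilinearMap k (fun _ : Fin n => B ⊗[k] C) M}
    (h : ∀ (p : Fin n → B) (q : Fin n → C),
      f (fun i => p i ⊗ₜ[k] q i) = g (fun i => p i ⊗ₜ[k] q i)) : f = g := by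
  induction n with
  | zero =>
    ext a
    have := h Fin.elim0 Fin.elim0
    rwa [Subsingleton.elim (fun i : Fin 0 => _) a] at this
  | succ n ih =>
    have : f.curryLeft = g.curryLeft := by
      apply TensorProduct.ext'
      intro x y
      apply ih
      intro p q
      have := h (Fin.cons x p) (Fin.cons y q)
      have e : (fun i : Fin (n + 1) => (Fin.cons x p : Fin (n + 1) → B) i ⊗ₜ[k]
          (Fin.cons y q : Fin (n + 1) → C) i) =
          Fin.cons (x ⊗ₜ[k] y) fun i => p i ⊗ₜ[k] q i := by
        funext i
        refine Fin.cases ?_ (fun i => ?_) i <;> simp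
      rw [e] at this
      exact this
    rw [← f.uncurry_curryLeft, this, g.uncurry_curryLeft]

variable [Bialgebra k A]

variable (k A) in
/-- The multiplicative extension of the coproduct to the tensor algebra. -/
def wordComul : TensorAlgebra k A →ₐ[k] TensorAlgebra k A ⊗[k] TensorAlgebra k A :=
  TensorAlgebra.lift k
    (TensorProduct.map (TensorAlgebra.ι k) (TensorAlgebra.ι k) ∘ₗ Coalgebra.comul)

theorem wordComul_ι (a : A) : wordComul k A (TensorAlgebra.ι k a) =
    TensorProduct.map (TensorAlgebra.ι k) (TensorAlgebra.ι k) (Coalgebra.comul (R := k) a) :=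
  TensorAlgebra.lift_ι_apply _ _

variable (k A) in
/-- The multiplicative extension of the counit to the tensor algebra. -/
def wordCounit : TensorAlgebra k A →ₐ[k] k := TensorAlgebra.lift k Coalgebra.counit

theorem wordCounit_ι (a : A) :
    wordCounit k A (TensorAlgebra.ι k a) = Coalgebra.counit (R := k) a :=
  TensorAlgebra.lift_ι_apply _ _

/-- The coalgebra of words: the coproduct of the letters extends multiplicatively. -/
scoped instance tensorAlgebraBialgebra : Bialgebra k (TensorAlgebra k A) :=
  Bialgebra.ofAlgHom (wordComul k A) (wordCounit k A)
    (by
      -- Both sides of each coalgebra axiom are algebra maps, so it suffices to compare them on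
      -- letters, where the axiom is that of `A`.
      apply TensorAlgebra.hom_ext
      ext a
      have h := congrArg (TensorProduct.map (TensorAlgebra.ι k) (TensorProduct.map
        (TensorAlgebra.ι k) (TensorAlgebra.ι k))) (Coalgebra.coassoc_apply (R := k) a)
      have h1 : ∀ z : A ⊗[k] A, Algebra.TensorProduct.assoc k k k (TensorAlgebra k A)
          (TensorAlgebra k A) (TensorAlgebra k A)
          (Algebra.TensorProduct.map (wordComul k A) (AlgHom.id k _)
            (TensorProduct.map (TensorAlgebra.ι k) (TensorAlgebra.ι k) z)) =
          TensorProduct.map (TensorAlgebra.ι k) (TensorProduct.map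
            (TensorAlgebra.ι k) (TensorAlgebra.ι k))
              (TensorProduct.assoc k A A A (Coalgebra.comul.rTensor A z)) := by
        intro z
        induction z with
        | zero => simp
        | add x y hx hy => simp only [map_add, hx, hy]
        | tmul x y =>
          simp only [TensorProduct.map_tmul, Algebra.TensorProduct.map_tmul, wordComul_ι,
            LinearMap.rTensor_tmul]
          generalize Coalgebra.comul (R := k) x = t
          induction t with
          | zero => simp
          | add p q hp hq => simp only [map_add, TensorProduct.add_tmul, hp, hq]
          | tmul p q => simp
      have h2 : ∀ z : A ⊗[k] A,
          Algebra.TensorProduct.map (AlgHom.id k _) (wordComul k A)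
            (TensorProduct.map (TensorAlgebra.ι k) (TensorAlgebra.ι k) z) =
          TensorProduct.map (TensorAlgebra.ι k) (TensorProduct.map
            (TensorAlgebra.ι k) (TensorAlgebra.ι k)) (Coalgebra.comul.lTensor A z) := by
        intro z
        induction z with
        | zero => simp
        | add x y hx hy => simp only [map_add, hx, hy]
        | tmul x y => simp [wordComul_ι]
      simp only [LinearMap.comp_apply, AlgHom.toLinearMap_apply, AlgHom.comp_apply, wordComul_ι, h2]
      exact (h1 _).trans h)
    (by
      apply TensorAlgebra.hom_ext
      ext a
      have h := congrArg (TensorProduct.map LinearMap.id (TensorAlgebra.ι k))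
        (Coalgebra.rTensor_counit_comul (R := k) a)
      have h1 : ∀ z : A ⊗[k] A, Algebra.TensorProduct.map (wordCounit k A) (AlgHom.id k _)
            (TensorProduct.map (TensorAlgebra.ι k) (TensorAlgebra.ι k) z) =
          TensorProduct.map LinearMap.id (TensorAlgebra.ι k)
            (Coalgebra.counit.rTensor A z) := by
        intro z
        induction z with
        | zero => simp
        | add x y hx hy => simp only [map_add, hx, hy]
        | tmul x y => simp [wordCounit_ι]
      simp only [LinearMap.comp_apply, AlgHom.toLinearMap_apply, AlgHom.comp_apply, wordComul_ι, h1]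
      exact h)
    (by
      apply TensorAlgebra.hom_ext
      ext a
      have h := congrArg (TensorProduct.map (TensorAlgebra.ι k) LinearMap.id)
        (Coalgebra.lTensor_counit_comul (R := k) a)
      have h1 : ∀ z : A ⊗[k] A, Algebra.TensorProduct.map (AlgHom.id k _) (wordCounit k A)
            (TensorProduct.map (TensorAlgebra.ι k) (TensorAlgebra.ι k) z) =
          TensorProduct.map (TensorAlgebra.ι k) LinearMap.id
            (Coalgebra.counit.lTensor A z) := by
        intro z
        induction z with
        | zero => simp
        | add x y hx hy => simp only [map_add, hx, hy]
        | tmul x y => simp [wordCounit_ι]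
      simp only [LinearMap.comp_apply, AlgHom.toLinearMap_apply, AlgHom.comp_apply, wordComul_ι, h1]
      exact h)

theorem comul_ι (a : A) : Coalgebra.comul (R := k) (TensorAlgebra.ι k a) =
    TensorProduct.map (TensorAlgebra.ι k) (TensorAlgebra.ι k) (Coalgebra.comul (R := k) a) :=
  TensorAlgebra.lift_ι_apply _ _

theorem counit_ι (a : A) : Coalgebra.counit (R := k) (TensorAlgebra.ι k a) =
    Coalgebra.counit (R := k) a :=
  TensorAlgebra.lift_ι_apply _ _

/-- This replaces Sweedler sums: an expression in `Δ(a₁), …, Δ(aₙ)` is the value of a multilinear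
map on `A ⊗ A`, and identities between such maps may be checked at pure tensors `pᵢ ⊗ qᵢ` by
`multilinearMap_tmul_ext`. -/
theorem map_comul_tprod {M M' : Type*} [AddCommMonoid M] [Module k M] [AddCommMonoid M']
    [Module k M'] (F : TensorAlgebra k A →ₗ[k] M) (G : TensorAlgebra k A →ₗ[k] M') {n : ℕ}
    (a : Fin n → A) :
    TensorProduct.map F G (Coalgebra.comul (R := k) (TensorAlgebra.tprod k A n a)) =
      pairMap F G n fun i => Coalgebra.comul (R := k) (a i) := by
  have : Coalgebra.comul (R := k) (TensorAlgebra.tprod k A n a) =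
      (List.ofFn fun i => Coalgebra.comul (R := k) (TensorAlgebra.ι k (a i))).prod := by
    rw [TensorAlgebra.tprod_apply, ← Bialgebra.comulAlgHom_apply, map_list_prod, List.map_ofFn]
    rfl
  rw [this]
  simp only [comul_ι]
  rfl

variable (k A) in
/-- The product of the letters. -/
def wordProd : TensorAlgebra k A →ₐ[k] A := TensorAlgebra.lift k LinearMap.id

theorem wordProd_ι (a : A) : wordProd k A (TensorAlgebra.ι k a) = a :=
  TensorAlgebra.lift_ι_apply _ _

theorem wordProd_tprod {n : ℕ} (a : Fin n → A) :
    wordProd k A (TensorAlgebra.tprod k A n a) = (List.ofFn a).prod := by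
  rw [TensorAlgebra.tprod_apply, map_list_prod, List.map_ofFn]
  congr 2
  funext i
  exact wordProd_ι _

/-- Since `Δ` is multiplicative, both sides are algebra maps in `t` that agree on letters. So the
product of the letters is a coalgebra map, and the antipode axioms of `A` pull back along it. -/
theorem comul_wordProd (t : TensorAlgebra k A) :
    Coalgebra.comul (R := k) (wordProd k A t) =
      TensorProduct.map (wordProd k A).toLinearMap (wordProd k A).toLinearMap
        (Coalgebra.comul (R := k) t) := by
  have : (Bialgebra.comulAlgHom k A).comp (wordProd k A) =
      (Algebra.TensorProduct.map (wordProd k A) (wordProd k A)).comp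
        (Bialgebra.comulAlgHom k (TensorAlgebra k A)) := by
    apply TensorAlgebra.hom_ext
    ext a
    simp only [LinearMap.comp_apply, AlgHom.toLinearMap_apply, AlgHom.comp_apply,
      Bialgebra.comulAlgHom_apply, wordProd_ι, comul_ι]
    generalize Coalgebra.comul (R := k) a = z
    induction z with
    | zero => simp
    | add x y hx hy => rw [map_add, map_add, ← hx, ← hy]
    | tmul x y => simp [wordProd_ι]
  exact AlgHom.congr_fun this t

theorem counit_wordProd (t : TensorAlgebra k A) :
    Coalgebra.counit (R := k) (wordProd k A t) = Coalgebra.counit (R := k) t := by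
  have : (Bialgebra.counitAlgHom k A).comp (wordProd k A) =
      Bialgebra.counitAlgHom k (TensorAlgebra k A) := by
    apply TensorAlgebra.hom_ext
    ext a
    simp [wordProd_ι, counit_ι]
  exact AlgHom.congr_fun this t

end WordCoalgebra

/-! ## Bimodules by restriction -/

section Restriction

variable {k : Type u} [Field k] {A : Type v} [Ring A] [Algebra k A]
  {U : Type*} [Ring U] [Algebra k U]

/-- A `U`-module regarded as an `A`-bimodule by restriction along `θ : Aᵉ → U`. -/
def Res (_θ : Env k A →ₐ[k] U) (M : Type w) : Type w := M

variable (θ : Env k A →ₐ[k] U) (M : Type w) [AddCommGroup M]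

instance : AddCommGroup (Res θ M) := inferInstanceAs (AddCommGroup M)

instance [Module k M] : Module k (Res θ M) := inferInstanceAs (Module k M)

instance resModule [Module U M] : Module (Env k A) (Res θ M) :=
  Module.compHom M θ.toRingHom

instance [Module k M] [Module U M] [IsScalarTower k U M] :
    IsScalarTower k (Env k A) (Res θ M) where
  smul_assoc r e m := by
    have h := smul_assoc r (θ e) (show M from m)
    rw [← map_smul] at h
    exact h

end Restriction

/-! ### Scalars on the restricted modules; trivial right multiplication and reversal -/

section HopfModules

variable (k : Type u) [Field k] (A : Type v) [Ring A] [HopfAlgebra k A]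

instance : Module k (Triv k A) := inferInstanceAs (Module k k)

instance : IsScalarTower k A (Triv k A) where
  smul_assoc r a c := by
    have h : ∀ c : k, Coalgebra.counit (R := k) (r • a) * c =
        r * (Coalgebra.counit (R := k) a * c) := fun c => by
      rw [map_smul, smul_eq_mul, mul_assoc]
    exact h c

instance (M : Type w) [AddCommGroup M] [Module k M] : Module k (Ad k A M) :=
  inferInstanceAs (Module k M)

instance (M : Type w) [AddCommGroup M] [Module k M] [Module (Env k A) M]
    [IsScalarTower k (Env k A) M] : IsScalarTower k A (Ad k A M) where
  smul_assoc r a m := by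
    have h := smul_assoc r (deltaHom k A a) (show M from m)
    rw [← map_smul] at h
    exact h

/-- The algebra map `Aᵉ → A`, `x ⊗ y ↦ x ε(y)`. -/
def rtHom : Env k A →ₐ[k] A :=
  Algebra.TensorProduct.lift (AlgHom.id k A)
    (((Algebra.ofId k A).comp (Bialgebra.counitAlgHom k A)).fromOpposite
      fun _ _ => Algebra.commute_algebraMap_left _ _)
    fun _ _ => Algebra.commute_algebraMap_right _ _

/-- The algebra endomorphism `x ⊗ y ↦ S(y) ⊗ S(x)` of `Aᵉ`. -/
def flipHom : Env k A →ₐ[k] Env k A :=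
  Algebra.TensorProduct.lift
    (Algebra.TensorProduct.includeRight.comp (HopfAlgebra.antipodeAlgHomOp k A))
    (Algebra.TensorProduct.includeLeft.comp (AlgHom.opComm (HopfAlgebra.antipodeAlgHomOp k A)))
    fun x y => by
      change _ * _ = _ * _
      simp

variable {k A}

theorem rtHom_tmul (x y : A) : rtHom k A (x ⊗ₜ[k] MulOpposite.op y) =
    Coalgebra.counit (R := k) y • x := by
  rw [Algebra.smul_def, Algebra.commutes]
  exact Algebra.TensorProduct.lift_tmul _ _ _ _ _

theorem flipHom_tmul (x y : A) : flipHom k A (x ⊗ₜ[k] MulOpposite.op y) =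
    HopfAlgebra.antipode k y ⊗ₜ[k] MulOpposite.op (HopfAlgebra.antipode k x) := by
  simp [flipHom]

end HopfModules

/-! ## Convolution of cochains with functions of words -/

section Convolution

variable {k : Type u} [Field k] {A : Type v} [Ring A] [HopfAlgebra k A]
  {M : Type w} [AddCommGroup M] [Module k M] [Module (Env k A) M] [IsScalarTower k (Env k A) M]

theorem leftAct_apply (x : A) (m : M) : leftAct (k := k) x m = (x ⊗ₜ[k] 1 : Env k A) • m := rfl

theorem rightAct_apply (y : A) (m : M) :
    rightAct (k := k) y m = (1 ⊗ₜ[k] MulOpposite.op y : Env k A) • m := rfl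

theorem rightAct_mul (x y : A) (m : M) :
    rightAct (k := k) (x * y) m = rightAct (k := k) y (rightAct (k := k) x m) := by
  simp only [rightAct_apply, smul_smul, Algebra.TensorProduct.tmul_mul_tmul, one_mul,
    MulOpposite.op_mul]

theorem rightAct_one (m : M) : rightAct (k := k) (1 : A) m = m := by
  rw [rightAct_apply]
  exact one_smul (Env k A) m

theorem rightAct_self (x y : A) : rightAct (k := k) x y = y * x := by
  rw [rightAct_apply, env_smul_def]
  simp

theorem rightAct_algebraMap (r : k) (m : M) :
    rightAct (k := k) (algebraMap k A r) m = r • m := by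
  rw [Algebra.algebraMap_eq_smul_one, map_smul, LinearMap.smul_apply, rightAct_one]

theorem tmul_op_smul (x y : A) (m : M) :
    (x ⊗ₜ[k] MulOpposite.op y : Env k A) • m =
      leftAct (k := k) x (rightAct (k := k) y m) := by
  rw [rightAct_apply, leftAct_apply, smul_smul, Algebra.TensorProduct.tmul_mul_tmul]
  simp

theorem leftAct_rightAct_comm (x y : A) (m : M) :
    leftAct (k := k) x (rightAct (k := k) y m) = rightAct (k := k) y (leftAct (k := k) x m) := by
  rw [← tmul_op_smul, rightAct_apply, leftAct_apply, smul_smul,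
    Algebra.TensorProduct.tmul_mul_tmul]
  simp

variable (k A M) in
/-- Right multiplication `M ⊗ A → M`. -/
def rightMul : M ⊗[k] A →ₗ[k] M := TensorProduct.lift (rightAct (k := k)).flip

theorem rightMul_tmul (m : M) (y : A) : rightMul k A M (m ⊗ₜ y) = rightAct (k := k) y m := by
  simp [rightMul]

/-- The convolution `t ↦ ∑ F(t₁) w(t₂)`. -/
def conv (F : TensorAlgebra k A →ₗ[k] M) (w : TensorAlgebra k A →ₗ[k] A) :
    TensorAlgebra k A →ₗ[k] M :=
  rightMul k A M ∘ₗ TensorProduct.map F w ∘ₗ Coalgebra.comul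

theorem conv_assoc (F : TensorAlgebra k A →ₗ[k] M) (w w' : TensorAlgebra k A →ₗ[k] A) :
    conv (conv F w) w' = conv F (conv w w') := by
  -- The threefold convolution before any coproduct is taken; the two bracketings are its values on
  -- the two iterated coproducts.
  let Q : TensorAlgebra k A ⊗[k] (TensorAlgebra k A ⊗[k] TensorAlgebra k A) →ₗ[k] M :=
    rightMul k A M ∘ₗ TensorProduct.map F (rightMul k A A ∘ₗ TensorProduct.map w w')
  have h1 : ∀ z, rightMul k A M (TensorProduct.map (conv F w) w' z) =
      Q (TensorProduct.assoc k _ _ _ (Coalgebra.comul.rTensor _ z)) := by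
    intro z
    induction z with
    | zero => simp
    | add x y hx hy => simp only [map_add, hx, hy]
    | tmul x y =>
      simp only [TensorProduct.map_tmul, LinearMap.rTensor_tmul, conv, LinearMap.comp_apply]
      generalize Coalgebra.comul (R := k) x = t
      induction t with
      | zero => simp
      | add p q hp hq => simp only [map_add, TensorProduct.add_tmul, hp, hq]
      | tmul p q => simp [Q, rightMul_tmul, rightAct_self, rightAct_mul]
  have h2 : ∀ z, rightMul k A M (TensorProduct.map F (conv w w') z) =
      Q (Coalgebra.comul.lTensor _ z) := by
    intro z
    induction z with
    | zero => simp
    | add x y hx hy => simp only [map_add, hx, hy]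
    | tmul x y => simp [Q, conv]
  ext t
  have e : conv (conv F w) w' t =
      rightMul k A M (TensorProduct.map (conv F w) w' (Coalgebra.comul (R := k) t)) := rfl
  have e' : conv F (conv w w') t =
      rightMul k A M (TensorProduct.map F (conv w w') (Coalgebra.comul (R := k) t)) := rfl
  rw [e, e', h1, h2, Coalgebra.coassoc_apply]

variable (k A) in
/-- The unit for convolution. -/
def convOne : TensorAlgebra k A →ₗ[k] A := Algebra.linearMap k A ∘ₗ Coalgebra.counit

theorem conv_convOne (F : TensorAlgebra k A →ₗ[k] M) : conv F (convOne k A) = F := by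
  have h : ∀ z, rightMul k A M (TensorProduct.map F (convOne k A) z) =
      F (TensorProduct.rid k _ (Coalgebra.counit.lTensor _ z)) := by
    intro z
    induction z with
    | zero => simp
    | add x y hx hy => simp only [map_add, hx, hy]
    | tmul x y => simp [convOne, rightMul_tmul, rightAct_algebraMap]
  ext t
  refine (h _).trans ?_
  rw [Coalgebra.lTensor_counit_comul]
  simp

variable (k A) in
/-- The antipode of the product of the letters. -/
def wordAntipode : TensorAlgebra k A →ₗ[k] A :=
  HopfAlgebra.antipode k ∘ₗ (wordProd k A).toLinearMap

/-- The antipode axiom, pulled back along the product of the letters. With its mirror image it makes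
`wordProd` invertible for convolution, so that convolving with it is a bijection on cochains. -/
theorem conv_wordAntipode_wordProd :
    conv (wordAntipode k A) (wordProd k A).toLinearMap = convOne k A := by
  have h : ∀ z, rightMul k A A (TensorProduct.map (wordAntipode k A) (wordProd k A).toLinearMap z) =
      LinearMap.mul' k A ((HopfAlgebra.antipode k).rTensor A (TensorProduct.map
        (wordProd k A).toLinearMap (wordProd k A).toLinearMap z)) := by
    intro z
    induction z with
    | zero => simp
    | add x y hx hy => simp only [map_add, hx, hy]
    | tmul x y => simp [rightMul_tmul, rightAct_self, wordAntipode]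
  ext t
  refine (h _).trans ?_
  rw [← comul_wordProd, HopfAlgebra.mul_antipode_rTensor_comul_apply, counit_wordProd]
  rfl

theorem conv_wordProd_wordAntipode :
    conv (wordProd k A).toLinearMap (wordAntipode k A) = convOne k A := by
  have h : ∀ z, rightMul k A A (TensorProduct.map (wordProd k A).toLinearMap (wordAntipode k A) z) =
      LinearMap.mul' k A ((HopfAlgebra.antipode k).lTensor A (TensorProduct.map
        (wordProd k A).toLinearMap (wordProd k A).toLinearMap z)) := by
    intro z
    induction z with
    | zero => simp
    | add x y hx hy => simp only [map_add, hx, hy]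
    | tmul x y => simp [rightMul_tmul, rightAct_self, wordAntipode]
  ext t
  refine (h _).trans ?_
  rw [← comul_wordProd, HopfAlgebra.mul_antipode_lTensor_comul_apply, counit_wordProd]
  rfl

/-- The convolution of a cochain with a function of words. -/
def convCochain {n : ℕ} (c : Cochain k A M n) (w : TensorAlgebra k A →ₗ[k] A) : Cochain k A M n :=
  (conv (wordMap c) w).compMultilinearMap (TensorAlgebra.tprod k A n)

theorem convCochain_apply {n : ℕ} (c : Cochain k A M n) (w : TensorAlgebra k A →ₗ[k] A)
    (a : Fin n → A) : convCochain c w a =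
      rightMul k A M (pairMap (wordMap c) w n fun i => Coalgebra.comul (R := k) (a i)) := by
  rw [← map_comul_tprod]
  rfl

/-- The coproduct of a word of length `m` consists of pairs of words of the same length `m`, so
convolution does not leave degree `n`. -/
theorem wordMap_convCochain {n : ℕ} (c : Cochain k A M n) (w : TensorAlgebra k A →ₗ[k] A) :
    wordMap (convCochain c w) = conv (wordMap c) w := by
  apply tensorAlgebra_linearMap_ext
  intro m a
  by_cases h : m = n
  · subst h
    rw [wordMap_tprod]
    rfl
  · rw [wordMap_tprod_of_ne _ _ h]
    have : pairMap (wordMap c) w m = 0 := by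
      apply multilinearMap_tmul_ext
      intro p q
      rw [pairMap_tmul, wordMap_tprod_of_ne _ _ h, TensorProduct.zero_tmul]
      rfl
    change _ = rightMul k A M (TensorProduct.map (wordMap c) w (Coalgebra.comul (R := k) _))
    rw [map_comul_tprod, this]
    simp

theorem convCochain_convCochain {n : ℕ} (c : Cochain k A M n)
    (w w' : TensorAlgebra k A →ₗ[k] A) :
    convCochain (convCochain c w) w' = convCochain c (conv w w') := by
  rw [convCochain, wordMap_convCochain, conv_assoc]
  rfl

theorem convCochain_convOne {n : ℕ} (c : Cochain k A M n) :
    convCochain c (convOne k A) = c := by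
  ext a
  rw [convCochain, conv_convOne]
  exact wordMap_tprod c a

end Convolution

/-! ## Insertion and products of letters -/

section InsertProd

variable {k : Type u} [Field k] {A : Type v} [Ring A] [Algebra k A]

theorem ofFn_insertArg {m n N : ℕ} (h : N + 1 = m + n) (i : Fin m) (g : Cochain k A A n)
    (a : Fin N → A) :
    List.ofFn (insertArg h i g a) = (List.ofFn a).take i.1 ++
      g (fun l => a ⟨i.1 + l.1, by omega⟩) :: (List.ofFn a).drop (i.1 + n) := by
  apply List.ext_getElem
  · simp
    omega
  · intro j hj _
    rw [List.length_ofFn] at hj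
    simp only [List.getElem_ofFn, List.getElem_append, List.length_take, List.length_ofFn,
      List.getElem_take]
    unfold insertArg
    rcases lt_trichotomy j i.1 with h1 | h1 | h1
    · rw [dif_pos h1, dif_pos (by omega)]
    · subst h1
      rw [dif_neg (lt_irrefl _), dif_pos rfl, dif_neg (by omega)]
      simp only [min_eq_left (show i.1 ≤ N by omega), Nat.sub_self, List.getElem_cons_zero]
    · rw [dif_neg (by simpa using h1.le), dif_neg (fun e => h1.ne' (congrArg Fin.val e)),
        dif_neg (by omega)]
      obtain ⟨r, hr⟩ : ∃ r, j = i.1 + r + 1 := ⟨j - i.1 - 1, by omega⟩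
      have h7 : j - min i.1 N = r + 1 := by omega
      simp only [h7, List.getElem_cons_succ, List.getElem_drop, List.getElem_ofFn]
      congr 2
      omega

/-- Associativity: multiplying a block of consecutive letters first does not change the total
product. Compatibility of insertion with the coaction comes down to this. -/
theorem prod_ofFn_insertArg {m n N : ℕ} (h : N + 1 = m + n) (i : Fin m) (a : Fin N → A) :
    (List.ofFn (insertArg h i (MultilinearMap.mkPiAlgebraFin k n A) a)).prod =
      (List.ofFn a).prod := by
  have h1 : (List.ofFn fun l : Fin n => a ⟨i.1 + l.1, by omega⟩) =
      ((List.ofFn a).drop i.1).take n := by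
    apply List.ext_getElem
    · simp
      omega
    · intro j hj _
      simp
  rw [ofFn_insertArg, List.prod_append, List.prod_cons, MultilinearMap.mkPiAlgebraFin_apply, h1,
    ← List.drop_drop, List.prod_take_mul_prod_drop, List.prod_take_mul_prod_drop]

theorem insertArg_tmul {B C : Type*} [Ring B] [Algebra k B] [Ring C] [Algebra k C] {m n N : ℕ}
    (h : N + 1 = m + n) (i : Fin m) (g : Cochain k (B ⊗[k] C) (B ⊗[k] C) n) (g₁ : Cochain k B B n)
    (g₂ : Cochain k C C n) (hg : ∀ p q, g (fun l => p l ⊗ₜ q l) = g₁ p ⊗ₜ g₂ q)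
    (p : Fin N → B) (q : Fin N → C) :
    insertArg h i g (fun l => p l ⊗ₜ[k] q l) =
      fun j => insertArg h i g₁ p j ⊗ₜ[k] insertArg h i g₂ q j := by
  funext j
  unfold insertArg
  split_ifs
  · rfl
  · exact hg _ _
  · rfl

theorem map_insertArg {B : Type*} [Ring B] [Algebra k B] {m n N : ℕ}
    (h : N + 1 = m + n) (i : Fin m) (g : Cochain k A A n) (g' : Cochain k B B n) (f : A → B)
    (a : Fin N → A) (hg : ∀ b, f (g b) = g' fun l => f (b l)) :
    (fun j => f (insertArg h i g a j)) = insertArg h i g' fun l => f (a l) := by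
  funext j
  unfold insertArg
  split_ifs
  · rfl
  · exact hg _
  · rfl

end InsertProd

/-! ## Insertion and the coproduct -/

section Twist

variable {k : Type u} [Field k] {A : Type v} [Ring A] [HopfAlgebra k A]
  {M : Type w} [AddCommGroup M] [Module k M]

/-- At pure tensors `pᵢ ⊗ qᵢ` the left components see `g` inserted into `f`, and the right
components see the product of a block inserted into the whole product, which does not change it. -/
theorem pairMap_wordProd_insertAt {m n N : ℕ} (h : N + 1 = m + n) (i : Fin m)
    (f : Cochain k A M m) (g : Cochain k A A n) :
    pairMap (wordMap (insertAt h i f g)) (wordProd k A).toLinearMap N =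
      insertAt h i (pairMap (wordMap f) (wordProd k A).toLinearMap m)
        (pairMap (wordMap g) (wordProd k A).toLinearMap n) := by
  apply multilinearMap_tmul_ext
  intro p q
  rw [pairMap_tmul, wordMap_tprod, insertAt_apply, insertAt_apply,
    insertArg_tmul h i _ g (MultilinearMap.mkPiAlgebraFin k n A), pairMap_tmul, wordMap_tprod]
  · simp only [AlgHom.toLinearMap_apply, wordProd_tprod, prod_ofFn_insertArg]
  · intro p q
    rw [pairMap_tmul, wordMap_tprod, AlgHom.toLinearMap_apply, wordProd_tprod,
      MultilinearMap.mkPiAlgebraFin_apply]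

theorem pairMap_mkPiAlgebraFin (n : ℕ) :
    pairMap (wordMap (MultilinearMap.mkPiAlgebraFin k n A)) (wordProd k A).toLinearMap n =
      MultilinearMap.mkPiAlgebraFin k n (A ⊗[k] A) := by
  apply multilinearMap_tmul_ext
  intro p q
  rw [pairMap_tmul, wordMap_tprod, AlgHom.toLinearMap_apply, wordProd_tprod,
    MultilinearMap.mkPiAlgebraFin_apply, MultilinearMap.mkPiAlgebraFin_apply, list_prod_ofFn_tmul]

/-- A cochain is colinear if it is a map of right `A`-comodules, for the coaction on words by the
product of the letters. -/
def IsColinear {n : ℕ} (f : Cochain k A A n) : Prop :=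
  ∀ a : Fin n → A, Coalgebra.comul (R := k) (f a) =
    pairMap (wordMap f) (wordProd k A).toLinearMap n fun i => Coalgebra.comul (R := k) (a i)

theorem isColinear_mkPiAlgebraFin (n : ℕ) :
    IsColinear (MultilinearMap.mkPiAlgebraFin k n A) := by
  intro a
  rw [pairMap_mkPiAlgebraFin, MultilinearMap.mkPiAlgebraFin_apply,
    MultilinearMap.mkPiAlgebraFin_apply, ← Bialgebra.comulAlgHom_apply, map_list_prod,
    List.map_ofFn]
  rfl

theorem IsColinear.comul_insertArg {m n N : ℕ} (h : N + 1 = m + n) (i : Fin m)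
    {g : Cochain k A A n} (hg : IsColinear g) (a : Fin N → A) :
    (fun j => Coalgebra.comul (R := k) (insertArg h i g a j)) =
      insertArg h i (pairMap (wordMap g) (wordProd k A).toLinearMap n)
        fun l => Coalgebra.comul (R := k) (a l) :=
  map_insertArg h i g _ _ a hg

/-- The coproduct passes first through `f`, then through the inserted value of `g`. This closure is
what keeps brackets of embedded cochains among the embedded cochains. -/
theorem IsColinear.insertAt {m n N : ℕ} (h : N + 1 = m + n) (i : Fin m)
    {f : Cochain k A A m} {g : Cochain k A A n} (hf : IsColinear f) (hg : IsColinear g) :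
    IsColinear (insertAt h i f g) := by
  intro a
  rw [pairMap_wordProd_insertAt, insertAt_apply, insertAt_apply, hf, hg.comul_insertArg]

/-- Identification of a bimodule with its adjoint module as a bimodule with trivial right
multiplication. -/
def fromAd (M : Type w) [AddCommGroup M] [Module k M] [Module (Env k A) M] :
    Res (rtHom k A) (Ad k A M) ≃ₗ[k] M :=
  LinearEquiv.refl k M

theorem fromAd_smul [Module (Env k A) M] (e : Env k A) (m : Res (rtHom k A) (Ad k A M)) :
    fromAd M (e • m) = deltaHom k A (rtHom k A e) • fromAd M m := rfl

variable [Module (Env k A) M] [IsScalarTower k (Env k A) M]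

/-- The multilinear map `(pᵢ ⊗ qᵢ)ᵢ ↦ c (p₁, …, pₙ) q₁ ⋯ qₙ`. -/
def twist {n : ℕ} (c : Cochain k A M n) : MultilinearMap k (fun _ : Fin n => A ⊗[k] A) M :=
  (rightMul k A M).compMultilinearMap (pairMap (wordMap c) (wordProd k A).toLinearMap n)

theorem twist_tmul {n : ℕ} (c : Cochain k A M n) (p q : Fin n → A) :
    twist c (fun i => p i ⊗ₜ[k] q i) = rightAct (k := k) (List.ofFn q).prod (c p) := by
  rw [twist, LinearMap.compMultilinearMap_apply, pairMap_tmul, rightMul_tmul, wordMap_tprod,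
    AlgHom.toLinearMap_apply, wordProd_tprod]

theorem convCochain_wordProd_apply {n : ℕ} (c : Cochain k A M n) (a : Fin n → A) :
    convCochain c (wordProd k A).toLinearMap a =
      twist c fun i => Coalgebra.comul (R := k) (a i) :=
  convCochain_apply _ _ _

theorem convCochain_mulTerm {n : ℕ} (i : Fin n) (c : Cochain k A M n) :
    convCochain (mulTerm i c) (wordProd k A).toLinearMap =
      mulTerm i (convCochain c (wordProd k A).toLinearMap) := by
  ext a
  rw [convCochain_wordProd_apply, mulTerm, twist, pairMap_wordProd_insertAt,
    LinearMap.compMultilinearMap_apply, insertAt_apply,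
    ← (isColinear_mkPiAlgebraFin 2).comul_insertArg]
  exact (convCochain_wordProd_apply _ _).symm

theorem twist_leftAct {n : ℕ} (x : A) (c : Cochain k A M n) :
    twist ((leftAct (k := k) x).compMultilinearMap c) =
      (leftAct (k := k) x).compMultilinearMap (twist c) := by
  apply multilinearMap_tmul_ext
  intro p q
  rw [twist_tmul, LinearMap.compMultilinearMap_apply, LinearMap.compMultilinearMap_apply,
    twist_tmul, leftAct_rightAct_comm]

theorem ofFn_prod_castSucc {B : Type*} [Monoid B] {n : ℕ} (q : Fin (n + 1) → B) :
    (List.ofFn q).prod = (List.ofFn fun i : Fin n => q i.castSucc).prod * q (Fin.last n) := by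
  rw [List.ofFn_succ', List.prod_concat]

/-- The trivial right multiplication turns the first half of the last letter into a counit, the
convolution multiplies by the second half, and `∑ ε(a₁) a₂ = a`. -/
theorem convCochain_rightTerm {n : ℕ} (c : Cochain k A (Res (rtHom k A) (Ad k A M)) n) :
    convCochain ((fromAd M).toLinearMap.compMultilinearMap (rightTerm c))
        (wordProd k A).toLinearMap =
      rightTerm (convCochain ((fromAd M).toLinearMap.compMultilinearMap c)
        (wordProd k A).toLinearMap) := by
  set c' : Cochain k A M n := (fromAd M).toLinearMap.compMultilinearMap c with hc'
  have key : twist ((fromAd M).toLinearMap.compMultilinearMap (rightTerm c)) =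
      MultilinearMap.uncurryRight (M := fun _ : Fin (n + 1) => A ⊗[k] A)
        ((rightAct (k := k) (A := A) (M := M) ∘ₗ (TensorProduct.lid k A).toLinearMap ∘ₗ
          Coalgebra.counit.rTensor A).flip.compMultilinearMap (twist c')) := by
    apply multilinearMap_tmul_ext
    intro p q
    rw [twist_tmul, LinearMap.compMultilinearMap_apply, rightTerm_apply, LinearEquiv.coe_coe,
      fromAd_smul, rtHom_tmul, AlgHom.map_smul_of_tower, map_one,
      MultilinearMap.uncurryRight_apply]
    have e := twist_tmul c' (fun i => p i.castSucc) (fun i => q i.castSucc)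
    rw [ofFn_prod_castSucc, rightAct_mul]
    simp only [LinearMap.compMultilinearMap_apply, LinearMap.flip_apply, LinearMap.comp_apply,
      LinearMap.rTensor_tmul, LinearEquiv.coe_coe, TensorProduct.lid_tmul]
    erw [e]
    rw [smul_assoc, one_smul, map_smul, map_smul, map_smul (rightAct (k := k)),
      LinearMap.smul_apply]
    rfl
  ext a
  rw [convCochain_wordProd_apply, key, MultilinearMap.uncurryRight_apply, rightTerm_apply,
    ← rightAct_apply, convCochain_wordProd_apply]
  simp only [LinearMap.compMultilinearMap_apply, LinearMap.flip_apply, LinearMap.comp_apply,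
    Coalgebra.rTensor_counit_comul, LinearEquiv.coe_coe, TensorProduct.lid_tmul, one_smul]
  rfl

variable (k A) in
/-- The map `p ⊗ q ↦ ∑ p₁ ⊗ S(p₂) q` to the enveloping algebra. -/
def deltaMul : A ⊗[k] A →ₗ[k] Env k A :=
  TensorProduct.lift (((LinearMap.mul k (Env k A)).flip ∘ₗ (deltaHom k A).toLinearMap).compl₂
    ((Algebra.TensorProduct.includeRight : Aᵐᵒᵖ →ₐ[k] Env k A).toLinearMap ∘ₗ
      (MulOpposite.opLinearEquiv k).toLinearMap))

theorem deltaMul_tmul (p q : A) :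
    deltaMul k A (p ⊗ₜ q) = (1 ⊗ₜ[k] MulOpposite.op q : Env k A) * deltaHom k A p := by
  simp [deltaMul]

/-- The cancellation `∑ a₁ ⊗ S(a₂) a₃ = a ⊗ 1`. -/
theorem deltaMul_comul (a : A) :
    deltaMul k A (Coalgebra.comul (R := k) a) = (a ⊗ₜ[k] 1 : Env k A) := by
  let Q : A ⊗[k] A →ₗ[k] Aᵐᵒᵖ := (MulOpposite.opLinearEquiv k).toLinearMap ∘ₗ
    LinearMap.mul' k A ∘ₗ (HopfAlgebra.antipode k).rTensor A
  have h1 : ∀ z, deltaMul k A z = Q.lTensor A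
      (TensorProduct.assoc k A A A (Coalgebra.comul.rTensor A z)) := by
    intro z
    induction z with
    | zero => simp
    | add x y hx hy => simp only [map_add, hx, hy]
    | tmul p q =>
      have e : deltaHom k A p = Algebra.TensorProduct.map (AlgHom.id k A)
        (HopfAlgebra.antipodeAlgHomOp k A) (Coalgebra.comul (R := k) p) := rfl
      rw [deltaMul_tmul, e, LinearMap.rTensor_tmul]
      generalize Coalgebra.comul (R := k) p = t
      induction t with
      | zero => simp
      | add x y hx hy => simp only [map_add, mul_add, TensorProduct.add_tmul, hx, hy]
      | tmul x y => simp [Q]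
  have h2 : ∀ z, Q.lTensor A (Coalgebra.comul.lTensor A z) =
      ((MulOpposite.opLinearEquiv k).toLinearMap ∘ₗ Algebra.linearMap k A).lTensor A
        (Coalgebra.counit.lTensor A z) := by
    intro z
    induction z with
    | zero => simp
    | add x y hx hy => simp only [map_add, hx, hy]
    | tmul p q => simp [Q, HopfAlgebra.mul_antipode_rTensor_comul_apply]
  rw [h1, Coalgebra.coassoc_apply, h2, Coalgebra.lTensor_counit_comul]
  simp

/-- The first letter acts by the adjoint action and its last coproduct component is the first factor
multiplied from the right, so that `∑ a₁ m S(a₂) a₃ = a m` becomes plain left multiplication. -/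
theorem convCochain_leftTerm {n : ℕ} (c : Cochain k A (Res (rtHom k A) (Ad k A M)) n) :
    convCochain ((fromAd M).toLinearMap.compMultilinearMap (leftTerm c))
        (wordProd k A).toLinearMap =
      leftTerm (convCochain ((fromAd M).toLinearMap.compMultilinearMap c)
        (wordProd k A).toLinearMap) := by
  set c' : Cochain k A M n := (fromAd M).toLinearMap.compMultilinearMap c with hc'
  -- The coproduct of the first letter is generalized to an arbitrary `z`, so that the claim can be
  -- checked at pure tensors before `deltaMul_comul` is applied.
  have key : ∀ z, (twist ((fromAd M).toLinearMap.compMultilinearMap (leftTerm c))).curryLeft z =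
      twist ((Algebra.lsmul k k M (deltaMul k A z)).compMultilinearMap c') := by
    intro z
    apply multilinearMap_tmul_ext
    intro p q
    rw [twist_tmul]
    induction z with
    | zero => simp
    | add x y hx hy =>
      simp only [map_add, _root_.add_apply, hx, hy, LinearMap.compMultilinearMap_apply]
      exact (map_add (rightAct (k := k) (List.ofFn q).prod) _ _).symm
    | tmul x y =>
      have e : (Fin.cons (x ⊗ₜ[k] y) fun i => p i ⊗ₜ[k] q i : Fin (n + 1) → A ⊗[k] A) =
          fun i : Fin (n + 1) => (Fin.cons x p : Fin (n + 1) → A) i ⊗ₜ[k]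
            (Fin.cons y q : Fin (n + 1) → A) i := by
        funext i
        refine Fin.cases ?_ (fun i => ?_) i <;> simp
      rw [MultilinearMap.curryLeft_apply, e, twist_tmul, LinearMap.compMultilinearMap_apply,
        LinearMap.compMultilinearMap_apply, leftTerm_apply, LinearEquiv.coe_coe, fromAd_smul,
        ← MulOpposite.op_one, rtHom_tmul, deltaMul_tmul]
      simp only [List.ofFn_succ, Fin.cons_zero, Fin.cons_succ, List.prod_cons, rightAct_mul]
      change _ = rightAct (k := k) _
        (((1 ⊗ₜ[k] MulOpposite.op y : Env k A) * deltaHom k A x) • c' p)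
      rw [mul_smul, ← rightAct_apply]
      simp only [Bialgebra.counit_one, one_smul]
      rfl
  ext a
  have h := MultilinearMap.congr_fun (key (Coalgebra.comul (R := k) (a 0)))
    fun i => Coalgebra.comul (R := k) (a i.succ)
  rw [deltaMul_comul] at h
  have h' := MultilinearMap.congr_fun (twist_leftAct (a 0) c')
    fun i => Coalgebra.comul (R := k) (a i.succ)
  rw [convCochain_wordProd_apply, leftTerm_apply, ← leftAct_apply, convCochain_wordProd_apply]
  refine Eq.trans ?_ (h.trans h')
  rw [MultilinearMap.curryLeft_apply]
  congr 1
  funext i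
  refine Fin.cases ?_ (fun i => ?_) i <;> simp

theorem convCochain_add {n : ℕ} (c c' : Cochain k A M n) (w : TensorAlgebra k A →ₗ[k] A) :
    convCochain (c + c') w = convCochain c w + convCochain c' w := by
  ext a
  have : wordMap (c + c') = wordMap c + wordMap c' := by
    simp [wordMap, LinearMap.add_comp]
  simp [convCochain, conv, this, TensorProduct.map_add_left]

theorem convCochain_smul {n : ℕ} (r : k) (c : Cochain k A M n) (w : TensorAlgebra k A →ₗ[k] A) :
    convCochain (r • c) w = r • convCochain c w := by
  ext a
  have : wordMap (r • c) = r • wordMap c := by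
    simp [wordMap, LinearMap.smul_comp]
  simp [convCochain, conv, this, TensorProduct.map_smul_left]

variable (k A M) in
/-- Convolution with the product of letters, which identifies the cochains with values in the
adjoint module with the Hochschild cochains. -/
def fromAdCochain (n : ℕ) :
    Cochain k A (Res (rtHom k A) (Ad k A M)) n ≃ₗ[k] Cochain k A M n where
  toFun c := convCochain ((fromAd M).toLinearMap.compMultilinearMap c) (wordProd k A).toLinearMap
  invFun c := (fromAd M).symm.toLinearMap.compMultilinearMap (convCochain c (wordAntipode k A))
  map_add' c c' := by
    rw [← convCochain_add]
    congr 1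
  map_smul' r c := by
    rw [RingHom.id_apply, ← convCochain_smul]
    congr 1
  left_inv c := by
    simp only
    rw [convCochain_convCochain, conv_wordProd_wordAntipode, convCochain_convOne]
    ext a
    simp
  right_inv c := by
    have : (fromAd (k := k) (A := A) M).toLinearMap.compMultilinearMap
        ((fromAd (k := k) (A := A) M).symm.toLinearMap.compMultilinearMap (convCochain c (wordAntipode k A))) =
        convCochain c (wordAntipode k A) := by
      ext a
      simp
    change convCochain (k := k) ((fromAd (k := k) (A := A) M).toLinearMap.compMultilinearMap
      ((fromAd (k := k) (A := A) M).symm.toLinearMap.compMultilinearMap (convCochain c (wordAntipode k A))))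
        (wordProd k A).toLinearMap = c
    rw [this, convCochain_convCochain, conv_wordAntipode_wordProd, convCochain_convOne]

theorem fromAdCochain_apply {n : ℕ} (c : Cochain k A (Res (rtHom k A) (Ad k A M)) n) :
    fromAdCochain k A M n c =
      convCochain ((fromAd M).toLinearMap.compMultilinearMap c) (wordProd k A).toLinearMap := rfl

/-- The Eckmann-Shapiro isomorphism on cochains: convolution with the product of the letters matches
the outer and inner terms of the two differentials one by one. -/
theorem hochschildD_fromAdCochain {n : ℕ} (c : Cochain k A (Res (rtHom k A) (Ad k A M)) n) :
    hochschildD k A M n (fromAdCochain k A M n c) =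
      fromAdCochain k A M (n + 1) (hochschildD k A (Res (rtHom k A) (Ad k A M)) n c) := by
  have e : ∀ (V : Type w) [AddCommGroup V] [Module k V] [Module (Env k A) V]
      [IsScalarTower k (Env k A) V] (c : Cochain k A V n),
      hochschildD k A V n c = leftTerm c + ∑ i : Fin n, (-1 : k) ^ (i.1 + 1) • mulTerm i c
        + (-1 : k) ^ (n + 1) • rightTerm c := fun V _ _ _ _ c => rfl
  rw [e, e, map_add, map_add, map_sum]
  simp only [map_smul]
  rw [fromAdCochain_apply, fromAdCochain_apply, fromAdCochain_apply, convCochain_leftTerm,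
    convCochain_rightTerm]
  congr 2
  refine Finset.sum_congr rfl fun i _ => ?_
  rw [fromAdCochain_apply, ← convCochain_mulTerm]
  rfl

theorem hochschildD_fromAdCochain_symm {n : ℕ} (c : Cochain k A M n) :
    hochschildD k A (Res (rtHom k A) (Ad k A M)) n ((fromAdCochain k A M n).symm c) =
      (fromAdCochain k A M (n + 1)).symm (hochschildD k A M n c) := by
  rw [LinearEquiv.eq_symm_apply, ← hochschildD_fromAdCochain, LinearEquiv.apply_symm_apply]

variable {M' : Type x} [AddCommGroup M'] [Module k M'] [Module (Env k A) M']
  [IsScalarTower k (Env k A) M']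

theorem convCochain_comp (f : M →ₗ[Env k A] M') {n : ℕ} (c : Cochain k A M n)
    (w : TensorAlgebra k A →ₗ[k] A) :
    convCochain ((f.restrictScalars k).compMultilinearMap c) w =
      (f.restrictScalars k).compMultilinearMap (convCochain c w) := by
  have h1 : wordMap ((f.restrictScalars k).compMultilinearMap c) =
      f.restrictScalars k ∘ₗ wordMap c := by
    apply tensorAlgebra_linearMap_ext
    intro m a
    by_cases h : m = n
    · subst h
      rw [LinearMap.comp_apply, wordMap_tprod, wordMap_tprod]
      rfl
    · rw [LinearMap.comp_apply, wordMap_tprod_of_ne _ _ h, wordMap_tprod_of_ne _ _ h, map_zero]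
  have h2 : ∀ z, rightMul k A M' (TensorProduct.map (f.restrictScalars k ∘ₗ wordMap c) w z) =
      f (rightMul k A M (TensorProduct.map (wordMap c) w z)) := by
    intro z
    induction z with
    | zero => simp
    | add x y hx hy => simp only [map_add, hx, hy]
    | tmul x y =>
      simp only [TensorProduct.map_tmul, rightMul_tmul, rightAct_apply, map_smul]
      rfl
  ext a
  rw [convCochain, h1]
  exact h2 _

end Twist

/-! ## The free resolution of the trivial module by words -/

section LeftBar

variable {k : Type u} [Field k] {A : Type v} [Ring A] [HopfAlgebra k A]

variable (k A) in
/-- The free `A`-module on `A^{⊗n}`. -/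
abbrev LeftBar (n : ℕ) : Type (max u v) := A ⊗[k] (⨂[k] _ : Fin n, A)

/-- Cochains with values in an `A`-module with trivial right multiplication. -/
abbrev TrivCochain (k : Type u) [Field k] (A : Type v) [Ring A] [HopfAlgebra k A] (N : Type w)
    [AddCommGroup N] [Module k N] (n : ℕ) : Type (max v w) :=
  Cochain k A (Res (rtHom k A) N) n

section ResMap

variable {U : Type*} [Ring U] [Algebra k U] (θ : Env k A →ₐ[k] U)

/-- The identity map from a module to the restricted bimodule. -/
def resEquiv (N : Type w) [AddCommGroup N] [Module k N] : N ≃ₗ[k] Res θ N := LinearEquiv.refl k N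

variable {N : Type w} [AddCommGroup N] [Module k N] [Module U N]
  {N' : Type x} [AddCommGroup N'] [Module k N'] [Module U N']

theorem smul_resEquiv (e : Env k A) (m : N) : e • resEquiv θ N m = resEquiv θ N (θ e • m) := rfl

/-- A linear map as a map of restricted bimodules. -/
def resMap (f : N →ₗ[U] N') : Res θ N →ₗ[Env k A] Res θ N' where
  toFun := f
  map_add' := f.map_add
  map_smul' e m := f.map_smul (θ e) m

end ResMap

variable {N : Type w} [AddCommGroup N] [Module k N] [Module A N] [IsScalarTower k A N]
  {N' : Type x} [AddCommGroup N'] [Module k N'] [Module A N'] [IsScalarTower k A N']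

/-- Composition of a cochain with a linear map of the coefficients. -/
def compTriv {n : ℕ} (f : N →ₗ[A] N') (c : TrivCochain k A N n) : TrivCochain k A N' n :=
  ((resMap (rtHom k A) f).restrictScalars k).compMultilinearMap c

theorem compTriv_apply {n : ℕ} (f : N →ₗ[A] N') (c : TrivCochain k A N n) (a : Fin n → A) :
    compTriv f c a = resMap (rtHom k A) f (c a) := rfl

theorem hochschildD_compTriv {n : ℕ} (f : N →ₗ[A] N') (c : TrivCochain k A N n) :
    hochschildD k A _ n (compTriv f c) = compTriv f (hochschildD k A _ n c) :=
  hochschildD_comp _ _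

/-- The linear map on the free module that corresponds to a cochain. -/
def leftBarExtend {n : ℕ} (c : TrivCochain k A N n) : LeftBar k A n →ₗ[A] N :=
  TensorProduct.AlgebraTensorModule.lift
    (LinearMap.toSpanSingleton A ((⨂[k] _ : Fin n, A) →ₗ[k] N)
      ((resEquiv (rtHom k A) N).symm.toLinearMap ∘ₗ PiTensorProduct.lift c))

theorem leftBarExtend_tmul {n : ℕ} (c : TrivCochain k A N n) (x : A) (a : Fin n → A) :
    leftBarExtend c (x ⊗ₜ PiTensorProduct.tprod k a) =
      x • (resEquiv (rtHom k A) N).symm (c a) := by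
  simp [leftBarExtend]

variable (k A) in
/-- The universal cochain `(a₁, …, aₙ) ↦ 1 ⊗ (a₁, …, aₙ)`. -/
def leftBarUniv (n : ℕ) : TrivCochain k A (LeftBar k A n) n :=
  (resEquiv (rtHom k A) (LeftBar k A n)).toLinearMap.compMultilinearMap
    ((TensorProduct.mk k A (⨂[k] _ : Fin n, A) 1).compMultilinearMap (PiTensorProduct.tprod k))

theorem compTriv_leftBarUniv {n : ℕ} (c : TrivCochain k A N n) :
    compTriv (leftBarExtend c) (leftBarUniv k A n) = c := by
  ext a
  change resEquiv (rtHom k A) N (leftBarExtend c ((1 : A) ⊗ₜ PiTensorProduct.tprod k a)) = c a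
  rw [leftBarExtend_tmul, one_smul, LinearEquiv.apply_symm_apply]

theorem leftBar_linearMap_ext {n : ℕ} {f g : LeftBar k A n →ₗ[A] N}
    (h : compTriv f (leftBarUniv k A n) = compTriv g (leftBarUniv k A n)) : f = g := by
  apply TensorProduct.AlgebraTensorModule.curry_injective
  apply LinearMap.ext_ring
  apply PiTensorProduct.ext
  ext a
  exact MultilinearMap.congr_fun h a

theorem leftBarExtend_compTriv {n : ℕ} (f : N →ₗ[A] N') (c : TrivCochain k A N n) :
    leftBarExtend (compTriv f c) = f ∘ₗ leftBarExtend c := by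
  apply leftBar_linearMap_ext
  rw [compTriv_leftBarUniv]
  conv_lhs => rw [← compTriv_leftBarUniv c]
  rfl

variable (k A) in
/-- The differential of the free resolution. -/
def leftBarD (n : ℕ) : LeftBar k A (n + 1) →ₗ[A] LeftBar k A n :=
  leftBarExtend (hochschildD k A _ n (leftBarUniv k A n))

theorem compTriv_leftBarD (n : ℕ) : compTriv (leftBarD k A n) (leftBarUniv k A (n + 1)) =
    hochschildD k A _ n (leftBarUniv k A n) :=
  compTriv_leftBarUniv _

theorem leftBarExtend_leftBarD {n : ℕ} (c : TrivCochain k A N n) :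
    leftBarExtend c ∘ₗ leftBarD k A n = leftBarExtend (hochschildD k A _ n c) := by
  rw [leftBarD, ← leftBarExtend_compTriv, ← hochschildD_compTriv, compTriv_leftBarUniv]

theorem leftBarExtend_zero {n : ℕ} : leftBarExtend (0 : TrivCochain k A N n) = 0 := by
  apply leftBar_linearMap_ext
  rw [compTriv_leftBarUniv]
  rfl

/-- The composite corresponds to `δδ` of the universal cochain. Exactness of this complex is never
used: in lifting arguments it is only the projective source. -/
theorem leftBarD_leftBarD (n : ℕ) (b : LeftBar k A (n + 2)) :
    leftBarD k A n (leftBarD k A (n + 1) b) = 0 := by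
  have : leftBarD k A n ∘ₗ leftBarD k A (n + 1) = 0 := by
    rw [leftBarD, leftBarExtend_leftBarD, hochschildD_hochschildD, leftBarExtend_zero]
  exact LinearMap.congr_fun this b

variable (k A) in
/-- The cochain `1` of degree `0` with values in the trivial module. -/
def trivOne : TrivCochain k A (Triv k A) 0 :=
  MultilinearMap.constOfIsEmpty k (fun _ : Fin 0 => A) (resEquiv (rtHom k A) (Triv k A) (1 : k))

theorem smul_trivOne (x y : A) (a : Fin 0 → A) :
    (x ⊗ₜ[k] MulOpposite.op y : Env k A) • trivOne k A a =
      resEquiv (rtHom k A) (Triv k A)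
        (Coalgebra.counit (R := k) x * Coalgebra.counit (R := k) y : k) := by
  have e : (x ⊗ₜ[k] MulOpposite.op y : Env k A) • trivOne k A a =
      resEquiv (rtHom k A) (Triv k A)
        (Coalgebra.counit (R := k) (rtHom k A (x ⊗ₜ[k] MulOpposite.op y)) * 1 : k) := rfl
  rw [e, rtHom_tmul, map_smul, smul_eq_mul, mul_one, mul_comm]

theorem hochschildD_trivOne : hochschildD k A _ 0 (trivOne k A) = 0 := by
  ext a
  rw [hochschildD_apply, ← MulOpposite.op_one, smul_trivOne, smul_trivOne]
  simp

variable (k A) in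
/-- The augmentation of the free resolution. -/
def leftBarAug : LeftBar k A 0 →ₗ[A] Triv k A := leftBarExtend (trivOne k A)

theorem leftBarAug_leftBarD (b : LeftBar k A 1) : leftBarAug k A (leftBarD k A 0 b) = 0 := by
  have : leftBarAug k A ∘ₗ leftBarD k A 0 = 0 := by
    rw [leftBarAug, leftBarExtend_leftBarD, hochschildD_trivOne, leftBarExtend_zero]
  exact LinearMap.congr_fun this b

/-! ### Comparison with the bar resolution -/

variable {M : Type w} [AddCommGroup M] [Module k M] [Module (Env k A) M]
  [IsScalarTower k (Env k A) M] {M' : Type x} [AddCommGroup M'] [Module k M'] [Module (Env k A) M']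
  [IsScalarTower k (Env k A) M']

theorem fromAdCochain_symm_comp {n : ℕ} (f : M →ₗ[Env k A] M') (c : Cochain k A M n) :
    (fromAdCochain k A M' n).symm ((f.restrictScalars k).compMultilinearMap c) =
      compTriv (adMap f) ((fromAdCochain k A M n).symm c) := by
  change (fromAd M').symm.toLinearMap.compMultilinearMap (convCochain _ _) = _
  rw [convCochain_comp]
  rfl

theorem barExtend_comp_barUniv {n : ℕ} (c : Cochain k A M n) :
    ((barExtend c).restrictScalars k).compMultilinearMap (barUniv k A n) = c := by
  ext a
  exact barExtend_barUniv c a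

variable (k A) in
/-- The comparison map from the free resolution to the bar resolution. -/
def leftBarToBar (n : ℕ) : LeftBar k A n →ₗ[A] Ad k A (Bar k A n) :=
  leftBarExtend ((fromAdCochain k A (Bar k A n) n).symm (barUniv k A n))

/-- Along the standard comparison map, the Shapiro restriction of a cochain is the inverse of the
convolution isomorphism. -/
theorem barExtend_leftBarToBar {n : ℕ} (c : Cochain k A M n) :
    adMap (barExtend c) ∘ₗ leftBarToBar k A n =
      leftBarExtend ((fromAdCochain k A M n).symm c) := by
  rw [leftBarToBar, ← leftBarExtend_compTriv, ← fromAdCochain_symm_comp, barExtend_comp_barUniv]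

theorem barD_leftBarToBar (n : ℕ) :
    adMap (barD k A n) ∘ₗ leftBarToBar k A (n + 1) = leftBarToBar k A n ∘ₗ leftBarD k A n := by
  rw [barD, barExtend_leftBarToBar, ← hochschildD_fromAdCochain_symm, leftBarToBar,
    leftBarExtend_leftBarD]

theorem barAug_leftBarToBar :
    adMap (barAug k A) ∘ₗ leftBarToBar k A 0 = unitMap k A ∘ₗ leftBarAug k A := by
  rw [barAug, barExtend_leftBarToBar, leftBarAug, ← leftBarExtend_compTriv]
  congr 1
  rw [LinearEquiv.symm_apply_eq]
  ext a
  rw [fromAdCochain_apply, convCochain_wordProd_apply]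
  have e : (fun i : Fin 0 => Coalgebra.comul (R := k) (a i)) = fun i => a i ⊗ₜ[k] a i :=
    Subsingleton.elim _ _
  rw [e, twist_tmul, List.ofFn_zero, List.prod_nil, rightAct_one]
  exact (map_one (algebraMap k A)).symm

variable (k A) in
/-- Restriction along both `rtHom` and `deltaHom` changes nothing. -/
theorem rtHom_deltaHom (a : A) : rtHom k A (deltaHom k A a) = a := by
  have h1 : ∀ z : A ⊗[k] A, rtHom k A (Algebra.TensorProduct.map (AlgHom.id k A)
      (HopfAlgebra.antipodeAlgHomOp k A) z) =
      TensorProduct.rid k A (Coalgebra.counit.lTensor A z) := by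
    intro z
    induction z with
    | zero => simp
    | add x y hx hy => simp only [map_add, hx, hy]
    | tmul x y =>
      refine (rtHom_tmul _ _).trans ?_
      simp
  refine (h1 (Coalgebra.comul (R := k) a)).trans ?_
  rw [Coalgebra.lTensor_counit_comul]
  simp

/-- An `A`-module with trivial right multiplication as an adjoint module. -/
def adRes : Ad k A (Res (rtHom k A) N) →ₗ[A] N where
  toFun m := m
  map_add' _ _ := rfl
  map_smul' a m := by
    have : ∀ m : N, rtHom k A (deltaHom k A a) • m = a • m := fun m => by rw [rtHom_deltaHom]
    exact this m

variable (k A) in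
/-- The comparison map from the bar resolution to the free resolution. -/
def barToLeftBar (n : ℕ) : Ad k A (Bar k A n) →ₗ[A] LeftBar k A n :=
  adRes ∘ₗ adMap (barExtend (leftBarUniv k A n))

theorem leftBarD_barToLeftBar (n : ℕ) :
    leftBarD k A n ∘ₗ barToLeftBar k A (n + 1) = barToLeftBar k A n ∘ₗ adMap (barD k A n) := by
  have h : resMap (rtHom k A) (leftBarD k A n) ∘ₗ barExtend (leftBarUniv k A (n + 1)) =
      barExtend (leftBarUniv k A n) ∘ₗ barD k A n := by
    rw [barExtend_barD]
    apply bar_env_linearMap_ext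
    intro a
    rw [LinearMap.comp_apply, barExtend_barUniv, barExtend_barUniv, ← compTriv_leftBarD]
    rfl
  ext b
  exact LinearMap.congr_fun h b

theorem counit_env_smul (e : Env k A) (x : A) : Coalgebra.counit (R := k) (e • x) =
    Coalgebra.counit (R := k) (rtHom k A e) * Coalgebra.counit (R := k) x := by
  induction e using TensorProduct.induction_on with
  | zero =>
    refine (congrArg _ (zero_smul (Env k A) x)).trans ?_
    rw [map_zero, map_zero, map_zero, zero_mul]
  | add e e' h h' => rw [add_smul, map_add, map_add, map_add, add_mul, h, h']
  | tmul y z =>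
    obtain ⟨z, rfl⟩ := MulOpposite.op_surjective z
    rw [env_smul_def, rtHom_tmul, map_smul, Bialgebra.counit_mul, Bialgebra.counit_mul,
      smul_eq_mul, MulOpposite.unop_op]
    ring

variable (k A) in
/-- The counit as a map from `A` to the trivial bimodule. -/
def counitMap : A →ₗ[Env k A] Res (rtHom k A) (Triv k A) where
  toFun x := resEquiv (rtHom k A) (Triv k A) (Coalgebra.counit (R := k) x : k)
  map_add' x y := map_add (Coalgebra.counit (R := k) (A := A)) x y
  map_smul' e x := counit_env_smul e x

/-- This comparison covers the counit `A → k`, which splits the unit map. Composed with a lift of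
the unit map it therefore gives a chain map over the identity of `k`. -/
theorem leftBarAug_barToLeftBar (b : Ad k A (Bar k A 0)) :
    leftBarAug k A (barToLeftBar k A 0 b) =
      (resEquiv (rtHom k A) (Triv k A)).symm (counitMap k A (barAug k A b)) := by
  have h : resMap (rtHom k A) (leftBarAug k A) ∘ₗ barExtend (leftBarUniv k A 0) =
      counitMap k A ∘ₗ barAug k A := by
    apply bar_env_linearMap_ext
    intro a
    rw [LinearMap.comp_apply, LinearMap.comp_apply, barExtend_barUniv, barAug_barUniv,
      ← compTriv_apply, leftBarAug, compTriv_leftBarUniv]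
    exact congrArg (resEquiv (rtHom k A) (Triv k A)) (Bialgebra.counit_one (R := k) (A := A)).symm
  exact LinearMap.congr_fun h b

end LeftBar

/-! ### Classes and coboundaries -/

section Classes

variable {C : ℕ → Type w} [∀ n, AddCommGroup (C n)] (δ : ∀ n, C n →+ C (n + 1))

theorem cohClass_eq_cohClass_iff {n : ℕ} (c c' : cocycles δ n) :
    cohClass δ c = cohClass δ c' ↔ c.1 - c'.1 ∈ coboundaries δ n := by
  have h : cohClass δ c = cohClass δ c' ↔
      -c + c' ∈ (coboundaries δ n).addSubgroupOf (cocycles δ n) := QuotientAddGroup.eq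
  rw [h, AddSubgroup.mem_addSubgroupOf, ← neg_mem_iff]
  simp [sub_eq_add_neg, add_comm]

theorem cohClass_eq_zero_iff {n : ℕ} (c : cocycles δ n) :
    cohClass δ c = 0 ↔ c.1 ∈ coboundaries δ n := by
  have h : cohClass δ c = 0 ↔ c ∈ (coboundaries δ n).addSubgroupOf (cocycles δ n) :=
    QuotientAddGroup.eq_zero_iff c
  rw [h, AddSubgroup.mem_addSubgroupOf]

theorem cohClass_surjective {n : ℕ} : Function.Surjective (cohClass δ (n := n)) :=
  QuotientAddGroup.mk'_surjective _

end Classes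

/-! ### Representing Hochschild images by embedded cochains -/

section Comparison

variable {k : Type u} [Field k] {A : Type v} [Ring A] [HopfAlgebra k A]

variable (k A) in
/-- The embedding of the cochains with values in `k` into Hochschild cochains. -/
def embed (n : ℕ) (φ : TrivCochain k A (Triv k A) n) : Cochain k A A n :=
  fromAdCochain k A A n (compTriv (unitMap k A) φ)

theorem compTriv_zero {N N' : Type*} [AddCommGroup N] [Module k N] [Module A N]
    [IsScalarTower k A N] [AddCommGroup N'] [Module k N'] [Module A N'] [IsScalarTower k A N']
    {n : ℕ} (f : N →ₗ[A] N') : compTriv f (0 : TrivCochain k A N n) = 0 := by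
  ext a
  exact map_zero f

theorem hochschildD_embed {n : ℕ} (φ : TrivCochain k A (Triv k A) n) :
    hochschildD k A A n (embed k A n φ) = embed k A (n + 1) (hochschildD k A _ n φ) := by
  rw [embed, embed, hochschildD_fromAdCochain, hochschildD_compTriv]

theorem embed_mem_cocycles {n : ℕ} {φ : TrivCochain k A (Triv k A) n}
    (h : hochschildD k A _ n φ = 0) : embed k A n φ ∈ cocycles (hochschildD k A A) n := by
  change hochschildD k A A n _ = 0
  rw [hochschildD_embed, h, embed, compTriv_zero, map_zero]

variable (P : ProjRes.{u, v, w} k A)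

theorem ProjRes.aug_d (p : P.X 1) : P.aug (P.d 0 p) = 0 := P.exact_aug.apply_apply_eq_zero p

theorem ProjRes.d_d (n : ℕ) (p : P.X (n + 2)) : P.d n (P.d (n + 1) p) = 0 :=
  (P.exact_d n).apply_apply_eq_zero p

instance ProjRes.projective_X (n : ℕ) : Module.Projective A (P.X n) := P.projective n

variable (k A) in
/-- The differential of the restricted bar resolution. -/
def adBarD (n : ℕ) : Ad k A (Bar k A (n + 1)) →ₗ[A] Ad k A (Bar k A n) := adMap (barD k A n)

variable (k A) in
/-- The augmentation of the restricted bar resolution. -/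
def adBarAug : Ad k A (Bar k A 0) →ₗ[A] Ad k A A := adMap (barAug k A)

theorem exists_adBarD_eq_of_adBarAug_eq_zero (b : Ad k A (Bar k A 0))
    (hb : adBarAug k A b = 0) : ∃ c, adBarD k A 0 c = b :=
  exists_barD_eq_of_barAug_eq_zero b hb

theorem exists_adBarD_eq_of_adBarD_eq_zero (n : ℕ) (b : Ad k A (Bar k A (n + 1)))
    (hb : adBarD k A n b = 0) : ∃ c, adBarD k A (n + 1) c = b :=
  exists_barD_eq_of_barD_eq_zero n b hb

theorem adBarAug_surjective : Function.Surjective (adBarAug k A : Ad k A (Bar k A 0) → Ad k A A) :=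
  barAug_surjective (k := k) (A := A)

/-- `P` is projective and the restricted bar resolution is exact. Without such a lift no class would
have a Hochschild image. -/
theorem ProjRes.exists_unitLift : Nonempty (UnitLift P) := by
  obtain ⟨f, h₀, h⟩ := exists_chain_lift (R := A) (X := P.X) (Y := fun n => Ad k A (Bar k A n))
    (W := Ad k A A) P.d (adBarD k A) P.d_d
    (unitMap k A ∘ₗ P.aug) (fun p => by rw [LinearMap.comp_apply, P.aug_d, map_zero])
    (adBarAug k A) adBarAug_surjective exists_adBarD_eq_of_adBarAug_eq_zero
    exists_adBarD_eq_of_adBarD_eq_zero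
  exact ⟨⟨f, h, h₀⟩⟩

theorem ProjRes.exists_leftBar_lift : ∃ σ : ∀ n, LeftBar k A n →ₗ[A] P.X n,
    P.aug ∘ₗ σ 0 = leftBarAug k A ∧ ∀ n, P.d n ∘ₗ σ (n + 1) = σ n ∘ₗ leftBarD k A n :=
  exists_chain_lift (leftBarD k A) P.d leftBarD_leftBarD (leftBarAug k A) leftBarAug_leftBarD
    P.aug P.aug_surjective (fun y hy => (P.exact_aug y).1 hy) fun n y hy => (P.exact_d n y).1 hy

variable {P}

theorem adBarAug_leftBarToBar :
    adBarAug k A ∘ₗ leftBarToBar k A 0 = unitMap k A ∘ₗ leftBarAug k A :=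
  barAug_leftBarToBar

theorem adBarD_leftBarToBar (n : ℕ) :
    adBarD k A n ∘ₗ leftBarToBar k A (n + 1) = leftBarToBar k A n ∘ₗ leftBarD k A n :=
  barD_leftBarToBar n

/-- A comparison map from the free resolution to the restricted bar resolution is homotopic to the
standard one. -/
theorem exists_homotopy_leftBarToBar (f : ∀ n, LeftBar k A n →ₗ[A] Ad k A (Bar k A n))
    (h₀ : adBarAug k A ∘ₗ f 0 = unitMap k A ∘ₗ leftBarAug k A)
    (hf : ∀ n, adBarD k A n ∘ₗ f (n + 1) = f n ∘ₗ leftBarD k A n) :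
    ∃ h : ∀ n, LeftBar k A n →ₗ[A] Ad k A (Bar k A (n + 1)), ∀ n,
      f (n + 1) = leftBarToBar k A (n + 1) + adBarD k A (n + 1) ∘ₗ h (n + 1)
        + h n ∘ₗ leftBarD k A n := by
  have key := exists_homotopy (R := A) (X := LeftBar k A) (Y := fun n => Ad k A (Bar k A n))
    (W := Ad k A A) (leftBarD k A) (adBarD k A) leftBarD_leftBarD (adBarAug k A)
    exists_adBarD_eq_of_adBarAug_eq_zero
  have key' := key exists_adBarD_eq_of_adBarD_eq_zero f (leftBarToBar k A)
  exact key' (h₀.trans adBarAug_leftBarToBar.symm) hf adBarD_leftBarToBar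

/-- A Hochschild cocycle is determined up to coboundaries by its composite with a comparison map
from the free resolution. -/
theorem sub_fromAdCochain_mem_coboundaries {n : ℕ}
    (f : ∀ n, LeftBar k A n →ₗ[A] Ad k A (Bar k A n))
    (h₀ : adBarAug k A ∘ₗ f 0 = unitMap k A ∘ₗ leftBarAug k A)
    (hf : ∀ n, adBarD k A n ∘ₗ f (n + 1) = f n ∘ₗ leftBarD k A n)
    {c : Cochain k A A (n + 1)} (hc : hochschildD k A A (n + 1) c = 0)
    (φ : TrivCochain k A (Ad k A A) (n + 1)) (u : LeftBar k A n →ₗ[A] Ad k A A)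
    (h : adMap (barExtend c) ∘ₗ f (n + 1) = leftBarExtend φ + u ∘ₗ leftBarD k A n) :
    c - fromAdCochain k A A (n + 1) φ ∈ coboundaries (hochschildD k A A) (n + 1) := by
  obtain ⟨s, hs⟩ := exists_homotopy_leftBarToBar f h₀ hf
  -- As `c` is a cocycle, it kills the term of the homotopy that ends in a boundary; the other term
  -- factors through `leftBarD` and is absorbed into `u`.
  have hc' : adMap (barExtend c) ∘ₗ adBarD k A (n + 1) = 0 := by
    ext b
    have := LinearMap.congr_fun (barExtend_barD c) b
    rw [hc, barExtend_zero] at this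
    exact this
  have e : leftBarExtend ((fromAdCochain k A A (n + 1)).symm c) =
      leftBarExtend φ + (u - adMap (barExtend c) ∘ₗ s n) ∘ₗ leftBarD k A n := by
    rw [LinearMap.sub_comp, ← add_sub_assoc, ← h, hs, LinearMap.comp_add, LinearMap.comp_add,
      ← LinearMap.comp_assoc, hc', LinearMap.zero_comp, add_zero, LinearMap.comp_assoc,
      add_sub_cancel_right, barExtend_leftBarToBar]
  set t := u - adMap (barExtend c) ∘ₗ s n
  refine ⟨fromAdCochain k A A n (compTriv t (leftBarUniv k A n)), ?_⟩
  rw [hochschildD_fromAdCochain, ← LinearEquiv.eq_symm_apply, hochschildD_compTriv, map_sub,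
    LinearEquiv.symm_apply_apply, eq_sub_iff_add_eq',
    ← compTriv_leftBarUniv ((fromAdCochain k A A (n + 1)).symm c), e, ← compTriv_leftBarD]
  conv_lhs => rw [← compTriv_leftBarUniv φ]
  rfl

variable {σ : ∀ n, LeftBar k A n →ₗ[A] P.X n}

/-- The cochain of words that corresponds to a cochain of a projective resolution. -/
def pullCochain (σ : ∀ n, LeftBar k A n →ₗ[A] P.X n) {n : ℕ} (f : P.X n →ₗ[A] Triv k A) :
    TrivCochain k A (Triv k A) n :=
  compTriv (f ∘ₗ σ n) (leftBarUniv k A n)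

theorem leftBarExtend_compTriv_leftBarUniv {N : Type*} [AddCommGroup N] [Module k N] [Module A N]
    [IsScalarTower k A N] {n : ℕ} (f : LeftBar k A n →ₗ[A] N) :
    leftBarExtend (compTriv f (leftBarUniv k A n)) = f := by
  apply leftBar_linearMap_ext
  rw [compTriv_leftBarUniv]

theorem leftBarExtend_embed (σ : ∀ n, LeftBar k A n →ₗ[A] P.X n) {n : ℕ}
    (f : P.X n →ₗ[A] Triv k A) :
    leftBarExtend (compTriv (unitMap k A) (pullCochain σ f)) = unitMap k A ∘ₗ f ∘ₗ σ n := by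
  rw [leftBarExtend_compTriv, pullCochain, leftBarExtend_compTriv_leftBarUniv]

theorem hochschildD_pullCochain (hσ : ∀ n, P.d n ∘ₗ σ (n + 1) = σ n ∘ₗ leftBarD k A n) {n : ℕ}
    (f : P.X n →ₗ[A] Triv k A) :
    hochschildD k A _ n (pullCochain σ f) = pullCochain σ (f ∘ₗ P.d n) := by
  rw [pullCochain, pullCochain, hochschildD_compTriv, LinearMap.comp_assoc, hσ,
    ← compTriv_leftBarD]
  rfl

theorem hochschildD_pullCochain_eq_zero
    (hσ : ∀ n, P.d n ∘ₗ σ (n + 1) = σ n ∘ₗ leftBarD k A n) {n : ℕ} {f : P.X n →ₗ[A] Triv k A}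
    (hf : homD P (Triv k A) n f = 0) : hochschildD k A _ n (pullCochain σ f) = 0 := by
  have h : f ∘ₗ P.d n = 0 := hf
  rw [hochschildD_pullCochain hσ, h]
  rfl

theorem shapiro_cohClass_eq_iff (L : UnitLift P) {n : ℕ} (c : cocycles (hochschildD k A A) n)
    (f : cocycles (homD P (Triv k A)) n) :
    shapiro L n (cohClass _ c) = unitCoh P n (cohClass _ f) ↔
      adMap (barExtend c.1) ∘ₗ L.hom n - unitMap k A ∘ₗ f.1 ∈ coboundaries (homD P (Ad k A A)) n :=
  cohClass_eq_cohClass_iff (homD P (Ad k A A)) _ _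

/-- Composing the lift hidden in `h` with `σ` gives a comparison map from words to the bar
resolution over the unit map. It is homotopic to the standard one, so the Hochschild class does not
depend on the lift. -/
theorem sub_embed_mem_coboundaries (h₀ : P.aug ∘ₗ σ 0 = leftBarAug k A)
    (hσ : ∀ n, P.d n ∘ₗ σ (n + 1) = σ n ∘ₗ leftBarD k A n) {n : ℕ} (hn : 0 < n)
    (f : cocycles (homD P (Triv k A)) n) (c : cocycles (hochschildD k A A) n)
    (h : IsHochschildImage (cohClass _ f) (cohClass _ c)) :
    c.1 - embed k A n (pullCochain σ f.1) ∈ coboundaries (hochschildD k A A) n := by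
  obtain ⟨n, rfl⟩ : ∃ m, n = m + 1 := ⟨n - 1, by omega⟩
  obtain ⟨L, hL⟩ := h
  rw [shapiro_cohClass_eq_iff] at hL
  obtain ⟨g, hg⟩ := hL
  have hg' : g ∘ₗ P.d n = adMap (barExtend c.1) ∘ₗ L.hom (n + 1) - unitMap k A ∘ₗ f.1 := hg
  refine sub_fromAdCochain_mem_coboundaries (fun n => L.hom n ∘ₗ σ n) ?_ ?_ c.2 _ (g ∘ₗ σ n) ?_
  · have e : adBarAug k A ∘ₗ L.hom 0 = unitMap k A ∘ₗ P.aug := L.comm_aug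
    rw [← LinearMap.comp_assoc, e, LinearMap.comp_assoc, h₀]
  · intro n
    have e : adBarD k A n ∘ₗ L.hom (n + 1) = L.hom n ∘ₗ P.d n := L.comm n
    rw [← LinearMap.comp_assoc, e, LinearMap.comp_assoc, hσ, LinearMap.comp_assoc]
  · have e : (g ∘ₗ P.d n) ∘ₗ σ (n + 1) = (g ∘ₗ σ n) ∘ₗ leftBarD k A n := by
      rw [LinearMap.comp_assoc, hσ, LinearMap.comp_assoc]
    rw [leftBarExtend_embed, ← e, hg', LinearMap.sub_comp, LinearMap.comp_assoc,
      LinearMap.comp_assoc, add_sub_cancel]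

/-- Any lift may be chosen here, so one that factors through the words is taken. Along it the
embedded cochain restricts exactly to `f ∘ σ ∘ ρ`, and `σ ∘ ρ` is homotopic to the identity of `P`.
-/
theorem isHochschildImage_embed (h₀ : P.aug ∘ₗ σ 0 = leftBarAug k A)
    (hσ : ∀ n, P.d n ∘ₗ σ (n + 1) = σ n ∘ₗ leftBarD k A n) {n : ℕ} (hn : 0 < n)
    (f : cocycles (homD P (Triv k A)) n) (c : cocycles (hochschildD k A A) n)
    (hc : c.1 = embed k A n (pullCochain σ f.1)) :
    IsHochschildImage (cohClass _ f) (cohClass _ c) := by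
  obtain ⟨n, rfl⟩ : ∃ m, n = m + 1 := ⟨n - 1, by omega⟩
  obtain ⟨L⟩ := P.exists_unitLift
  let ρ : ∀ n, P.X n →ₗ[A] LeftBar k A n := fun n => barToLeftBar k A n ∘ₗ L.hom n
  have hρ : ∀ n, leftBarD k A n ∘ₗ ρ (n + 1) = ρ n ∘ₗ P.d n := by
    intro n
    rw [← LinearMap.comp_assoc, leftBarD_barToLeftBar, LinearMap.comp_assoc, L.comm,
      LinearMap.comp_assoc]
  have hρ₀ : leftBarAug k A ∘ₗ ρ 0 = P.aug := by
    ext p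
    have e : barAug k A (L.hom 0 p) = algebraMap k A (P.aug p) :=
      LinearMap.congr_fun L.comm_aug p
    refine (leftBarAug_barToLeftBar _).trans ?_
    rw [e]
    exact Bialgebra.counit_algebraMap (A := A) (R := k) _
  let L' : UnitLift P :=
    { hom := fun n => leftBarToBar k A n ∘ₗ ρ n
      comm := fun n => by
        rw [← LinearMap.comp_assoc, barD_leftBarToBar, LinearMap.comp_assoc, hρ]
        rfl
      comm_aug := by
        rw [← LinearMap.comp_assoc, barAug_leftBarToBar, LinearMap.comp_assoc, hρ₀] }
  obtain ⟨s, hs⟩ := exists_homotopy P.d P.d P.d_d P.aug (fun y hy => (P.exact_aug y).1 hy)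
    (fun n y hy => (P.exact_d n y).1 hy) (fun n => σ n ∘ₗ ρ n) (fun n => LinearMap.id)
    (by rw [← LinearMap.comp_assoc, h₀, hρ₀]; rfl)
    (fun n => by
      rw [← LinearMap.comp_assoc, hσ, LinearMap.comp_assoc, hρ]
      rfl)
    fun n => rfl
  refine ⟨L', ?_⟩
  rw [shapiro_cohClass_eq_iff]
  -- The primitive is `f` after the homotopy; the other homotopy term dies because `f` is a cocycle.
  refine ⟨unitMap k A ∘ₗ f.1 ∘ₗ s n, ?_⟩
  have hf : f.1 ∘ₗ P.d (n + 1) = 0 := f.2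
  change (unitMap k A ∘ₗ f.1 ∘ₗ s n) ∘ₗ P.d n = adMap (barExtend c.1) ∘ₗ
    (leftBarToBar k A (n + 1) ∘ₗ ρ (n + 1)) - unitMap k A ∘ₗ f.1
  have e : adMap (barExtend c.1) ∘ₗ (leftBarToBar k A (n + 1) ∘ₗ ρ (n + 1)) =
      unitMap k A ∘ₗ f.1 ∘ₗ (σ (n + 1) ∘ₗ ρ (n + 1)) := by
    rw [← LinearMap.comp_assoc (ρ (n + 1)), barExtend_leftBarToBar, hc, embed,
      LinearEquiv.symm_apply_apply, leftBarExtend_embed]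
    rfl
  rw [e, hs]
  ext p
  have hp : f.1 (P.d (n + 1) (s (n + 1) p)) = 0 := LinearMap.congr_fun hf _
  simp [hp]

end Comparison

/-! ## Reversal of cochains -/

section Reversal

variable {k : Type u} [Field k] {A : Type v} [Ring A] [HopfAlgebra k A]

/-- Both `S ∘ S` and the identity are convolution inverse to `S`: by cocommutativity `∑ S(S(a₁))
S(a₂) = S(∑ a₂ S(a₁)) = ε(a)`. -/
theorem antipode_antipode_of_isCocomm [Coalgebra.IsCocomm k A] (a : A) :
    HopfAlgebra.antipode k (HopfAlgebra.antipode k a) = a := by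
  have h : WithConv.toConv (HopfAlgebra.antipode k (A := A) ∘ₗ HopfAlgebra.antipode k) *
      WithConv.toConv (HopfAlgebra.antipode k (A := A)) = 1 := by
    ext c
    have e : ∀ z : A ⊗[k] A, LinearMap.mul' k A (TensorProduct.map
        (HopfAlgebra.antipode k ∘ₗ HopfAlgebra.antipode k) (HopfAlgebra.antipode k) z) =
        HopfAlgebra.antipode k (LinearMap.mul' k A ((HopfAlgebra.antipode k).lTensor A
          (TensorProduct.comm k A A z))) := by
      intro z
      induction z with
      | zero => simp
      | add x y hx hy => simp only [map_add, hx, hy]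
      | tmul x y => simp [HopfAlgebra.antipode_mul_antidistrib]
    refine (e (Coalgebra.comul (R := k) c)).trans ?_
    rw [Coalgebra.comm_comul, HopfAlgebra.mul_antipode_lTensor_comul_apply,
      Algebra.algebraMap_eq_smul_one, map_smul, HopfAlgebra.antipode_one]
    exact (Algebra.algebraMap_eq_smul_one _).symm
  have := left_inv_eq_right_inv h LinearMap.antipode_mul_id
  exact congr($(congrArg WithConv.ofConv this) a)

/-- The flip sends `∑ a₁ ⊗ S(a₂)` to `∑ S(S(a₂)) ⊗ S(a₁)`, which is `∑ a₂ ⊗ S(a₁)`. Hence reversing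
a bimodule does not change its adjoint module. -/
theorem flipHom_deltaHom [Coalgebra.IsCocomm k A] (a : A) :
    flipHom k A (deltaHom k A a) = deltaHom k A a := by
  have e : ∀ z : A ⊗[k] A, flipHom k A (Algebra.TensorProduct.map (AlgHom.id k A)
      (HopfAlgebra.antipodeAlgHomOp k A) z) =
      Algebra.TensorProduct.map (AlgHom.id k A) (HopfAlgebra.antipodeAlgHomOp k A)
        (TensorProduct.comm k A A z) := by
    intro z
    induction z with
    | zero => simp
    | add x y hx hy => simp only [map_add, hx, hy]
    | tmul x y =>
      refine (flipHom_tmul _ _).trans ?_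
      rw [antipode_antipode_of_isCocomm]
      rfl
  refine (e (Coalgebra.comul (R := k) a)).trans ?_
  rw [Coalgebra.comm_comul]
  rfl

variable (k) in
/-- The sign `(-1)^(n(n+1)/2)`. -/
def revSign : ℕ → k
  | 0 => 1
  | n + 1 => (-1) ^ (n + 1) * revSign n

theorem revSign_mul_self (n : ℕ) : revSign k n * revSign k n = 1 := by
  induction n with
  | zero => simp [revSign]
  | succ n ih =>
    rw [revSign, mul_mul_mul_comm, ih, ← mul_pow]
    simp

theorem revSign_add (m n : ℕ) :
    revSign k (m + n) = revSign k m * revSign k n * (-1) ^ (m * n) := by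
  induction n with
  | zero => simp [revSign]
  | succ n ih =>
    rw [← add_assoc, revSign, ih, revSign]
    ring

/-- The source of the minus sign in `T[f, g] = -[Tf, Tg]`. -/
theorem revSign_bracket {m n N : ℕ} (h : N + 1 = m + n) :
    revSign k N * (-1) ^ ((m + 1) * (n + 1)) = -(revSign k m * revSign k n) := by
  have h1 := revSign_add (k := k) m n
  rw [← h, revSign] at h1
  have h2 : ∀ j : ℕ, (-1 : k) ^ j * (-1) ^ j = 1 := fun j => by
    rw [← mul_pow]
    simp
  calc revSign k N * (-1) ^ ((m + 1) * (n + 1))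
      = (-1) ^ (N + 1) * ((-1) ^ (N + 1) * revSign k N) * (-1) ^ ((m + 1) * (n + 1)) := by
        rw [← mul_assoc, h2, one_mul]
    _ = -(revSign k m * revSign k n * (((-1) ^ (m * n) * (-1) ^ (m * n)) *
          ((-1) ^ (m + n) * (-1) ^ (m + n)))) := by
        rw [h1, h]
        ring
    _ = _ := by rw [h2, h2, mul_one, mul_one]

variable {M : Type w} [AddCommGroup M] [Module k M]

/-- The cochain `(a₁, …, aₙ) ↦ c (S aₙ, …, S a₁)`. -/
def reverse {n : ℕ} (c : Cochain k A M n) : Cochain k A M n :=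
  (c.compLinearMap fun _ => HopfAlgebra.antipode k).domDomCongr Fin.revPerm

theorem reverse_apply {n : ℕ} (c : Cochain k A M n) (a : Fin n → A) :
    reverse c a = c fun i => HopfAlgebra.antipode k (a i.rev) := rfl

theorem insertArg_antipode_rev {m n N : ℕ} (h : N + 1 = m + n) (i : Fin m)
    (g g' : Cochain k A A n)
    (hg : ∀ b, reverse g b = HopfAlgebra.antipode k (g' b)) (a : Fin N → A) :
    insertArg h i g (fun l => HopfAlgebra.antipode k (a l.rev)) =
      fun j => HopfAlgebra.antipode k (insertArg h i.rev g' a j.rev) := by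
  funext j
  unfold insertArg
  rcases lt_trichotomy j.1 i.1 with h1 | h1 | h1
  · rw [dif_pos h1, dif_neg (by simp; omega), dif_neg (by simp [Fin.ext_iff]; omega)]
    refine congrArg (fun t => HopfAlgebra.antipode k (a t)) (Fin.ext ?_)
    simp
    omega
  · obtain rfl : j = i := Fin.ext h1
    rw [dif_neg (lt_irrefl _), dif_pos rfl, dif_neg (lt_irrefl _), dif_pos rfl, ← hg,
      reverse_apply]
    congr 1
    funext l
    refine congrArg (fun t => HopfAlgebra.antipode k (a t)) (Fin.ext ?_)
    simp
    omega
  · rw [dif_neg (by omega), dif_neg (fun e => h1.ne' (congrArg Fin.val e)),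
      dif_pos (by simp; omega)]
    refine congrArg (fun t => HopfAlgebra.antipode k (a t)) (Fin.ext ?_)
    simp
    omega

theorem reverse_mkPiAlgebraFin_two (b : Fin 2 → A) :
    reverse (MultilinearMap.mkPiAlgebraFin k 2 A) b =
      HopfAlgebra.antipode k (MultilinearMap.mkPiAlgebraFin k 2 A b) := by
  rw [reverse_apply, MultilinearMap.mkPiAlgebraFin_apply, MultilinearMap.mkPiAlgebraFin_apply]
  simp [List.ofFn_succ, HopfAlgebra.antipode_mul_antidistrib, Fin.rev]

section Flip

/-- The signed reversal, with values in the reversed bimodule. -/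
def flipCochain {n : ℕ} (c : Cochain k A M n) : Cochain k A (Res (flipHom k A) M) n :=
  revSign k n • (resEquiv (flipHom k A) M).toLinearMap.compMultilinearMap (reverse c)

theorem flipCochain_apply {n : ℕ} (c : Cochain k A M n) (a : Fin n → A) :
    flipCochain c a = resEquiv (flipHom k A) M
      (revSign k n • c fun i => HopfAlgebra.antipode k (a i.rev)) := rfl

variable [Module (Env k A) M] [IsScalarTower k (Env k A) M]

/-- Reversal exchanges the outer terms of the differential and reverses the order of the inner ones;
the resulting sign `(-1)^(n+1)` is the quotient of consecutive values of `revSign`. -/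
theorem hochschildD_flipCochain {n : ℕ} (c : Cochain k A M n) :
    hochschildD k A _ n (flipCochain c) = flipCochain (hochschildD k A M n c) := by
  refine MultilinearMap.ext fun a : Fin (n + 1) → A => ?_
  rw [hochschildD_apply]
  simp only [flipCochain_apply, smul_resEquiv, ← map_smul, ← map_sum, ← map_add]
  congr 1
  set b : Fin (n + 1) → A := fun i => HopfAlgebra.antipode k (a i.rev) with hb
  have hc : ∀ (r : k) (e : Env k A) (m : M), e • r • m = r • e • m :=
    fun r e m => smul_comm _ _ _
  have h0 : (fun i : Fin n => HopfAlgebra.antipode k (a i.rev.succ)) = fun i => b i.castSucc := by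
    funext i
    rw [hb]
    simp only [Fin.rev_castSucc]
  have h1 : (fun i : Fin n => HopfAlgebra.antipode k (a i.rev.castSucc)) = fun i => b i.succ := by
    funext i
    rw [hb]
    simp only [Fin.rev_succ]
  have h2 : ∀ i : Fin n, (fun j : Fin n => HopfAlgebra.antipode k
      (insertArg (n := 2) rfl i (MultilinearMap.mkPiAlgebraFin k 2 A) a j.rev)) =
      insertArg (n := 2) rfl i.rev (MultilinearMap.mkPiAlgebraFin k 2 A) b := by
    intro i
    rw [insertArg_antipode_rev (n := 2) rfl i.rev _ _ reverse_mkPiAlgebraFin_two, Fin.rev_rev]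
  have h3 : ∀ i : Fin n, (-1 : k) ^ (n + 1) * (-1) ^ (i.rev.1 + 1) = (-1) ^ (i.1 + 1) := by
    intro i
    have : n + 1 + (i.rev.1 + 1) = (i.1 + 1) + 2 * (n - i.1) := by
      rw [Fin.val_rev]
      omega
    rw [← pow_add, this, pow_add _ (i.1 + 1), pow_mul]
    simp
  have h4 : (-1 : k) ^ (n + 1) * (-1) ^ (n + 1) = 1 := by
    rw [← mul_pow]
    simp
  have hl : b (Fin.last n) = HopfAlgebra.antipode k (a 0) := by simp [hb]
  have hz : b 0 = HopfAlgebra.antipode k (a (Fin.last n)) := by simp [hb]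
  rw [h0, h1, hochschildD_apply, hl, hz, ← MulOpposite.op_one, flipHom_tmul, flipHom_tmul,
    HopfAlgebra.antipode_one, hc, hc, smul_add, smul_add, revSign, Finset.smul_sum]
  simp only [h2, smul_smul]
  rw [← Equiv.sum_comp Fin.revPerm fun i : Fin n => ((-1 : k) ^ (i.1 + 1) * revSign k n) •
    c (insertArg (n := 2) rfl i.rev (MultilinearMap.mkPiAlgebraFin k 2 A) b)]
  have h5 : ∀ i : Fin n, (-1 : k) ^ (i.rev.1 + 1) * revSign k n =
      (-1) ^ (n + 1) * revSign k n * (-1) ^ (i.1 + 1) := by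
    intro i
    rw [mul_right_comm, ← h3 i.rev, Fin.rev_rev]
  rw [mul_right_comm, h4, one_mul]
  simp only [Fin.revPerm_apply, Fin.rev_rev, h5]
  abel

theorem flipCochain_comp {M' : Type x} [AddCommGroup M'] [Module k M'] [Module (Env k A) M']
    [IsScalarTower k (Env k A) M'] (f : M →ₗ[Env k A] M') {n : ℕ} (c : Cochain k A M n) :
    flipCochain ((f.restrictScalars k).compMultilinearMap c) =
      ((resMap (flipHom k A) f).restrictScalars k).compMultilinearMap (flipCochain c) := by
  ext a
  exact (LinearMap.map_smul_of_tower f (revSign k n) _).symm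

end Flip

/-- The signed reversal `(a₁, …, aₙ) ↦ ± S (f (S aₙ, …, S a₁))` of Hochschild cochains. -/
def antipodeReverse {n : ℕ} (f : Cochain k A A n) : Cochain k A A n :=
  revSign k n • (HopfAlgebra.antipode k).compMultilinearMap (reverse f)

/-- Slot `i` becomes slot `i.rev`. The antipode applied to the inner value meets the one applied to
the letters of the reversed `f`, and `S² = 1` removes both. -/
theorem insertAt_antipode_reverse [Coalgebra.IsCocomm k A] {m n N : ℕ} (h : N + 1 = m + n)
    (i : Fin m) (f : Cochain k A A m) (g : Cochain k A A n) :
    (HopfAlgebra.antipode k).compMultilinearMap (reverse (insertAt h i f g)) =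
      insertAt h i.rev ((HopfAlgebra.antipode k).compMultilinearMap (reverse f))
        ((HopfAlgebra.antipode k).compMultilinearMap (reverse g)) := by
  ext a
  rw [LinearMap.compMultilinearMap_apply, reverse_apply, insertAt_apply, insertAt_apply,
    insertArg_antipode_rev h i g ((HopfAlgebra.antipode k).compMultilinearMap (reverse g))
      fun b => (antipode_antipode_of_isCocomm _).symm]
  rfl

theorem circ_antipode_reverse [Coalgebra.IsCocomm k A] {m n N : ℕ} (h : N + 1 = m + n)
    (f : Cochain k A A m) (g : Cochain k A A n) :
    (HopfAlgebra.antipode k).compMultilinearMap (reverse (circ h f g)) =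
      (-1 : k) ^ ((m + 1) * (n + 1)) •
        circ h ((HopfAlgebra.antipode k).compMultilinearMap (reverse f))
          ((HopfAlgebra.antipode k).compMultilinearMap (reverse g)) := by
  have e : (HopfAlgebra.antipode k).compMultilinearMap (reverse (circ h f g)) =
      ∑ i : Fin m, (-1 : k) ^ (i.1 * (n + 1)) •
        (HopfAlgebra.antipode k).compMultilinearMap (reverse (insertAt h i f g)) := by
    ext a
    simp only [LinearMap.compMultilinearMap_apply, reverse_apply, circ, sum_apply, smul_apply,
      map_sum, map_smul]
  -- Since `i + i.rev = m - 1`, reindexing by `i.rev` changes every sign by the same factor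
  -- `(-1)^((m-1)(n-1))`.
  have hs : ∀ i : Fin m, (-1 : k) ^ (i.1 * (n + 1)) =
      (-1) ^ ((m + 1) * (n + 1)) * (-1) ^ (i.rev.1 * (n + 1)) := by
    intro i
    have : (m + 1) * (n + 1) + i.rev.1 * (n + 1) =
        i.1 * (n + 1) + 2 * ((i.rev.1 + 1) * (n + 1)) := by
      obtain ⟨d, hd⟩ : ∃ d, m = i.1 + 1 + d := ⟨m - i.1 - 1, by omega⟩
      have hr : i.rev.1 = d := by rw [Fin.val_rev]; omega
      rw [hr]
      nth_rw 1 [hd]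
      ring
    rw [← pow_add, this, pow_add, pow_mul]
    simp
  rw [e, circ, Finset.smul_sum]
  rw [← Equiv.sum_comp Fin.revPerm]
  refine Finset.sum_congr rfl fun i _ => ?_
  rw [insertAt_antipode_reverse, smul_smul, hs, Fin.revPerm_apply, Fin.rev_rev]

/-- Both circle products in the bracket acquire the same sign under reversal, and `revSign_bracket`
combines it with the normalization to `-1`. -/
theorem antipodeReverse_cochainBracket [Coalgebra.IsCocomm k A] {m n N : ℕ} (h : N + 1 = m + n)
    (f : Cochain k A A m) (g : Cochain k A A n) :
    antipodeReverse (cochainBracket h f g) =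
      -cochainBracket h (antipodeReverse f) (antipodeReverse g) := by
  set S := HopfAlgebra.antipode k (A := A) with hS
  have e : S.compMultilinearMap (reverse (cochainBracket h f g)) =
      S.compMultilinearMap (reverse (circ h f g)) - (-1 : k) ^ ((m + 1) * (n + 1)) •
        S.compMultilinearMap (reverse (circ (h.trans (Nat.add_comm m n)) g f)) := by
    ext a
    simp only [LinearMap.compMultilinearMap_apply, reverse_apply, cochainBracket, sub_apply,
      smul_apply, map_sub, map_smul]
  have e' : cochainBracket h (antipodeReverse f) (antipodeReverse g) =
      (revSign k m * revSign k n) • cochainBracket h (S.compMultilinearMap (reverse f))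
        (S.compMultilinearMap (reverse g)) := by
    simp only [antipodeReverse, cochainBracket, ← circLin_apply, map_smul, LinearMap.smul_apply,
      smul_sub, smul_smul]
    congr 2
    · rw [mul_comm]
    · ring
  rw [e']
  refine Eq.trans ?_ (neg_smul (revSign k m * revSign k n)
    (cochainBracket h (S.compMultilinearMap (reverse f)) (S.compMultilinearMap (reverse g))))
  rw [← revSign_bracket h, antipodeReverse, e, circ_antipode_reverse,
    circ_antipode_reverse, mul_smul, cochainBracket, mul_comm (n + 1)]
  exact congrArg (revSign k N • ·) (smul_sub _ _ _).symm

end Reversal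

/-! ### Reversal of the bar resolution and its effect on classes -/

section ReversalHomotopy

variable {k : Type u} [Field k] {A : Type v} [Ring A] [HopfAlgebra k A]

theorem antipode_algebraMap (r : k) :
    HopfAlgebra.antipode k (algebraMap k A r) = algebraMap k A r := by
  rw [Algebra.algebraMap_eq_smul_one, map_smul, HopfAlgebra.antipode_one]

theorem antipode_env_smul (e : Env k A) (b : A) : HopfAlgebra.antipode k (e • b) =
    flipHom k A e • HopfAlgebra.antipode k b := by
  induction e using TensorProduct.induction_on with
  | zero =>
    refine (congrArg _ (zero_smul (Env k A) b)).trans ?_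
    rw [map_zero, map_zero]
    exact (zero_smul (Env k A) (HopfAlgebra.antipode k b)).symm
  | add e e' h h' => rw [add_smul, map_add, map_add, add_smul, h, h']
  | tmul x y =>
    obtain ⟨y, rfl⟩ := MulOpposite.op_surjective y
    rw [env_smul_def, flipHom_tmul, env_smul_def, HopfAlgebra.antipode_mul_antidistrib,
      HopfAlgebra.antipode_mul_antidistrib, MulOpposite.unop_op, MulOpposite.unop_op, mul_assoc]

variable (k A) in
/-- The antipode as a bimodule map to the reversed bimodule. -/
def antipodeToFlip : A →ₗ[Env k A] Res (flipHom k A) A where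
  toFun b := resEquiv (flipHom k A) A (HopfAlgebra.antipode k b)
  map_add' x y := map_add (HopfAlgebra.antipode k) x y
  map_smul' e b := antipode_env_smul e b

theorem barExtend_comp_eq {M M' : Type*} [AddCommGroup M] [Module k M] [Module (Env k A) M]
    [IsScalarTower k (Env k A) M] [AddCommGroup M'] [Module k M'] [Module (Env k A) M']
    [IsScalarTower k (Env k A) M'] (f : M →ₗ[Env k A] M') {n : ℕ} (c : Cochain k A M n) :
    barExtend ((f.restrictScalars k).compMultilinearMap c) = f ∘ₗ barExtend c := by
  apply bar_env_linearMap_ext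
  intro a
  rw [LinearMap.comp_apply, barExtend_barUniv, barExtend_barUniv]
  rfl

variable (k A) in
/-- The reversal of the bar resolution. -/
def barFlip (n : ℕ) : Bar k A n →ₗ[Env k A] Res (flipHom k A) (Bar k A n) :=
  barExtend (flipCochain (barUniv k A n))

theorem barD_barFlip (n : ℕ) :
    resMap (flipHom k A) (barD k A n) ∘ₗ barFlip k A (n + 1) = barFlip k A n ∘ₗ barD k A n := by
  rw [barFlip, barFlip, barExtend_barD, hochschildD_flipCochain]
  apply bar_env_linearMap_ext
  intro a
  have h := flipCochain_comp (M := Bar k A (n + 1)) (M' := Bar k A n) (barD k A n) (barUniv k A (n + 1))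
  have h' : ((barD k A n).restrictScalars k).compMultilinearMap (barUniv k A (n + 1)) =
      hochschildD k A (Bar k A n) n (barUniv k A n) := MultilinearMap.ext barD_barUniv
  rw [LinearMap.comp_apply, barExtend_barUniv, barExtend_barUniv, ← h', h]
  rfl

theorem barExtend_barFlip {n : ℕ} (c : Cochain k A A n) :
    resMap (flipHom k A) (barExtend c) ∘ₗ barFlip k A n = barExtend (flipCochain c) := by
  apply bar_env_linearMap_ext
  intro a
  have h := flipCochain_comp (M := Bar k A n) (M' := A) (barExtend c) (barUniv k A n)
  rw [barExtend_comp_barUniv] at h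
  rw [LinearMap.comp_apply, barFlip, barExtend_barUniv, barExtend_barUniv, h]
  rfl

/-- The reversal of the bar resolution covers the antipode of `A`, which fixes scalars; that is why
a lift of the unit map stays a lift after reversal. -/
theorem barAug_barFlip :
    resMap (flipHom k A) (barAug k A) ∘ₗ barFlip k A 0 = antipodeToFlip k A ∘ₗ barAug k A := by
  rw [barAug, barExtend_barFlip, ← barExtend_comp_eq]
  congr 1
  ext a
  change (1 : k) • (1 : A) = HopfAlgebra.antipode k 1
  rw [one_smul, HopfAlgebra.antipode_one]

variable [Coalgebra.IsCocomm k A]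

variable (k A) in
/-- The antipode as a bimodule map from the reversed bimodule. -/
def antipodeOfFlip : Res (flipHom k A) A →ₗ[Env k A] A where
  toFun b := HopfAlgebra.antipode k ((resEquiv (flipHom k A) A).symm b)
  map_add' x y := map_add (HopfAlgebra.antipode k) _ _
  map_smul' e b := by
    have h : flipHom k A (flipHom k A e) = e := by
      induction e using TensorProduct.induction_on with
      | zero => rw [map_zero, map_zero]
      | add e e' h h' => rw [map_add, map_add, h, h']
      | tmul x y =>
        obtain ⟨y, rfl⟩ := MulOpposite.op_surjective y
        rw [flipHom_tmul, flipHom_tmul, antipode_antipode_of_isCocomm,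
          antipode_antipode_of_isCocomm]
    exact (antipode_env_smul (flipHom k A e) _).trans (by rw [h]; rfl)

theorem antipodeReverse_eq {n : ℕ} (f : Cochain k A A n) : antipodeReverse f =
    ((antipodeOfFlip k A).restrictScalars k).compMultilinearMap (flipCochain f) := by
  ext a
  exact (map_smul (HopfAlgebra.antipode k) (revSign k n) _).symm

theorem hochschildD_antipodeReverse {n : ℕ} (f : Cochain k A A n) :
    hochschildD k A A n (antipodeReverse f) = antipodeReverse (hochschildD k A A n f) := by
  rw [antipodeReverse_eq, antipodeReverse_eq, hochschildD_comp, hochschildD_flipCochain]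

theorem hochschildD_antipodeReverse_eq_zero {n : ℕ} {f : Cochain k A A n}
    (hf : hochschildD k A A n f = 0) : hochschildD k A A n (antipodeReverse f) = 0 := by
  rw [hochschildD_antipodeReverse, hf, antipodeReverse_eq]
  ext a
  change HopfAlgebra.antipode k (revSign k (n + 1) • (0 : A)) = 0
  rw [smul_zero, map_zero]

theorem flipCochain_antipodeReverse {n : ℕ} (f : Cochain k A A n) :
    flipCochain (antipodeReverse f) =
      ((antipodeToFlip k A).restrictScalars k).compMultilinearMap f := by
  refine MultilinearMap.ext fun a : Fin n → A => ?_
  change revSign k n • revSign k n • HopfAlgebra.antipode k (f fun i =>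
    HopfAlgebra.antipode k (HopfAlgebra.antipode k (a i.rev.rev))) = HopfAlgebra.antipode k (f a)
  simp only [antipode_antipode_of_isCocomm, Fin.rev_rev]
  rw [smul_smul, revSign_mul_self, one_smul]

/-- The adjoint modules of a bimodule and of the reversed bimodule agree. -/
def adFlip (M : Type w) [AddCommGroup M] [Module (Env k A) M] :
    Ad k A (Res (flipHom k A) M) →ₗ[A] Ad k A M where
  toFun m := m
  map_add' _ _ := rfl
  map_smul' a m := by
    have : ∀ m : M, flipHom k A (deltaHom k A a) • m = deltaHom k A a • m := fun m => by
      rw [flipHom_deltaHom]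
    exact this m

variable (k A) in
/-- The comparison map from the free resolution followed by the reversal. -/
def leftBarToBarFlip (n : ℕ) : LeftBar k A n →ₗ[A] Ad k A (Bar k A n) :=
  adFlip (Bar k A n) ∘ₗ adMap (barFlip k A n) ∘ₗ leftBarToBar k A n

theorem adBarD_leftBarToBarFlip (n : ℕ) :
    adBarD k A n ∘ₗ leftBarToBarFlip k A (n + 1) = leftBarToBarFlip k A n ∘ₗ leftBarD k A n := by
  refine LinearMap.ext fun b => ?_
  have h := LinearMap.congr_fun (barD_barFlip (k := k) (A := A) n) (leftBarToBar k A (n + 1) b)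
  have h' : barD k A n (leftBarToBar k A (n + 1) b) = leftBarToBar k A n (leftBarD k A n b) :=
    LinearMap.congr_fun (barD_leftBarToBar n) b
  exact h.trans (congrArg (barFlip k A n) h')

theorem adBarAug_leftBarToBarFlip :
    adBarAug k A ∘ₗ leftBarToBarFlip k A 0 = unitMap k A ∘ₗ leftBarAug k A := by
  refine LinearMap.ext fun b => ?_
  have h := LinearMap.congr_fun (barAug_barFlip (k := k) (A := A)) (leftBarToBar k A 0 b)
  have h' : barAug k A (leftBarToBar k A 0 b) = algebraMap k A (leftBarAug k A b) :=
    LinearMap.congr_fun barAug_leftBarToBar b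
  exact h.trans ((congrArg (antipodeToFlip k A) h').trans (antipode_algebraMap (A := A) _))

/-- The reversal fixes the classes that come from the cohomology of the Hopf algebra. -/
theorem antipodeReverse_embed_sub_mem_coboundaries {n : ℕ} (hn : 0 < n)
    {φ : TrivCochain k A (Triv k A) n} (hφ : hochschildD k A _ n φ = 0) :
    antipodeReverse (embed k A n φ) - embed k A n φ ∈ coboundaries (hochschildD k A A) n := by
  obtain ⟨n, rfl⟩ : ∃ m, n = m + 1 := ⟨n - 1, by omega⟩
  -- Tested against the reversed lift, the reversed cochain is the antipode of the values of the
  -- embedded one on the standard lift. Those values are scalars, so the two agree exactly and the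
  -- correction is `0`.
  refine sub_fromAdCochain_mem_coboundaries (leftBarToBarFlip k A) adBarAug_leftBarToBarFlip
    adBarD_leftBarToBarFlip ?_ _ 0 ?_
  · exact hochschildD_antipodeReverse_eq_zero (embed_mem_cocycles hφ)
  · rw [LinearMap.zero_comp, add_zero, leftBarExtend_compTriv]
    refine LinearMap.ext fun b => ?_
    have h := LinearMap.congr_fun (barExtend_barFlip (antipodeReverse (embed k A (n + 1) φ)))
      (leftBarToBar k A (n + 1) b)
    rw [flipCochain_antipodeReverse, barExtend_comp_eq] at h
    have h' : barExtend (embed k A (n + 1) φ) (leftBarToBar k A (n + 1) b) =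
        algebraMap k A (leftBarExtend φ b) := by
      refine (LinearMap.congr_fun (barExtend_leftBarToBar (embed k A (n + 1) φ)) b).trans ?_
      rw [embed, LinearEquiv.symm_apply_apply, leftBarExtend_compTriv]
      rfl
    exact h.trans ((congrArg (antipodeToFlip k A) h').trans (antipode_algebraMap (A := A) _))

end ReversalHomotopy

/-! ## Colinear cochains -/

section Colinear

variable {k : Type u} [Field k] {A : Type v} [Ring A] [HopfAlgebra k A]

variable (k A) in
/-- The colinear cochains form a subspace. -/
def colinear (n : ℕ) : Submodule k (Cochain k A A n) where
  carrier := {f | IsColinear f}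
  zero_mem' a := by
    have : wordMap (0 : Cochain k A A n) = 0 := by simp [wordMap]
    rw [this, pairMap]
    simp
  add_mem' {f g} hf hg a := by
    have : wordMap (f + g) = wordMap f + wordMap g := by simp [wordMap, LinearMap.add_comp]
    rw [add_apply, map_add, hf a, hg a, this]
    simp [pairMap, TensorProduct.map_add_left]
  smul_mem' r f hf a := by
    have : wordMap (r • f) = r • wordMap f := by simp [wordMap, LinearMap.smul_comp]
    rw [smul_apply, map_smul, hf a, this]
    simp [pairMap, TensorProduct.map_smul_left]

theorem circ_mem_colinear {m n N : ℕ} (h : N + 1 = m + n) {f : Cochain k A A m}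
    {g : Cochain k A A n} (hf : f ∈ colinear k A m) (hg : g ∈ colinear k A n) :
    circ h f g ∈ colinear k A N :=
  Submodule.sum_mem _ fun i _ => Submodule.smul_mem _ _ (IsColinear.insertAt h i hf hg)

theorem cochainBracket_mem_colinear {m n N : ℕ} (h : N + 1 = m + n) {f : Cochain k A A m}
    {g : Cochain k A A n} (hf : f ∈ colinear k A m) (hg : g ∈ colinear k A n) :
    cochainBracket h f g ∈ colinear k A N :=
  Submodule.sub_mem _ (circ_mem_colinear h hf hg)
    (Submodule.smul_mem _ _ (circ_mem_colinear _ hg hf))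

/-- Both sides are `∑ w(t₁) π(t₂) ⊗ π(t₃)`, where `π` is the product of the letters:
coassociativity, and `π` is a coalgebra map. -/
theorem comul_conv_wordProd (w : TensorAlgebra k A →ₗ[k] k) (t : TensorAlgebra k A) :
    Coalgebra.comul (R := k)
        (conv (Algebra.linearMap k A ∘ₗ w) (wordProd k A).toLinearMap t) =
      TensorProduct.map (conv (Algebra.linearMap k A ∘ₗ w) (wordProd k A).toLinearMap)
        (wordProd k A).toLinearMap (Coalgebra.comul (R := k) t) := by
  let Q : TensorAlgebra k A ⊗[k] (TensorAlgebra k A ⊗[k] TensorAlgebra k A) →ₗ[k] A ⊗[k] A :=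
    (TensorProduct.lid k (A ⊗[k] A)).toLinearMap ∘ₗ TensorProduct.map w
      (TensorProduct.map (wordProd k A).toLinearMap (wordProd k A).toLinearMap)
  have h1 : ∀ z, Coalgebra.comul (R := k) (rightMul k A A (TensorProduct.map
      (Algebra.linearMap k A ∘ₗ w) (wordProd k A).toLinearMap z)) =
      Q (Coalgebra.comul.lTensor _ z) := by
    intro z
    induction z with
    | zero => simp
    | add x y hx hy => simp only [map_add, hx, hy]
    | tmul x y =>
      simp [Q, rightMul_tmul, rightAct_self, ← Algebra.smul_def, comul_wordProd]
  have h2 : ∀ z, TensorProduct.map (conv (Algebra.linearMap k A ∘ₗ w) (wordProd k A).toLinearMap)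
      (wordProd k A).toLinearMap z =
      Q (TensorProduct.assoc k _ _ _ (Coalgebra.comul.rTensor _ z)) := by
    intro z
    induction z with
    | zero => simp
    | add x y hx hy => simp only [map_add, hx, hy]
    | tmul x y =>
      simp only [TensorProduct.map_tmul, LinearMap.rTensor_tmul, conv, LinearMap.comp_apply]
      generalize Coalgebra.comul (R := k) x = s
      induction s with
      | zero => simp
      | add p q hp hq => simp only [map_add, TensorProduct.add_tmul, hp, hq]
      | tmul p q =>
        simp [Q, rightMul_tmul, rightAct_self, ← Algebra.smul_def, TensorProduct.smul_tmul']
  rw [h2, Coalgebra.coassoc_apply, ← h1]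
  rfl

theorem embed_eq {n : ℕ} (φ : TrivCochain k A (Triv k A) n) :
    embed k A n φ = convCochain ((Algebra.linearMap k A ∘ₗ
      (resEquiv (rtHom k A) (Triv k A)).symm.toLinearMap : _ →ₗ[k] A).compMultilinearMap φ)
        (wordProd k A).toLinearMap := rfl

theorem embed_mem_colinear {n : ℕ} (φ : TrivCochain k A (Triv k A) n) :
    embed k A n φ ∈ colinear k A n := by
  intro a
  let φ' : MultilinearMap k (fun _ : Fin n => A) k :=
    ((resEquiv (rtHom k A) (Triv k A)).symm.toLinearMap : _ →ₗ[k] k).compMultilinearMap φ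
  have h : wordMap (embed k A n φ) =
      conv (Algebra.linearMap k A ∘ₗ wordMap φ') (wordProd k A).toLinearMap := by
    rw [embed_eq, wordMap_convCochain]
    congr 1
    apply tensorAlgebra_linearMap_ext
    intro m b
    by_cases hm : m = n
    · subst hm
      rw [LinearMap.comp_apply, wordMap_tprod, wordMap_tprod]
      rfl
    · rw [LinearMap.comp_apply, wordMap_tprod_of_ne _ _ hm, wordMap_tprod_of_ne _ _ hm, map_zero]
  rw [← wordMap_tprod (embed k A n φ), ← map_comul_tprod, h, comul_conv_wordProd]

/-- The composite of a Hochschild cochain with the counit. -/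
def counitCochain {n : ℕ} (f : Cochain k A A n) : TrivCochain k A (Triv k A) n :=
  ((counitMap k A).restrictScalars k).compMultilinearMap f

theorem hochschildD_counitCochain {n : ℕ} {f : Cochain k A A n} (hf : hochschildD k A A n f = 0) :
    hochschildD k A _ n (counitCochain f) = 0 := by
  rw [counitCochain, hochschildD_comp, hf]
  ext a
  exact map_zero (counitMap k A)

/-- A colinear cochain is determined by its composite with the counit. -/
theorem embed_counitCochain {n : ℕ} {f : Cochain k A A n} (hf : f ∈ colinear k A n) :
    embed k A n (counitCochain f) = f := by
  refine MultilinearMap.ext fun a : Fin n → A => ?_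
  have h : twist ((Algebra.linearMap k A ∘ₗ
      (resEquiv (rtHom k A) (Triv k A)).symm.toLinearMap : _ →ₗ[k] A).compMultilinearMap
        (counitCochain f)) = ((TensorProduct.lid k A).toLinearMap ∘ₗ
          Coalgebra.counit.rTensor A).compMultilinearMap
            (pairMap (wordMap f) (wordProd k A).toLinearMap n) := by
    apply multilinearMap_tmul_ext
    intro p q
    rw [twist_tmul, LinearMap.compMultilinearMap_apply, LinearMap.compMultilinearMap_apply,
      pairMap_tmul, wordMap_tprod, AlgHom.toLinearMap_apply, wordProd_tprod, LinearMap.comp_apply,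
      LinearMap.rTensor_tmul, LinearEquiv.coe_coe, TensorProduct.lid_tmul, rightAct_self,
      Algebra.smul_def]
    rfl
  rw [embed_eq, convCochain_wordProd_apply, h, LinearMap.compMultilinearMap_apply, ← hf a,
    LinearMap.comp_apply, Coalgebra.rTensor_counit_comul, LinearEquiv.coe_coe,
    TensorProduct.lid_tmul, one_smul]

/-- The bracket of two classes from the cohomology of the Hopf algebra vanishes. -/
theorem cochainBracket_embed_mem_coboundaries [Coalgebra.IsCocomm k A] (hk : ringChar k ≠ 2)
    {m n N : ℕ} (h : N + 1 = m + n) (hm : 0 < m) (hn : 0 < n)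
    {φ : TrivCochain k A (Triv k A) m} (hφ : hochschildD k A _ m φ = 0)
    {ψ : TrivCochain k A (Triv k A) n} (hψ : hochschildD k A _ n ψ = 0) :
    cochainBracket h (embed k A m φ) (embed k A n ψ) ∈ coboundaries (hochschildD k A A) N := by
  set b := cochainBracket h (embed k A m φ) (embed k A n ψ) with hb
  have hbc : b ∈ cocycles (hochschildD k A A) N :=
    cochainBracket_mem_cocycles h (embed_mem_cocycles hφ) (embed_mem_cocycles hψ)
  -- The bracket `b` is colinear, hence embedded, so the reversal fixes its class as well; `m, n ≥
  -- 1` makes its degree positive.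
  have h1 : antipodeReverse b - b ∈ coboundaries (hochschildD k A A) N := by
    have := antipodeReverse_embed_sub_mem_coboundaries (show 0 < N by omega)
      (hochschildD_counitCochain hbc)
    rwa [embed_counitCochain (cochainBracket_mem_colinear h (embed_mem_colinear φ)
      (embed_mem_colinear ψ))] at this
  have h2 := cochainBracket_sub_mem_coboundaries h hm hn (embed_mem_cocycles hφ)
    (hochschildD_antipodeReverse_eq_zero (embed_mem_cocycles hψ))
    (antipodeReverse_embed_sub_mem_coboundaries hm hφ)
    (antipodeReverse_embed_sub_mem_coboundaries hn hψ)
  rw [antipodeReverse_cochainBracket] at h1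
  -- With `X = [Tf, Tg]` and `Y = b`, the two relations put `-X - Y` and `X - Y` among the
  -- coboundaries; their sum is `-2 Y`.
  have h3 := neg_mem (add_mem h1 h2)
  have h4 : (2 : k) ≠ 0 := Ring.two_ne_zero hk
  have h5 := smul_mem_coboundaries (2⁻¹ : k) h3
  convert h5 using 1
  rw [← hb]
  have h6 : ∀ X Y : Cochain k A A N, (2⁻¹ : k) • -(-X - Y + (X - Y)) = Y := by
    intro X Y
    have : -(-X - Y + (X - Y)) = (2 : k) • Y := by
      rw [two_smul]
      abel
    rw [this, smul_smul, inv_mul_cancel₀ h4, one_smul]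
  exact (h6 _ _).symm

end Colinear
end HopfGerstenhaber

end

/-! ### The bracket on Hopf algebra cohomology -/

theorem corollary4p2 {k : Type u} [Field k] (hk : ringChar k ≠ 2)
    {A : Type v} [Ring A] [HopfAlgebra k A] [Coalgebra.IsCocomm k A]
    (P : HopfGerstenhaber.ProjRes.{u, v, w} k A) {m n N : ℕ} (hm : 0 < m) (hn : 0 < n)
    (h : N + 1 = m + n)
    (α : HopfGerstenhaber.HopfCoh P (HopfGerstenhaber.Triv k A) m)
    (β : HopfGerstenhaber.HopfCoh P (HopfGerstenhaber.Triv k A) n)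
    (z : HopfGerstenhaber.HH k A N) :
    HopfGerstenhaber.IsHopfBracket h α β z ↔ z = 0 := by
  obtain ⟨σ, h₀, hσ⟩ := P.exists_leftBar_lift
  obtain ⟨p, rfl⟩ := HopfGerstenhaber.cohClass_surjective _ α
  obtain ⟨q, rfl⟩ := HopfGerstenhaber.cohClass_surjective _ β
  have hp := HopfGerstenhaber.hochschildD_pullCochain_eq_zero hσ p.2
  have hq := HopfGerstenhaber.hochschildD_pullCochain_eq_zero hσ q.2
  have hpq := HopfGerstenhaber.cochainBracket_embed_mem_coboundaries hk h hm hn hp hq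
  constructor
  -- The lifts and representatives are arbitrary here; both cocycles are replaced by embedded ones
  -- up to coboundaries.
  · rintro ⟨x, y, hx, hy, f, g, b, rfl, rfl, hb, rfl⟩
    have hf := HopfGerstenhaber.sub_embed_mem_coboundaries h₀ hσ hm p f hx
    have hg := HopfGerstenhaber.sub_embed_mem_coboundaries h₀ hσ hn q g hy
    rw [HopfGerstenhaber.cohClass_eq_zero_iff, hb]
    have := add_mem (HopfGerstenhaber.cochainBracket_sub_mem_coboundaries h hm hn
      (HopfGerstenhaber.embed_mem_cocycles hp) g.2 hf hg) hpq
    rwa [sub_add_cancel] at this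
  -- Conversely `0` is attained: the embedded cocycles themselves serve as representatives, and
  -- their bracket is a coboundary.
  · rintro rfl
    refine ⟨_, _, HopfGerstenhaber.isHochschildImage_embed h₀ hσ hm p
        ⟨_, HopfGerstenhaber.embed_mem_cocycles hp⟩ rfl,
      HopfGerstenhaber.isHochschildImage_embed h₀ hσ hn q
        ⟨_, HopfGerstenhaber.embed_mem_cocycles hq⟩ rfl, _, _,
      ⟨_, HopfGerstenhaber.cochainBracket_mem_cocycles h
        (HopfGerstenhaber.embed_mem_cocycles hp) (HopfGerstenhaber.embed_mem_cocycles hq)⟩,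
      rfl, rfl, rfl, ?_⟩
    rw [HopfGerstenhaber.cohClass_eq_zero_iff]
    exact hpq
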